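/- **Problems.** All metric spaces are finite with rational distances; an instance is given by its distance matrix, the explicit list of its points, and its numerical parameters, all numbers in binary. *Pairwise Fair $k$-Median with $\ell$ disjoint groups.* Given are a finite metric space $(\Omega,d)$, finitely many points, each placed at a location of $\Omega$ (several points may share a location) and belonging to exactly one of the groups $P_1,\dots,P_\ell$, and integers $k\ge 0$ and $t\ge 1$. A feasible solution consists of at most $k$ clusters $X_1,X_2,\dots$ partitioning the points (clusters may be empty), with centers $c_1,c_2,\dots\in\Omega$, such that $|X_j\cap P_a|\le t\,|X_j\cap P_b|$ for every cluster $X_j$ and all $a,b\in\{1,\dots,\ell\}$. Its cost, to be minimized, is $\sum_j\sum_{p\in X_j} d(p,c_j)$. *Soft Uniform Capacitated $k$-Median.* Given are a finite metric space $(X,d)$ and integers $k,u\ge 0$. A feasible solution consists of at most $k$ facilities $f_1,f_2,\dots\in X$ (several facilities may be at the same location) and an assignment of each point $x\in X$ to a facility $f_{a(x)}$ such that at most $u$ points are assigned to each facility. Its cost, to be minimized, is $\sum_{x\in X} d(x,f_{a(x)})$. A *polynomial-time $\alpha$-approximation algorithm* for one of these problems runs on every instance in time polynomial in the length of the instance and,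 on every instance that has a feasible solution, returns a feasible solution of cost at most $\alpha$ times the minimum cost; here $\alpha\ge 1$ may be a constant or, more generally, any function $\alpha=\alpha(k)\ge 1$ of the parameter $k$ of the instance. **Theorem.** Assume that there is a polynomial-time $\alpha$-approximation algorithm for Pairwise Fair $k$-Median with $\ell=2$ disjoint groups. Then, for every constant $\varepsilon>0$, there is a polynomial-time $(1+\varepsilon)\alpha$-approximation algorithm for Soft Uniform Capacitated $k$-Median. -/

import Mathlib

/-! ### A machine model: while-programs over binary trees, with running time -/

/-- Binary trees (S-expressions), the data that programs manipulate. -/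
inductive Data where
  | nil : Data
  | node : Data → Data → Data

namespace Data

/-- Number of nodes of a tree, leaves included. -/
def size : Data → ℕ
  | nil => 1
  | node l r => l.size + r.size + 1

/-- Left subtree; `nil` for the empty tree. -/
def left : Data → Data
  | nil => nil
  | node l _ => l

/-- Right subtree; `nil` for the empty tree. -/
def right : Data → Data
  | nil => nil
  | node _ r => r

/-- A list of trees as a right comb. -/
def ofList : List Data → Data
  | [] => nil
  | x :: xs => node x (ofList xs)

def ofBool : Bool → Data
  | false => nil
  | true => node nil nil

/-- Natural numbers in binary, least significant bit first. -/
def ofNat (n : ℕ) : Data :=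
  ofList (n.bits.map ofBool)

/-- Nonnegative rationals as numerator and denominator in binary, in lowest terms. -/
def ofNNRat (q : ℚ≥0) : Data :=
  node (ofNat q.num) (ofNat q.den)

/-- A function on `{0, …, n - 1}` as the list of its values. -/
def ofFn {n : ℕ} (f : Fin n → Data) : Data :=
  ofList (List.ofFn f)

end Data

/-- A memory state: the contents of the variables `0, 1, 2, …`. -/
abbrev Store := ℕ → Data

/-- Expressions of the programming language. -/
inductive Expr where
  | var : ℕ → Expr
  | nil : Expr
  | node : Expr → Expr → Expr
  | left : Expr → Expr
  | right : Expr → Expr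

namespace Expr

def eval (s : Store) : Expr → Data
  | var x => s x
  | nil => Data.nil
  | node a b => Data.node (a.eval s) (b.eval s)
  | left a => (a.eval s).left
  | right a => (a.eval s).right

/-- Time to evaluate an expression: every operation costs the size of the tree it produces, so
that unbounded copying of trees is never free. -/
def time (s : Store) : Expr → ℕ
  | var x => (s x).size
  | nil => 1
  | node a b => a.time s + b.time s + (Data.node (a.eval s) (b.eval s)).size
  | left a => a.time s + (a.eval s).left.size
  | right a => a.time s + (a.eval s).right.size

end Expr

/-- While-programs. A test succeeds when its expression is not `nil`. -/
inductive Prog where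
  | assign : ℕ → Expr → Prog
  | seq : Prog → Prog → Prog
  | cond : Expr → Prog → Prog → Prog
  | loop : Expr → Prog → Prog

/-- `Exec c s s' m`: started in the state `s`, the program `c` halts in the state `s'`
after time `m`. -/
inductive Exec : Prog → Store → Store → ℕ → Prop where
  | assign (x : ℕ) (e : Expr) (s : Store) :
      Exec (.assign x e) s (Function.update s x (e.eval s)) (e.time s + 1)
  | seq {c₁ c₂ : Prog} {s₁ s₂ s₃ : Store} {m₁ m₂ : ℕ} :
      Exec c₁ s₁ s₂ m₁ → Exec c₂ s₂ s₃ m₂ → Exec (.seq c₁ c₂) s₁ s₃ (m₁ + m₂)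
  | cond_true {e : Expr} {c₁ c₂ : Prog} {s s' : Store} {m : ℕ} :
      e.eval s ≠ Data.nil → Exec c₁ s s' m → Exec (.cond e c₁ c₂) s s' (e.time s + 1 + m)
  | cond_false {e : Expr} {c₁ c₂ : Prog} {s s' : Store} {m : ℕ} :
      e.eval s = Data.nil → Exec c₂ s s' m → Exec (.cond e c₁ c₂) s s' (e.time s + 1 + m)
  | loop_true {e : Expr} {c : Prog} {s₁ s₂ s₃ : Store} {m₁ m₂ : ℕ} :
      e.eval s₁ ≠ Data.nil → Exec c s₁ s₂ m₁ → Exec (.loop e c) s₂ s₃ m₂ →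
        Exec (.loop e c) s₁ s₃ (e.time s₁ + 1 + m₁ + m₂)
  | loop_false {e : Expr} {c : Prog} {s : Store} :
      e.eval s = Data.nil → Exec (.loop e c) s s (e.time s + 1)

/-- The initial state: the input is in variable `0`, all other variables are empty. -/
def Store.init (x : Data) : Store :=
  fun i => if i = 0 then x else Data.nil

/-- On input `x` the program `c` halts after time `m` with output `y` (in variable `0`). -/
def Prog.Outputs (c : Prog) (x y : Data) (m : ℕ) : Prop :=
  ∃ s : Store, Exec c (Store.init x) s m ∧ s 0 = y

/-! ### Minimization problems and polynomial-time approximation -/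

/-- A minimization problem: instances, feasible solutions of each instance, their costs, and
the encodings of instances and solutions. -/
structure MinProblem where
  Inst : Type
  Sol : Inst → Type
  cost : (I : Inst) → Sol I → ℚ≥0
  encInst : Inst → Data
  encSol : (I : Inst) → Sol I → Data

/-- There is a program that halts on every instance in time polynomial in the size of the
encoded instance, and that, on every instance `I` that has a feasible solution, outputs a
feasible solution whose cost is at most `α I` times the cost of every feasible solution. -/
def MinProblem.HasPolyTimeApprox (Q : MinProblem) (α : Q.Inst → ℝ) : Prop :=
  ∃ (c : Prog) (p : Polynomial ℕ), ∀ I : Q.Inst, ∃ (y : Data) (m : ℕ),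
    c.Outputs (Q.encInst I) y m ∧ m ≤ p.eval (Q.encInst I).size ∧
    (Nonempty (Q.Sol I) →
      ∃ S : Q.Sol I, y = Q.encSol I S ∧ ∀ S' : Q.Sol I, (Q.cost I S : ℝ) ≤ α I * Q.cost I S')

/-! ### The two clustering problems -/

/-- A finite metric space on the points `0, …, n - 1` with rational distances. -/
structure FinMetric where
  n : ℕ
  dist : Fin n → Fin n → ℚ≥0
  dist_eq_zero : ∀ x y, dist x y = 0 ↔ x = y
  dist_comm : ∀ x y, dist x y = dist y x
  dist_triangle : ∀ x y z, dist x z ≤ dist x y + dist y z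

/-- The distance matrix, row by row. -/
def FinMetric.encode (X : FinMetric) : Data :=
  Data.ofFn fun x => Data.ofFn fun y => Data.ofNNRat (X.dist x y)

/-- An instance of pairwise fair `k`-median with `ℓ` disjoint groups: a metric space of
locations, `N` points, each with a location (several points may share one) and a group, the
number `k` of clusters and the balance parameter `t`. -/
structure PairwiseFairInst (ℓ : ℕ) where
  space : FinMetric
  N : ℕ
  loc : Fin N → Fin space.n
  group : Fin N → Fin ℓ
  k : ℕ
  t : ℕ
  one_le_t : 1 ≤ t

def PairwiseFairInst.encode {ℓ : ℕ} (I : PairwiseFairInst ℓ) : Data :=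
  .node I.space.encode
    (.node (Data.ofFn fun p => .node (Data.ofNat (I.loc p)) (Data.ofNat (I.group p)))
      (.node (Data.ofNat I.k) (Data.ofNat I.t)))

/-- A pairwise fair clustering: at most `k` clusters with their centers, and an assignment of
the points to the clusters, such that in every cluster the number of points of any group is at
most `t` times (and hence at least `1 / t` times) that of any other group. -/
structure PairwiseFairSol {ℓ : ℕ} (I : PairwiseFairInst ℓ) where
  numClusters : ℕ
  numClusters_le : numClusters ≤ I.k
  center : Fin numClusters → Fin I.space.n
  assign : Fin I.N → Fin numClusters
  fair : ∀ (j : Fin numClusters) (a b : Fin ℓ),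
    (Finset.univ.filter fun p => assign p = j ∧ I.group p = a).card ≤
      I.t * (Finset.univ.filter fun p => assign p = j ∧ I.group p = b).card

/-- Pairwise fair `k`-median with `ℓ` disjoint groups. -/
def pairwiseFairKMedian (ℓ : ℕ) : MinProblem where
  Inst := PairwiseFairInst ℓ
  Sol := PairwiseFairSol
  cost I S := ∑ p, I.space.dist (I.loc p) (S.center (S.assign p))
  encInst I := I.encode
  encSol _ S := .node (Data.ofFn fun j => Data.ofNat (S.center j))
    (Data.ofFn fun p => Data.ofNat (S.assign p))

/-- An instance of soft uniform capacitated `k`-median: a metric space, whose points are both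
the clients and the possible facility locations, the number `k` of facilities and the
capacity `u`. -/
structure SoftCkMInst where
  space : FinMetric
  k : ℕ
  u : ℕ

def SoftCkMInst.encode (I : SoftCkMInst) : Data :=
  .node I.space.encode (.node (Data.ofNat I.k) (Data.ofNat I.u))

/-- At most `k` facilities, several of which may be at the same location, and an assignment of
all points to the facilities with at most `u` points at each facility. -/
structure SoftCkMSol (I : SoftCkMInst) where
  numFacilities : ℕ
  numFacilities_le : numFacilities ≤ I.k
  facility : Fin numFacilities → Fin I.space.n
  assign : Fin I.space.n → Fin numFacilities
  capacity : ∀ j : Fin numFacilities, (Finset.univ.filter fun x => assign x = j).card ≤ I.u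

/-- Soft uniform capacitated `k`-median. -/
def softCapacitatedKMedian : MinProblem where
  Inst := SoftCkMInst
  Sol := SoftCkMSol
  cost I S := ∑ x, I.space.dist x (S.facility (S.assign x))
  encInst I := I.encode
  encSol _ S := .node (Data.ofFn fun j => Data.ofNat (S.facility j))
    (Data.ofFn fun x => Data.ofNat (S.assign x))

/-!
Replace every client by `2 ^ r` copies in the first group, add at most `k` points in the second
group, and let the balance parameter be `u * 2 ^ r`. In a fair clustering the clusters centered at
`c` contain, together, at most `u * 2 ^ r` copies for each of their `b` points of the second group.
Consider the multigraph with an edge from each copy's client to its center. An orientation in which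
in- and out-degrees differ by at most one splits the edges into two halves with halved degrees, of
which the cheaper one is kept. After `r` halvings one edge is left at each client and at most
`b * u` edges at `c`, so that `b` facilities at `c` suffice.

The points of the second group pay at most `n` times the largest distance. To make this negligible,
the distances are truncated just above the cost `F` of an explicit solution: the cheapest one among
those that send every client to a representative of its component in a threshold graph. If the
threshold is the largest distance in an optimal solution, then each facility serves clients of a
single component and components have diameter at most `n` times the threshold, whence `F` is at
most `n ^ 2` times the optimum. Taking `2 ^ r ≥ n ^ 3 * 2 ^ c` with `2 ≤ ε * 2 ^ c` absorbs the
error `n * (F + 1)`.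
-/

theorem Data.one_le_size (x : Data) : 1 ≤ x.size := by
  cases x <;> simp [Data.size]

theorem Data.size_left_le (x : Data) : x.left.size ≤ x.size := by
  cases x with
  | nil => rfl
  | node l r => simp only [Data.size, Data.left]; omega

theorem Data.size_right_le (x : Data) : x.right.size ≤ x.size := by
  cases x with
  | nil => rfl
  | node l r => simp only [Data.size, Data.right]; omega

namespace Expr

/-- Renaming of the variables of an expression. -/
def rename (ρ : ℕ → ℕ) : Expr → Expr
  | var x => var (ρ x)
  | nil => nil
  | node a b => node (a.rename ρ) (b.rename ρ)
  | left a => left (a.rename ρ)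
  | right a => right (a.rename ρ)

theorem eval_rename (ρ : ℕ → ℕ) (s : Store) (e : Expr) :
    (e.rename ρ).eval s = e.eval (s ∘ ρ) := by
  induction e <;> simp_all [rename, eval]

theorem time_rename (ρ : ℕ → ℕ) (s : Store) (e : Expr) :
    (e.rename ρ).time s = e.time (s ∘ ρ) := by
  induction e <;> simp_all [rename, time, eval_rename]

theorem size_eval_le_time (s : Store) (e : Expr) : (e.eval s).size ≤ e.time s := by
  cases e <;> simp [eval, time, Data.size]

/-- The expression without variables that evaluates to a given tree. -/
def const : Data → Expr
  | .nil => .nil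
  | .node l r => .node (const l) (const r)

theorem eval_const (s : Store) (x : Data) : (const x).eval s = x := by
  induction x <;> simp_all [const, eval]

theorem time_const (s s' : Store) (x : Data) : (const x).time s = (const x).time s' := by
  induction x <;> simp_all [const, time, eval_const]

end Expr

namespace Prog

/-- Renaming of the variables of a program. -/
def rename (ρ : ℕ → ℕ) : Prog → Prog
  | assign x e => assign (ρ x) (e.rename ρ)
  | seq a b => seq (a.rename ρ) (b.rename ρ)
  | cond e a b => cond (e.rename ρ) (a.rename ρ) (b.rename ρ)
  | loop e a => loop (e.rename ρ) (a.rename ρ)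

/-- A strict upper bound on the variables that a program writes. -/
def bound : Prog → ℕ
  | assign x _ => x + 1
  | seq a b => max a.bound b.bound
  | cond _ a b => max a.bound b.bound
  | loop _ a => a.bound

/-- The program that empties the variables `1, …, b`. -/
def clear : ℕ → Prog
  | 0 => loop .nil (assign 0 .nil)
  | b + 1 => seq (clear b) (assign (b + 1) .nil)

end Prog

namespace Exec

variable {c : Prog} {s s' : Store} {m : ℕ}

theorem rename {ρ : ℕ → ℕ} (hρ : Function.Injective ρ) (r : Store) (h : Exec c s s' m) :
    Exec (c.rename ρ) (Function.extend ρ s r) (Function.extend ρ s' r) m := by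
  have eval_eq (e : Expr) (s : Store) : (e.rename ρ).eval (Function.extend ρ s r) = e.eval s := by
    rw [Expr.eval_rename, Function.extend_comp hρ]
  have time_eq (e : Expr) (s : Store) : (e.rename ρ).time (Function.extend ρ s r) = e.time s := by
    rw [Expr.time_rename, Function.extend_comp hρ]
  induction h with
  | assign x e s =>
    have update_eq : Function.extend ρ (Function.update s x (e.eval s)) r =
        Function.update (Function.extend ρ s r) (ρ x) (e.eval s) := by
      funext j
      by_cases hj : ∃ i, ρ i = j
      · obtain ⟨i, rfl⟩ := hj
        simp only [hρ.extend_apply, Function.update_apply, hρ.eq_iff]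
      · rw [Function.update_of_ne (by rintro rfl; exact hj ⟨x, rfl⟩),
          Function.extend_apply' _ _ _ hj, Function.extend_apply' _ _ _ hj]
    have := Exec.assign (ρ x) (e.rename ρ) (Function.extend ρ s r)
    rwa [eval_eq, time_eq, ← update_eq] at this
  | seq _ _ ih₁ ih₂ => exact .seq ih₁ ih₂
  | cond_true ne_nil _ ih => rw [← time_eq]; exact .cond_true (by rwa [eval_eq]) ih
  | cond_false eq_nil _ ih => rw [← time_eq]; exact .cond_false (by rwa [eval_eq]) ih
  | loop_true ne_nil _ _ ih₁ ih₂ => rw [← time_eq]; exact .loop_true (by rwa [eval_eq]) ih₁ ih₂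
  | loop_false eq_nil => rw [← time_eq]; exact .loop_false (by rwa [eval_eq])

theorem eq_of_bound_le (h : Exec c s s' m) {j : ℕ} (hj : c.bound ≤ j) : s' j = s j := by
  induction h with
  | assign x e s => exact Function.update_of_ne (by simp only [Prog.bound] at hj; omega) _ _
  | seq _ _ ih₁ ih₂ =>
    have hj := max_le_iff.1 hj
    exact (ih₂ hj.2).trans (ih₁ hj.1)
  | cond_true _ _ ih => exact ih (max_le_iff.1 hj).1
  | cond_false _ _ ih => exact ih (max_le_iff.1 hj).2
  | loop_true _ _ _ ih₁ ih₂ => exact (ih₂ hj).trans (ih₁ hj)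
  | loop_false _ => rfl

theorem size_le (h : Exec c s s' m) (j : ℕ) : (s' j).size ≤ (s j).size + m := by
  induction h with
  | assign x e s =>
    by_cases hj : j = x
    · subst hj
      have := e.size_eval_le_time s
      simp only [Function.update_self]
      omega
    · rw [Function.update_of_ne hj]
      omega
  | seq => omega
  | cond_true => omega
  | cond_false => omega
  | loop_true => omega
  | loop_false => omega

theorem clear (b : ℕ) (s : Store) :
    Exec (Prog.clear b) s (fun j => if 1 ≤ j ∧ j ≤ b then Data.nil else s j) (2 + 2 * b) := by
  induction b with
  | zero =>
    have h : Exec (Prog.clear 0) s s 2 := .loop_false rfl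
    convert h using 1
    funext j
    rw [if_neg (by omega)]
  | succ b ih =>
    have h : Exec (Prog.clear (b + 1)) s _ (2 + 2 * b + (1 + 1)) :=
      .seq ih (.assign (b + 1) .nil _)
    convert h using 1
    · funext j
      simp only [Function.update_apply, Expr.eval]
      grind
    · omega

end Exec

theorem Prog.Outputs.exec_init {c : Prog} {x y : Data} {m : ℕ} (h : c.Outputs x y m) :
    Exec (.seq c (.clear c.bound)) (Store.init x) (Store.init y) (m + (2 + 2 * c.bound)) := by
  obtain ⟨s, hs, rfl⟩ := h
  convert Exec.seq hs (Exec.clear c.bound s) using 1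
  funext j
  have untouched : c.bound ≤ j → s j = Store.init x j := hs.eq_of_bound_le
  simp only [Store.init] at *
  grind

/-- A store with given contents of the variables `0`, `1`, `2` and `4`, all others being empty.
A subprogram that computes on the odd variables has its input and output in variable `1`. -/
def Store.regs (x₀ x₁ x₂ x₄ : Data) : Store := fun i =>
  if i = 0 then x₀ else if i = 1 then x₁ else if i = 2 then x₂ else if i = 4 then x₄ else .nil

theorem Store.regs_zero (x₀ x₁ x₂ x₄ : Data) : Store.regs x₀ x₁ x₂ x₄ 0 = x₀ := rfl

theorem Store.regs_one (x₀ x₁ x₂ x₄ : Data) : Store.regs x₀ x₁ x₂ x₄ 1 = x₁ := rfl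

theorem Store.regs_two (x₀ x₁ x₂ x₄ : Data) : Store.regs x₀ x₁ x₂ x₄ 2 = x₂ := rfl

theorem Store.regs_four (x₀ x₁ x₂ x₄ : Data) : Store.regs x₀ x₁ x₂ x₄ 4 = x₄ := rfl

theorem Store.init_eq_regs (x : Data) : Store.init x = Store.regs x .nil .nil .nil := by
  funext j
  simp [Store.init, Store.regs]

namespace Exec

variable {e : Expr} {x₀ x₁ x₂ x₄ : Data}

theorem assign_zero : Exec (.assign 0 e) (.regs x₀ x₁ x₂ x₄)
    (.regs (e.eval (.regs x₀ x₁ x₂ x₄)) x₁ x₂ x₄) (e.time (.regs x₀ x₁ x₂ x₄) + 1) := by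
  convert Exec.assign 0 e (.regs x₀ x₁ x₂ x₄)
  funext j
  grind [Store.regs, Function.update_apply]

theorem assign_one : Exec (.assign 1 e) (.regs x₀ x₁ x₂ x₄)
    (.regs x₀ (e.eval (.regs x₀ x₁ x₂ x₄)) x₂ x₄) (e.time (.regs x₀ x₁ x₂ x₄) + 1) := by
  convert Exec.assign 1 e (.regs x₀ x₁ x₂ x₄)
  funext j
  grind [Store.regs, Function.update_apply]

theorem assign_two : Exec (.assign 2 e) (.regs x₀ x₁ x₂ x₄)
    (.regs x₀ x₁ (e.eval (.regs x₀ x₁ x₂ x₄)) x₄) (e.time (.regs x₀ x₁ x₂ x₄) + 1) := by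
  convert Exec.assign 2 e (.regs x₀ x₁ x₂ x₄)
  funext j
  grind [Store.regs, Function.update_apply]

theorem assign_four : Exec (.assign 4 e) (.regs x₀ x₁ x₂ x₄)
    (.regs x₀ x₁ x₂ (e.eval (.regs x₀ x₁ x₂ x₄))) (e.time (.regs x₀ x₁ x₂ x₄) + 1) := by
  convert Exec.assign 4 e (.regs x₀ x₁ x₂ x₄)
  funext j
  grind [Store.regs, Function.update_apply]

variable {c : Prog} {x y : Data} {m : ℕ}

theorem regs_even (h : Exec c (.init x) (.init y) m) :
    Exec (c.rename (2 * ·)) (.regs x x₁ .nil .nil) (.regs y x₁ .nil .nil) m := by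
  have extend_eq (z : Data) : Function.extend (2 * ·) (Store.init z) (Store.regs x x₁ .nil .nil) =
      Store.regs z x₁ .nil .nil := by
    funext j
    obtain ⟨i, rfl | rfl⟩ := j.even_or_odd'
    · rw [(mul_right_injective₀ two_ne_zero).extend_apply]
      grind [Store.regs, Store.init]
    · rw [Function.extend_apply' _ _ _ (by rintro ⟨a, ha⟩; omega)]
      grind [Store.regs]
  simpa only [extend_eq] using h.rename (mul_right_injective₀ two_ne_zero) (.regs x x₁ .nil .nil)

theorem regs_odd (h : Exec c (.init x) (.init y) m) :
    Exec (c.rename (2 * · + 1)) (.regs x₀ x x₂ x₄) (.regs x₀ y x₂ x₄) m := by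
  have injective : Function.Injective (2 * · + 1) := fun a b hab => by simpa using hab
  have extend_eq (z : Data) : Function.extend (2 * · + 1) (Store.init z) (Store.regs x₀ x x₂ x₄) =
      Store.regs x₀ z x₂ x₄ := by
    funext j
    obtain ⟨i, rfl | rfl⟩ := j.even_or_odd'
    · rw [Function.extend_apply' _ _ _ (by rintro ⟨a, ha⟩; omega)]
      grind [Store.regs]
    · rw [injective.extend_apply]
      grind [Store.regs, Store.init]
  simpa only [extend_eq] using h.rename injective (.regs x₀ x x₂ x₄)

end Exec

/-- Types whose elements are represented by trees. -/
class Enc (α : Type) where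
  enc : α → Data

open Enc (enc)

instance : Enc Bool := ⟨Data.ofBool⟩

instance : Enc ℕ := ⟨Data.ofNat⟩

instance {α β : Type} [Enc α] [Enc β] : Enc (α × β) := ⟨fun p => .node (enc p.1) (enc p.2)⟩

instance {α : Type} [Enc α] : Enc (List α) := ⟨fun l => .ofList (l.map enc)⟩

instance {α : Type} [Enc α] {P : α → Prop} : Enc {a // P a} := ⟨fun a => enc a.1⟩

/-- The length of the encoding of `a`, the measure of input and output lengths. -/
def encSize {α : Type} [Enc α] (a : α) : ℕ := (enc a).size

section encSize

variable {α β : Type} [Enc α] [Enc β]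

theorem enc_prod (a : α) (b : β) : enc (a, b) = .node (enc a) (enc b) := rfl

theorem enc_cons (a : α) (l : List α) : enc (a :: l) = .node (enc a) (enc l) := rfl

theorem size_enc (a : α) : (enc a).size = encSize a := rfl

theorem one_le_encSize (a : α) : 1 ≤ encSize a := Data.one_le_size _

theorem encSize_prod (a : α) (b : β) : encSize (a, b) = encSize a + encSize b + 1 := rfl

theorem encSize_nil : encSize ([] : List α) = 1 := rfl

theorem encSize_cons (a : α) (l : List α) : encSize (a :: l) = encSize a + encSize l + 1 := rfl

theorem encSize_append (l l' : List α) : encSize (l ++ l') + 1 = encSize l + encSize l' := by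
  induction l with
  | nil => rw [List.nil_append, encSize_nil, add_comm]
  | cons a l ih => simp only [List.cons_append, encSize_cons]; omega

theorem length_lt_encSize (l : List α) : l.length < encSize l := by
  induction l with
  | nil => exact Nat.one_pos
  | cons a l ih => simp only [List.length_cons, encSize_cons]; omega

theorem encSize_lt_of_mem {a : α} {l : List α} (h : a ∈ l) : encSize a < encSize l := by
  induction l with
  | nil => exact absurd h List.not_mem_nil
  | cons b l ih =>
    rw [encSize_cons]
    rcases List.mem_cons.1 h with rfl | h
    · omega
    · have := ih h
      omega

theorem encSize_le_of_forall_mem_le {l : List α} {K : ℕ} (h : ∀ a ∈ l, encSize a ≤ K) :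
    encSize l ≤ l.length * (K + 1) + 1 := by
  induction l with
  | nil => simp [encSize_nil]
  | cons a l ih =>
    have head_le := h a List.mem_cons_self
    have tail_le := ih fun b hb => h b (List.mem_cons_of_mem a hb)
    rw [encSize_cons, List.length_cons, add_one_mul]
    omega

end encSize

theorem monotone_eval_nat (p : Polynomial ℕ) : Monotone fun n => p.eval n := by
  intro a b hab
  induction p using Polynomial.induction_on' with
  | add p q hp hq => simp only [Polynomial.eval_add] at *; omega
  | monomial n c => simp only [Polynomial.eval_monomial]; gcongr

/-- Functions bounded by a polynomial in the length of the encoded argument. -/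
def PolyBounded {α : Type} [Enc α] (f : α → ℕ) : Prop :=
  ∃ p : Polynomial ℕ, ∀ a, f a ≤ p.eval (encSize a)

namespace PolyBounded

variable {α β : Type} [Enc α] [Enc β] {f g : α → ℕ}

theorem mono (hg : PolyBounded g) (h : ∀ a, f a ≤ g a) : PolyBounded f := by
  obtain ⟨p, hp⟩ := hg
  exact ⟨p, fun a => (h a).trans (hp a)⟩

theorem const (n : ℕ) : PolyBounded fun _ : α => n :=
  ⟨.C n, fun _ => Polynomial.eval_C.ge⟩

theorem encSize : PolyBounded fun a : α => encSize a :=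
  ⟨.X, fun _ => Polynomial.eval_X.ge⟩

theorem add (hf : PolyBounded f) (hg : PolyBounded g) : PolyBounded fun a => f a + g a := by
  obtain ⟨p, hp⟩ := hf
  obtain ⟨q, hq⟩ := hg
  exact ⟨p + q, fun a => by simpa using add_le_add (hp a) (hq a)⟩

theorem mul (hf : PolyBounded f) (hg : PolyBounded g) : PolyBounded fun a => f a * g a := by
  obtain ⟨p, hp⟩ := hf
  obtain ⟨q, hq⟩ := hg
  exact ⟨p * q, fun a => by simpa using Nat.mul_le_mul (hp a) (hq a)⟩

theorem eval (p : Polynomial ℕ) (hf : PolyBounded f) : PolyBounded fun a => p.eval (f a) := by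
  obtain ⟨q, hq⟩ := hf
  exact ⟨p.comp q, fun a => by simpa using monotone_eval_nat p (hq a)⟩

theorem comp {f : β → ℕ} {g : α → β} (hf : PolyBounded f)
    (hg : PolyBounded fun a => _root_.encSize (g a)) : PolyBounded fun a => f (g a) := by
  obtain ⟨p, hp⟩ := hf
  exact (hg.eval p).mono fun a => hp _

end PolyBounded

/-- The program `c` computes `f` within time `t`. Only the output may remain in the memory, so
that programs can be run one after the other. -/
def Prog.Computes {α β : Type} [Enc α] [Enc β] (c : Prog) (f : α → β) (t : α → ℕ) : Prop :=
  ∀ a, ∃ m ≤ t a, Exec c (.init (enc a)) (.init (enc (f a))) m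

/-- Functions that are computed in polynomial time. -/
def PolyTime {α β : Type} [Enc α] [Enc β] (f : α → β) : Prop :=
  ∃ (c : Prog) (t : α → ℕ), PolyBounded t ∧ c.Computes f t

namespace PolyTime

variable {α β γ : Type} [Enc α] [Enc β] [Enc γ]

theorem encSize_bounded {f : α → β} (hf : PolyTime f) : PolyBounded fun a => encSize (f a) := by
  obtain ⟨c, t, ht, hc⟩ := hf
  refine (PolyBounded.encSize.add ht).mono fun a => ?_
  obtain ⟨m, hm, e⟩ := hc a
  have : encSize (f a) ≤ encSize a + m := e.size_le 0
  omega

theorem of_expr {f : α → β} (e : Expr) (he : ∀ a, e.eval (.init (enc a)) = enc (f a))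
    (ht : PolyBounded fun a : α => e.time (.init (enc a))) : PolyTime f := by
  refine ⟨.assign 0 e, _, ht.add (.const 1), fun a => ⟨_, le_rfl, ?_⟩⟩
  convert Exec.assign 0 e _ using 1
  funext j
  simp only [Store.init, Function.update_apply, ← he]
  split_ifs <;> rfl

theorem of_enc_eq {f : α → β} (h : ∀ a, enc (f a) = enc a) : PolyTime f :=
  of_expr (.var 0) (fun a => (h a).symm) .encSize

theorem congr {f g : α → β} (hg : PolyTime g) (h : ∀ a, f a = g a) : PolyTime f := by
  rwa [funext h]

theorem congr_enc {f : α → β} {g : α → γ} (hg : PolyTime g) (h : ∀ a, enc (f a) = enc (g a)) :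
    PolyTime f := by
  obtain ⟨c, t, ht, hc⟩ := hg
  exact ⟨c, t, ht, fun a => by rw [h a]; exact hc a⟩

theorem id : PolyTime fun a : α => a := of_enc_eq fun _ => rfl

theorem comp {f : β → γ} {g : α → β} (hf : PolyTime f) (hg : PolyTime g) :
    PolyTime fun a => f (g a) := by
  have size_bounded := hg.encSize_bounded
  obtain ⟨c, t, ht, hc⟩ := hf
  obtain ⟨c', t', ht', hc'⟩ := hg
  refine ⟨.seq c' c, _, ht'.add (ht.comp size_bounded), fun a => ?_⟩
  obtain ⟨m, hm, e⟩ := hc (g a)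
  obtain ⟨m', hm', e'⟩ := hc' a
  exact ⟨m' + m, by omega, .seq e' e⟩

theorem const (b : β) : PolyTime fun _ : α => b :=
  of_expr (.const (enc b)) (fun _ => Expr.eval_const _ _)
    ((PolyBounded.const _).mono fun _ => (Expr.time_const _ (.init .nil) _).le)

theorem pair {f : α → β} {g : α → γ} (hf : PolyTime f) (hg : PolyTime g) :
    PolyTime fun a => (f a, g a) := by
  have f_bounded := hf.encSize_bounded
  have g_bounded := hg.encSize_bounded
  obtain ⟨c, t, ht, hc⟩ := hf
  obtain ⟨c', t', ht', hc'⟩ := hg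
  refine ⟨.seq (.assign 1 (.var 0)) (.seq (c.rename (2 * · + 1)) (.seq (c'.rename (2 * ·))
    (.seq (.assign 0 (.node (.var 1) (.var 0))) (.assign 1 .nil)))), _,
    ((((PolyBounded.encSize.add ht).add ht').add f_bounded).add g_bounded).add
      (f_bounded.add (g_bounded.add (.const 5))), fun a => ?_⟩
  obtain ⟨m, hm, e⟩ := hc a
  obtain ⟨m', hm', e'⟩ := hc' a
  rw [Store.init_eq_regs, Store.init_eq_regs]
  refine ⟨_, ?_, .seq .assign_one (.seq e.regs_odd
    (.seq e'.regs_even (.seq .assign_zero .assign_one)))⟩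
  simp only [Expr.time, Expr.eval, Store.regs_zero, Store.regs_one, Data.size, size_enc]
  omega

theorem fst {f : α → β × γ} (hf : PolyTime f) : PolyTime fun a => (f a).1 :=
  comp (of_expr (f := fun p : β × γ => p.1) (.left (.var 0)) (fun _ => rfl)
    ((PolyBounded.encSize.add .encSize).mono fun _ =>
      Nat.add_le_add_left (Data.size_left_le _) _)) hf

theorem snd {f : α → β × γ} (hf : PolyTime f) : PolyTime fun a => (f a).2 :=
  comp (of_expr (f := fun p : β × γ => p.2) (.right (.var 0)) (fun _ => rfl)
    ((PolyBounded.encSize.add .encSize).mono fun _ =>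
      Nat.add_le_add_left (Data.size_right_le _) _)) hf

theorem dite {b : α → Bool} {f : {a // b a = true} → β} {g : α → β} (hb : PolyTime b)
    (hf : PolyTime f) (hg : PolyTime g) :
    PolyTime fun a => if h : b a = true then f ⟨a, h⟩ else g a := by
  have b_bounded := hb.encSize_bounded
  obtain ⟨c, t, ht, hc⟩ := hb
  obtain ⟨c₁, t₁, ⟨p₁, ht₁⟩, hc₁⟩ := hf
  obtain ⟨c₂, t₂, ht₂, hc₂⟩ := hg
  refine ⟨.seq (.assign 1 (.var 0)) (.seq (c.rename (2 * · + 1))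
    (.cond (.var 1) (.seq (.assign 1 .nil) c₁) (.seq (.assign 1 .nil) c₂))), _,
    (((PolyBounded.encSize.add ht).add ⟨p₁, fun _ => le_rfl⟩).add ht₂).add
      (b_bounded.add (.const 5)), fun a => ?_⟩
  obtain ⟨m, hm, e⟩ := hc a
  have init_eq := Store.init_eq_regs (enc a)
  by_cases h : b a = true
  · obtain ⟨m₁, hm₁, e₁⟩ := hc₁ ⟨a, h⟩
    have time_le : m₁ ≤ p₁.eval (encSize a) := hm₁.trans (ht₁ ⟨a, h⟩)
    change Exec c₁ (.init (enc a)) _ _ at e₁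
    rw [init_eq] at e₁
    simp only [dif_pos h, init_eq]
    refine ⟨_, ?_, .seq .assign_one (.seq e.regs_odd
      (.cond_true ?_ (.seq .assign_one e₁)))⟩
    · simp only [Expr.time, Store.regs_zero, Store.regs_one, size_enc]
      omega
    · simp [Expr.eval, Store.regs_one, h, enc, Data.ofBool]
  · obtain ⟨m₁, hm₁, e₁⟩ := hc₂ a
    rw [init_eq] at e₁
    simp only [dif_neg h, init_eq]
    refine ⟨_, ?_, .seq .assign_one (.seq e.regs_odd
      (.cond_false ?_ (.seq .assign_one e₁)))⟩
    · simp only [Expr.time, Store.regs_zero, Store.regs_one, size_enc]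
      omega
    · simp [Expr.eval, Store.regs_one, h, enc, Data.ofBool]

theorem subtype_val {P : α → Prop} : PolyTime fun a : {a // P a} => a.1 := of_enc_eq fun _ => rfl

theorem ite {P : α → Prop} [DecidablePred P] {f g : α → β} (hP : PolyTime fun a => decide (P a))
    (hf : PolyTime f) (hg : PolyTime g) : PolyTime fun a => if P a then f a else g a :=
  (dite hP (hf.comp subtype_val) hg).congr fun a => by
    by_cases h : P a <;> simp [h]

theorem bool_decide {b : α → Bool} (hb : PolyTime b) : PolyTime fun a => decide (b a = true) :=
  hb.congr fun _ => Bool.decide_eq_true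

theorem cons {f : α → β} {l : α → List β} (hf : PolyTime f) (hl : PolyTime l) :
    PolyTime fun a => f a :: l a :=
  (hf.pair hl).congr_enc fun _ => rfl

theorem tail {l : α → List β} (hl : PolyTime l) : PolyTime fun a => (l a).tail :=
  comp (of_expr (f := fun l : List β => l.tail) (.right (.var 0))
    (fun l => by cases l <;> rfl)
    ((PolyBounded.encSize.add .encSize).mono fun _ =>
      Nat.add_le_add_left (Data.size_right_le _) _)) hl

end PolyTime

namespace Prog

/-- One step of a left fold: variable `0` holds the remaining list, variable `2` the parameter
`x`, variable `4` the accumulator, and `c` computes the step function from `(x, s, a)`. -/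
def foldStep (c : Prog) : Prog :=
  .seq (.assign 1 (.node (.var 2) (.node (.var 4) (.left (.var 0))))) (.seq (c.rename (2 * · + 1))
    (.seq (.assign 4 (.var 1)) (.seq (.assign 1 .nil) (.assign 0 (.right (.var 0))))))

/-- The left fold of a list, on the input `(x, s, l)`; see `Prog.foldStep` for the memory. -/
def fold (c : Prog) : Prog :=
  .seq (.assign 2 (.left (.var 0))) (.seq (.assign 4 (.left (.right (.var 0))))
    (.seq (.assign 0 (.right (.right (.var 0)))) (.seq (.loop (.var 0) c.foldStep)
      (.seq (.assign 0 (.var 4)) (.seq (.assign 2 .nil) (.assign 4 .nil))))))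

end Prog

theorem encSize_foldl_le_of_forall_mem_le {α σ : Type} [Enc σ] {g : σ → α → σ} {K : ℕ} {l : List α}
    (h : ∀ s, ∀ a ∈ l, encSize (g s a) ≤ encSize s + K) (s : σ) :
    encSize (l.foldl g s) ≤ encSize s + l.length * K := by
  induction l generalizing s with
  | nil => simp
  | cons a l ih =>
    have head_le := h s a List.mem_cons_self
    have tail_le := ih (fun s b hb => h s b (List.mem_cons_of_mem a hb)) (g s a)
    rw [List.foldl_cons, List.length_cons, add_one_mul]
    omega

section foldl

variable {α γ σ : Type} [Enc α] [Enc γ] [Enc σ] {f : γ → σ → α → σ} {c : Prog}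
  {t : γ × σ × α → ℕ}

theorem Prog.Computes.exec_foldStep (hc : c.Computes (fun p => f p.1 p.2.1 p.2.2) t) (x : γ)
    (s : σ) (a : α) (l : List α) :
    ∃ m ≤ t (x, s, a) + encSize (f x s a) + 3 * (encSize x + encSize s) +
        5 * encSize (a :: l) + 10,
      Exec c.foldStep (.regs (enc (a :: l)) .nil (enc x) (enc s))
        (.regs (enc l) .nil (enc x) (enc (f x s a))) m := by
  obtain ⟨m, hm, e⟩ := hc (x, s, a)
  refine ⟨_, ?_, .seq .assign_one (.seq e.regs_odd (.seq .assign_four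
    (.seq .assign_one .assign_zero)))⟩
  simp only [Expr.time, Expr.eval, Store.regs_zero, Store.regs_one, Store.regs_two,
    Store.regs_four, enc_cons, Data.left, Data.right, Data.size, size_enc, encSize_cons]
  omega

theorem Prog.Computes.exec_loop_foldStep (hc : c.Computes (fun p => f p.1 p.2.1 p.2.2) t)
    {x : γ} {B T L : ℕ} {l : List α}
    (hT : ∀ s, encSize s ≤ B → ∀ a ∈ l, t (x, s, a) ≤ T) (hL : encSize l ≤ L) {s : σ}
    (hB : ∀ l', l' <+: l → encSize (l'.foldl (f x) s) ≤ B) :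
    ∃ m ≤ (l.length + 1) * (T + 6 * (encSize x + B + L) + 12),
      Exec (.loop (.var 0) c.foldStep) (.regs (enc l) .nil (enc x) (enc s))
        (.regs .nil .nil (enc x) (enc (l.foldl (f x) s))) m := by
  induction l generalizing s with
  | nil =>
    refine ⟨2, ?_, .loop_false rfl⟩
    rw [List.length_nil, zero_add, one_mul]
    omega
  | cons a l ih =>
    rw [encSize_cons] at hL
    obtain ⟨m, hm, e⟩ := ih (fun s hs b hb => hT s hs b (List.mem_cons_of_mem a hb)) (by omega)
      (s := f x s a) fun l' h => hB (a :: l') (List.cons_prefix_cons.2 ⟨rfl, h⟩)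
    obtain ⟨m₁, hm₁, e₁⟩ := hc.exec_foldStep x s a l
    have s_le : encSize s ≤ B := hB [] List.nil_prefix
    have step_le : encSize (f x s a) ≤ B := hB [a] (List.prefix_append [a] l)
    have time_le := hT s s_le a List.mem_cons_self
    refine ⟨_, ?_, .loop_true (by simp [Expr.eval, Store.regs_zero, enc_cons]) e₁ e⟩
    rw [encSize_cons] at hm₁
    rw [List.length_cons, add_one_mul (l.length + 1)]
    simp only [Expr.time, Store.regs_zero, size_enc, encSize_cons]
    omega

theorem Prog.Computes.exec_fold (hc : c.Computes (fun p => f p.1 p.2.1 p.2.2) t)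
    {x : γ} {s : σ} {l : List α} {B T : ℕ}
    (hT : ∀ s, encSize s ≤ B → ∀ a ∈ l, t (x, s, a) ≤ T)
    (hB : ∀ l', l' <+: l → encSize (l'.foldl (f x) s) ≤ B) :
    ∃ m ≤ encSize l * (T + 6 * (encSize x + B + encSize l) + 12) + 10 * encSize (x, s, l) + B + 10,
      Exec c.fold (.init (enc (x, s, l))) (.init (enc (l.foldl (f x) s))) m := by
  obtain ⟨m, hm, e⟩ := hc.exec_loop_foldStep hT le_rfl hB
  have time_le := hm.trans (Nat.mul_le_mul_right _ (length_lt_encSize l))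
  have fold_le := hB l List.prefix_rfl
  rw [Store.init_eq_regs, Store.init_eq_regs]
  refine ⟨_, ?_, .seq .assign_two (.seq .assign_four
    (.seq .assign_zero (.seq e (.seq .assign_zero
      (.seq .assign_two .assign_four)))))⟩
  simp only [Expr.time, Expr.eval, Store.regs_zero, Store.regs_four, enc_prod, Data.left,
    Data.right, Data.size, size_enc, encSize_prod]
  omega

theorem PolyTime.foldl {s : γ → σ} {l : γ → List α}
    (hf : PolyTime fun p : γ × σ × α => f p.1 p.2.1 p.2.2) (hs : PolyTime s) (hl : PolyTime l)
    {B : γ → ℕ} (hB : PolyBounded B)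
    (h : ∀ x l', l' <+: l x → encSize (l'.foldl (f x) (s x)) ≤ B x) :
    PolyTime fun x => (l x).foldl (f x) (s x) := by
  have input := PolyTime.id.pair (hs.pair hl)
  have input_bounded := input.encSize_bounded
  have l_bounded := hl.encSize_bounded
  obtain ⟨c, t, ⟨p, ht⟩, hc⟩ := hf
  obtain ⟨c', t', ht', hc'⟩ := input
  let T := fun x => p.eval (encSize x + (B x + encSize (l x) + 1) + 1)
  have T_bounded : PolyBounded T :=
    (PolyBounded.encSize.add ((hB.add l_bounded).add (.const 1)) |>.add (.const 1)).eval p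
  refine ⟨.seq c' c.fold, _, ht'.add ((((l_bounded.mul ((T_bounded.add ((PolyBounded.const 6).mul
    ((PolyBounded.encSize.add hB).add l_bounded))).add (.const 12))).add
      ((PolyBounded.const 10).mul input_bounded)).add hB).add (.const 10)), fun x => ?_⟩
  obtain ⟨m', hm', e'⟩ := hc' x
  have step_le (s' : σ) (hs' : encSize s' ≤ B x) (a : α) (ha : a ∈ l x) : t (x, s', a) ≤ T x := by
    refine (ht _).trans (monotone_eval_nat p ?_)
    have := encSize_lt_of_mem ha
    rw [encSize_prod, encSize_prod]
    omega
  obtain ⟨m, hm, e⟩ := hc.exec_fold step_le (h x)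
  exact ⟨m' + m, Nat.add_le_add hm' hm, .seq e' e⟩

theorem PolyTime.foldl_of_le_add {s : γ → σ} {l : γ → List α}
    (hf : PolyTime fun p : γ × σ × α => f p.1 p.2.1 p.2.2) (hs : PolyTime s) (hl : PolyTime l)
    {K : γ → ℕ} (hK : PolyBounded K)
    (h : ∀ x s, ∀ a ∈ l x, encSize (f x s a) ≤ encSize s + K x) :
    PolyTime fun x => (l x).foldl (f x) (s x) := by
  refine foldl hf hs hl (hs.encSize_bounded.add (hl.encSize_bounded.mul hK)) fun x l' hl' => ?_
  refine (encSize_foldl_le_of_forall_mem_le (fun s a ha => h x s a (hl'.subset ha)) _).trans ?_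
  gcongr
  exact hl'.length_le.trans (length_lt_encSize _).le

end foldl

/-! ### Lists and natural numbers in polynomial time -/

section encSize

variable {α : Type} [Enc α]

theorem encSize_reverse (l : List α) : encSize l.reverse = encSize l := by
  induction l with
  | nil => rfl
  | cons a l ih =>
    have append_eq := encSize_append l.reverse [a]
    simp only [encSize_cons, encSize_nil] at append_eq ⊢
    rw [List.reverse_cons]
    omega

theorem encSize_le_of_suffix {l l' : List α} (h : l' <:+ l) : encSize l' ≤ encSize l := by
  obtain ⟨r, rfl⟩ := h
  have append_eq := encSize_append r l'
  have one_le := one_le_encSize r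
  omega

theorem encSize_bool_le (b : Bool) : encSize b ≤ 3 := by
  cases b <;> simp [encSize, enc, Data.ofBool, Data.size]

theorem encSize_nat (n : ℕ) : encSize n = encSize n.bits := rfl

theorem encSize_nat_le (n : ℕ) : encSize n ≤ 4 * n.size + 1 := by
  have bits_le := encSize_le_of_forall_mem_le (l := n.bits) fun b _ => encSize_bool_le b
  rw [encSize_nat, ← Nat.size_eq_bits_len]
  omega

theorem two_mul_length_lt_encSize (l : List α) : 2 * l.length < encSize l := by
  induction l with
  | nil => exact Nat.one_pos
  | cons a l ih =>
    have head_pos := one_le_encSize a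
    simp only [List.length_cons, encSize_cons]
    omega

theorem two_mul_size_lt_encSize (n : ℕ) : 2 * n.size < encSize n := by
  rw [encSize_nat, ← Nat.size_eq_bits_len]
  exact two_mul_length_lt_encSize _

theorem encSize_nat_le_two_mul {m n : ℕ} (h : m ≤ n) : encSize m ≤ 2 * encSize n := by
  have upper := encSize_nat_le m
  have lower := two_mul_size_lt_encSize n
  have size_le := Nat.size_le_size h
  omega

theorem encSize_nat_le_four_mul (n : ℕ) : encSize n ≤ 4 * n + 1 := by
  have upper := encSize_nat_le n
  have size_le : n.size ≤ n := Nat.size_le.2 Nat.lt_two_pow_self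
  omega

theorem size_add_le (a b : ℕ) : (a + b).size ≤ a.size + b.size + 1 := by
  rw [Nat.size_le, pow_succ, mul_two]
  exact add_lt_add
    ((Nat.lt_size_self a).trans_le (Nat.pow_le_pow_right two_pos (Nat.le_add_right _ _)))
    ((Nat.lt_size_self b).trans_le (Nat.pow_le_pow_right two_pos (Nat.le_add_left _ _)))

theorem size_mul_le (a b : ℕ) : (a * b).size ≤ a.size + b.size := by
  rw [Nat.size_le, pow_add]
  exact Nat.mul_lt_mul'' (Nat.lt_size_self a) (Nat.lt_size_self b)

theorem encSize_mul_le (a b : ℕ) : encSize (a * b) ≤ 2 * (encSize a + encSize b) := by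
  have upper := encSize_nat_le (a * b)
  have lower_a := two_mul_size_lt_encSize a
  have lower_b := two_mul_size_lt_encSize b
  have size_le := size_mul_le a b
  omega

theorem encSize_sum_le (l : List ℕ) : encSize l.sum ≤ 2 * encSize l := by
  have size_sum_lt : 2 * l.sum.size < encSize l := by
    induction l with
    | nil => exact Nat.one_pos
    | cons a l ih =>
      have lower := two_mul_size_lt_encSize a
      have size_le := size_add_le a l.sum
      rw [List.sum_cons, encSize_cons]
      omega
  have upper := encSize_nat_le l.sum
  omega

end encSize

namespace PolyTime

variable {α β γ σ : Type} [Enc α] [Enc β] [Enc γ] [Enc σ]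

theorem reverse {l : γ → List α} (hl : PolyTime l) : PolyTime fun x => (l x).reverse := by
  refine (foldl_of_le_add (f := fun _ s a => a :: s) (s := fun _ => []) (l := l)
    (K := fun x => encSize (l x) + 1) (id.snd.snd.cons id.snd.fst) (const _) hl
    (hl.encSize_bounded.add (.const 1)) fun x s a ha => ?_).congr fun x => by simp
  have := encSize_lt_of_mem ha
  rw [encSize_cons]
  omega

theorem foldr {f : γ → α → σ → σ} {s : γ → σ} {l : γ → List α}
    (hf : PolyTime fun p : γ × σ × α => f p.1 p.2.2 p.2.1) (hs : PolyTime s) (hl : PolyTime l)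
    {B : γ → ℕ} (hB : PolyBounded B)
    (h : ∀ x l', l' <:+ l x → encSize (l'.foldr (f x) (s x)) ≤ B x) :
    PolyTime fun x => (l x).foldr (f x) (s x) := by
  refine (foldl (f := fun x s a => f x a s) hf hs hl.reverse hB fun x l' hl' => ?_).congr
    fun x => by rw [List.foldl_reverse]
  have reverse_le := h x l'.reverse (by rw [← List.reverse_prefix]; simpa using hl')
  rwa [List.foldr_reverse] at reverse_le

theorem foldr_of_le_add {f : γ → α → σ → σ} {s : γ → σ} {l : γ → List α}
    (hf : PolyTime fun p : γ × σ × α => f p.1 p.2.2 p.2.1) (hs : PolyTime s) (hl : PolyTime l)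
    {K : γ → ℕ} (hK : PolyBounded K)
    (h : ∀ x s, ∀ a ∈ l x, encSize (f x a s) ≤ encSize s + K x) :
    PolyTime fun x => (l x).foldr (f x) (s x) :=
  (foldl_of_le_add (f := fun x s a => f x a s) hf hs hl.reverse hK
    fun x s a ha => h x s a (List.mem_reverse.1 ha)).congr fun x => by rw [List.foldl_reverse]

theorem exists_bound_of_mem {f : γ → α → β} {l : γ → List α}
    (hf : PolyTime fun p : γ × α => f p.1 p.2) (hl : PolyTime l) :
    ∃ K : γ → ℕ, PolyBounded K ∧ ∀ x, ∀ a ∈ l x, encSize (f x a) ≤ K x := by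
  obtain ⟨p, hp⟩ := hf.encSize_bounded
  refine ⟨_, ((PolyBounded.encSize.add hl.encSize_bounded).add (.const 1)).eval p,
    fun x a ha => (hp (x, a)).trans (monotone_eval_nat p ?_)⟩
  have := encSize_lt_of_mem ha
  rw [encSize_prod]
  omega

theorem map {f : γ → α → β} {l : γ → List α} (hl : PolyTime l)
    (hf : PolyTime fun p : γ × α => f p.1 p.2) : PolyTime fun x => (l x).map (f x) := by
  obtain ⟨K, hK, h⟩ := exists_bound_of_mem hf hl
  refine (foldr_of_le_add (f := fun x a s => f x a :: s) (s := fun _ => []) (l := l)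
    (K := fun x => K x + 1) ((hf.comp (id.fst.pair id.snd.snd)).cons id.snd.fst) (const _) hl
    (hK.add (.const 1)) fun x s a ha => ?_).congr fun x => by rw [List.map_eq_foldr]
  have := h x a ha
  rw [encSize_cons]
  omega

theorem filter {p : γ → α → Bool} {l : γ → List α} (hl : PolyTime l)
    (hp : PolyTime fun q : γ × α => p q.1 q.2) : PolyTime fun x => (l x).filter (p x) := by
  refine (foldr_of_le_add (f := fun x a s => if p x a = true then a :: s else s)
    (s := fun _ => []) (l := l) (K := fun x => encSize (l x) + 1)
    (ite (hp.comp (id.fst.pair id.snd.snd)).bool_decide (id.snd.snd.cons id.snd.fst) id.snd.fst)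
    (const _) hl (hl.encSize_bounded.add (.const 1)) fun x s a ha => ?_).congr fun x => ?_
  · have := encSize_lt_of_mem ha
    split_ifs
    · rw [encSize_cons]; omega
    · omega
  · induction l x with
    | nil => rfl
    | cons a l ih => simp only [List.filter_cons, List.foldr_cons, ih]

theorem append {l l' : γ → List α} (hl : PolyTime l) (hl' : PolyTime l') :
    PolyTime fun x => l x ++ l' x := by
  refine (foldr_of_le_add (f := fun _ a s => a :: s) (s := l') (l := l)
    (K := fun x => encSize (l x) + 1) (id.snd.snd.cons id.snd.fst) hl' hl
    (hl.encSize_bounded.add (.const 1)) fun x s a ha => ?_).congr fun x => by simp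
  have := encSize_lt_of_mem ha
  rw [encSize_cons]
  omega

theorem flatMap {f : γ → α → List β} {l : γ → List α} (hl : PolyTime l)
    (hf : PolyTime fun p : γ × α => f p.1 p.2) :
    PolyTime fun x => (l x).flatMap (f x) := by
  obtain ⟨K, hK, h⟩ := exists_bound_of_mem hf hl
  refine (foldr_of_le_add (f := fun x a s => f x a ++ s) (s := fun _ => []) (l := l)
    (K := K) ((hf.comp (id.fst.pair id.snd.snd)).append id.snd.fst) (const _) hl
    hK fun x s a ha => ?_).congr fun x => ?_
  · have := h x a ha
    have := encSize_append (f x a) s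
    omega
  · induction l x with
    | nil => rfl
    | cons a l ih => simp only [List.flatMap_cons, List.foldr_cons, ih]

theorem isEmpty {l : γ → List α} (hl : PolyTime l) : PolyTime fun x => (l x).isEmpty :=
  (foldr_of_le_add (f := fun _ _ _ => false) (s := fun _ => true) (const _) (const _) hl
    (.const 3) fun _ _ _ _ => (encSize_bool_le _).trans (Nat.le_add_left _ _)).congr
    fun x => by cases l x <;> rfl

theorem headD {l : γ → List α} {d : γ → α} (hl : PolyTime l) (hd : PolyTime d) :
    PolyTime fun x => (l x).headD (d x) :=
  (foldr_of_le_add (f := fun _ a _ => a) id.snd.snd hd hl hl.encSize_bounded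
    fun _ _ _ ha => (encSize_lt_of_mem ha).le.trans (Nat.le_add_left _ _)).congr
    fun x => by cases l x <;> rfl

theorem cond {b : γ → Bool} {f g : γ → β} (hb : PolyTime b) (hf : PolyTime f) (hg : PolyTime g) :
    PolyTime fun x => bif b x then f x else g x :=
  (ite hb.bool_decide hf hg).congr fun x => by cases b x <;> rfl

theorem not {f : γ → Bool} (hf : PolyTime f) : PolyTime fun x => !f x :=
  (hf.cond (const false) (const true)).congr fun x => by cases f x <;> rfl

theorem and {f g : γ → Bool} (hf : PolyTime f) (hg : PolyTime g) : PolyTime fun x => f x && g x :=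
  (hf.cond hg (const false)).congr fun x => by cases f x <;> rfl

theorem or {f g : γ → Bool} (hf : PolyTime f) (hg : PolyTime g) : PolyTime fun x => f x || g x :=
  (hf.cond (const true) hg).congr fun x => by cases f x <;> rfl

theorem xor {f g : γ → Bool} (hf : PolyTime f) (hg : PolyTime g) :
    PolyTime fun x => Bool.xor (f x) (g x) :=
  (hf.cond hg.not hg).congr fun x => by cases f x <;> simp

theorem decide_and {P Q : γ → Prop} [DecidablePred P] [DecidablePred Q]
    (hP : PolyTime fun x => decide (P x)) (hQ : PolyTime fun x => decide (Q x)) :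
    PolyTime fun x => decide (P x ∧ Q x) :=
  (hP.and hQ).congr fun x => Bool.decide_and (P x) (Q x)

theorem bits {f : γ → ℕ} (hf : PolyTime f) : PolyTime fun x => (f x).bits :=
  comp (of_enc_eq (f := fun n : ℕ => n.bits) fun _ => rfl) hf

theorem enc_bit (b : Bool) (n : ℕ) :
    enc (n.bit b) = enc (bif b || !n.bits.isEmpty then b :: n.bits else []) := by
  change enc (n.bit b).bits = _
  by_cases h : n = 0 → b = true
  · rw [Nat.bits_append_bit _ _ h]
    rcases n.eq_zero_or_pos with rfl | hn
    · simp [h rfl]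
    · have bits_ne_nil : n.bits ≠ [] := by
        rw [← List.length_pos_iff, Nat.size_eq_bits_len]
        exact Nat.size_pos.2 hn
      simp [List.isEmpty_eq_false_iff.2 bits_ne_nil]
  · push Not at h
    obtain ⟨rfl, hb⟩ := h
    simp [hb]

theorem bit {b : γ → Bool} {f : γ → ℕ} (hb : PolyTime b) (hf : PolyTime f) :
    PolyTime fun x => Nat.bit (b x) (f x) :=
  (cond (hb.or hf.bits.isEmpty.not) (hb.cons hf.bits) (const ([] : List Bool))).congr_enc
    fun x => enc_bit (b x) (f x)

theorem div2 {f : γ → ℕ} (hf : PolyTime f) : PolyTime fun x => (f x).div2 :=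
  hf.bits.tail.congr_enc fun x => congrArg enc (Nat.div2_bits_eq_tail (f x))

theorem bodd {f : γ → ℕ} (hf : PolyTime f) : PolyTime fun x => (f x).bodd :=
  (hf.bits.headD (const default)).congr fun x => by
    rw [Nat.bodd_eq_bits_head]
    cases (f x).bits <;> rfl

end PolyTime

theorem encSize_bit_le (b : Bool) (n : ℕ) : encSize (Nat.bit b n) ≤ encSize n + 4 := by
  by_cases h : n = 0 → b = true
  · rw [encSize_nat, Nat.bits_append_bit _ _ h, encSize_cons, encSize_nat]
    have := encSize_bool_le b
    omega
  · push Not at h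
    obtain ⟨rfl, hb⟩ := h
    simp [hb]

theorem encSize_div2_le (n : ℕ) : encSize n.div2 ≤ encSize n := by
  rw [encSize_nat, Nat.div2_bits_eq_tail, encSize_nat n]
  exact encSize_le_of_suffix (List.tail_suffix _)

theorem size_div2_le {n m : ℕ} (h : n.size ≤ m + 1) : n.div2.size ≤ m := by
  rw [Nat.size_le, pow_succ] at *
  rw [Nat.div2_val]
  omega

theorem foldl_div2_eq_zero {α : Type} (l : List α) (n : ℕ) (h : n.size ≤ l.length) :
    l.foldl (fun n _ => n.div2) n = 0 := by
  induction l generalizing n with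
  | nil => exact Nat.size_eq_zero.1 (Nat.le_zero.1 h)
  | cons a l ih => exact ih _ (size_div2_le h)

/-- One step of binary addition: the state consists of the remaining digits of the summands,
the carry, and the digits computed so far, most recent first. -/
def addStep (s : ℕ × ℕ × Bool × List Bool) : ℕ × ℕ × Bool × List Bool :=
  (s.1.div2, s.2.1.div2,
    (s.1.bodd && s.2.1.bodd) || (s.2.2.1 && (s.1.bodd || s.2.1.bodd)),
    Bool.xor s.1.bodd (Bool.xor s.2.1.bodd s.2.2.1) :: s.2.2.2)

/-- The number whose low binary digits are those in the list, read in reverse order, and whose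
high digits are those of `n`. -/
def digitsOnto (l : List Bool) (n : ℕ) : ℕ := l.foldl (fun n b => Nat.bit b n) n

theorem digitsOnto_addStep (s : ℕ × ℕ × Bool × List Bool) :
    digitsOnto (addStep s).2.2.2 ((addStep s).1 + (addStep s).2.1 + (addStep s).2.2.1.toNat) =
      digitsOnto s.2.2.2 (s.1 + s.2.1 + s.2.2.1.toNat) := by
  obtain ⟨a, b, c, l⟩ := s
  simp only [addStep, digitsOnto, List.foldl_cons]
  congr 1
  have ha := Nat.bodd_add_div2 a
  have hb := Nat.bodd_add_div2 b
  rw [Nat.bit_val]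
  revert ha hb
  cases a.bodd <;> cases b.bodd <;> cases c <;> simp <;> omega

theorem foldl_addStep {α : Type} (l : List α) (s : ℕ × ℕ × Bool × List Bool) :
    (l.foldl (fun s _ => addStep s) s).1 = l.foldl (fun n _ => n.div2) s.1 ∧
    (l.foldl (fun s _ => addStep s) s).2.1 = l.foldl (fun n _ => n.div2) s.2.1 ∧
    digitsOnto (l.foldl (fun s _ => addStep s) s).2.2.2 ((l.foldl (fun s _ => addStep s) s).1 +
      (l.foldl (fun s _ => addStep s) s).2.1 + (l.foldl (fun s _ => addStep s) s).2.2.1.toNat) =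
      digitsOnto s.2.2.2 (s.1 + s.2.1 + s.2.2.1.toNat) := by
  induction l generalizing s with
  | nil => exact ⟨rfl, rfl, rfl⟩
  | cons a l ih =>
    obtain ⟨fst_eq, snd_eq, digits_eq⟩ := ih (addStep s)
    exact ⟨fst_eq, snd_eq, digits_eq.trans (digitsOnto_addStep s)⟩

theorem add_eq_digitsOnto (a b : ℕ) :
    a + b = digitsOnto ((a.bits ++ b.bits).foldl (fun s _ => addStep s) (a, b, false, [])).2.2.2
      (Nat.bit ((a.bits ++ b.bits).foldl (fun s _ => addStep s) (a, b, false, [])).2.2.1 0) := by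
  obtain ⟨fst_eq, snd_eq, digits_eq⟩ := foldl_addStep (a.bits ++ b.bits) (a, b, false, [])
  rw [foldl_div2_eq_zero _ _ (by simp [← Nat.size_eq_bits_len])] at fst_eq snd_eq
  rw [fst_eq, snd_eq] at digits_eq
  simp only [digitsOnto, List.foldl_nil, Bool.toNat_false, add_zero, zero_add] at digits_eq
  rw [← digits_eq]
  rfl

/-- One step of binary comparison: the state consists of the remaining digits of the two
numbers and the result of comparing the low digits read so far. -/
def leStep (s : ℕ × ℕ × Bool) : ℕ × ℕ × Bool :=
  (s.1.div2, s.2.1.div2, bif Bool.xor s.1.bodd s.2.1.bodd then s.2.1.bodd else s.2.2)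

theorem foldl_leStep {α : Type} (l : List α) (a b : ℕ) (r : Bool) (ha : a.size ≤ l.length)
    (hb : b.size ≤ l.length) :
    (l.foldl (fun s _ => leStep s) (a, b, r)).2.2 = if a = b then r else decide (a < b) := by
  induction l generalizing a b r with
  | nil =>
    rw [Nat.size_eq_zero.1 (Nat.le_zero.1 ha), Nat.size_eq_zero.1 (Nat.le_zero.1 hb)]
    rfl
  | cons x l ih =>
    rw [List.foldl_cons, leStep, ih _ _ _ (size_div2_le ha) (size_div2_le hb)]
    have ha := Nat.bodd_add_div2 a
    have hb := Nat.bodd_add_div2 b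
    dsimp only
    generalize a.div2 = a', b.div2 = b', a.bodd = p, b.bodd = q at *
    cases p <;> cases q <;>
      simp only [Bool.toNat_false, Bool.toNat_true, Bool.xor_false, Bool.xor_true, Bool.not_false,
        Bool.not_true, cond_false, cond_true] at ha hb ⊢ <;>
      subst ha hb <;> split_ifs <;> grind

section foldr_bit

theorem foldr_bit_bits (n : ℕ) : n.bits.foldr Nat.bit 0 = n := by
  induction n using Nat.binaryRec' with
  | zero => simp
  | bit b n hn ih => rw [Nat.bits_append_bit _ _ hn, List.foldr_cons, ih]

theorem foldr_bit_le_of_suffix {l l' : List Bool} (h : l' <:+ l) :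
    l'.foldr Nat.bit 0 ≤ l.foldr Nat.bit 0 := by
  obtain ⟨r, rfl⟩ := h
  induction r with
  | nil => rfl
  | cons b r ih =>
    rw [List.cons_append, List.foldr_cons, Nat.bit_val]
    omega

theorem foldr_double_add (l : List Bool) (n : ℕ) :
    l.foldr (fun b s => if b = true then s + s + n else s + s) 0 = l.foldr Nat.bit 0 * n := by
  induction l with
  | nil => simp
  | cons b l ih =>
    rw [List.foldr_cons, List.foldr_cons, ih, Nat.bit_val]
    cases b <;> simp <;> ring

end foldr_bit

namespace PolyTime

variable {α β γ : Type} [Enc α] [Enc β] [Enc γ]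

theorem foldl_addStep {f g : γ → ℕ} (hf : PolyTime f) (hg : PolyTime g) :
    PolyTime fun x =>
      ((f x).bits ++ (g x).bits).foldl (fun s _ => addStep s) (f x, g x, false, []) := by
  refine foldl_of_le_add (f := fun _ s _ => addStep s) (s := fun x => (f x, g x, false, []))
    (K := fun _ => 10) ?_ (hf.pair (hg.pair (const _))) (hf.bits.append hg.bits) (.const _) ?_
  · have state : PolyTime fun p : γ × (ℕ × ℕ × Bool × List Bool) × Bool => p.2.1 := id.snd.fst
    have digit₁ := state.fst.bodd
    have digit₂ := state.snd.fst.bodd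
    have carry := state.snd.snd.fst
    exact state.fst.div2.pair (state.snd.fst.div2.pair
      (((digit₁.and digit₂).or (carry.and (digit₁.or digit₂))).pair
        ((digit₁.xor (digit₂.xor carry)).cons state.snd.snd.snd)))
  · rintro _ ⟨a, b, c, l⟩ _ _
    have a_le := encSize_div2_le a
    have b_le := encSize_div2_le b
    have carry_le := encSize_bool_le ((a.bodd && b.bodd) || (c && (a.bodd || b.bodd)))
    have digit_le := encSize_bool_le (Bool.xor a.bodd (Bool.xor b.bodd c))
    simp only [addStep, encSize_prod, encSize_cons]
    omega

theorem add {f g : γ → ℕ} (hf : PolyTime f) (hg : PolyTime g) : PolyTime fun x => f x + g x :=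
  have final := foldl_addStep hf hg
  (foldl_of_le_add (f := fun _ s b => Nat.bit b s) (K := fun _ => 4)
    (id.snd.snd.bit id.snd.fst) (final.snd.snd.fst.bit (const 0)) final.snd.snd.snd (.const _)
    fun _ s a _ => encSize_bit_le a s).congr fun x => add_eq_digitsOnto (f x) (g x)

theorem decide_le {f g : γ → ℕ} (hf : PolyTime f) (hg : PolyTime g) :
    PolyTime fun x => decide (f x ≤ g x) := by
  refine (foldl_of_le_add (f := fun _ s _ => leStep s) (s := fun x => (f x, g x, true))
    (l := fun x => (f x).bits ++ (g x).bits)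
    (K := fun _ => 10) ?_ (hf.pair (hg.pair (const _))) (hf.bits.append hg.bits) (.const _)
    ?_).snd.snd.congr fun x => ?_
  · have state : PolyTime fun p : γ × (ℕ × ℕ × Bool) × Bool => p.2.1 := id.snd.fst
    have digit₁ := state.fst.bodd
    have digit₂ := state.snd.fst.bodd
    exact state.fst.div2.pair
      (state.snd.fst.div2.pair ((digit₁.xor digit₂).cond digit₂ state.snd.snd))
  · rintro _ ⟨a, b, c⟩ _ _
    have a_le := encSize_div2_le a
    have b_le := encSize_div2_le b
    have result_le := encSize_bool_le (bif Bool.xor a.bodd b.bodd then b.bodd else c)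
    simp only [leStep, encSize_prod]
    omega
  · rw [foldl_leStep _ _ _ _ (by simp [← Nat.size_eq_bits_len])
      (by simp [← Nat.size_eq_bits_len])]
    split_ifs <;> grind

theorem decide_lt {f g : γ → ℕ} (hf : PolyTime f) (hg : PolyTime g) :
    PolyTime fun x => decide (f x < g x) :=
  (hg.decide_le hf).not.congr fun x => by simp [← decide_not]

theorem decide_eq {f g : γ → ℕ} (hf : PolyTime f) (hg : PolyTime g) :
    PolyTime fun x => decide (f x = g x) :=
  ((hf.decide_le hg).decide_and (hg.decide_le hf)).congr fun x => by
    rw [decide_eq_decide, le_antisymm_iff]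

theorem decide_eq_pair {f g : γ → ℕ × ℕ} (hf : PolyTime f) (hg : PolyTime g) :
    PolyTime fun x => decide (f x = g x) :=
  ((hf.fst.decide_eq hg.fst).decide_and (hf.snd.decide_eq hg.snd)).congr fun x => by
    rw [decide_eq_decide, Prod.ext_iff]

theorem min {f g : γ → ℕ} (hf : PolyTime f) (hg : PolyTime g) :
    PolyTime fun x => Min.min (f x) (g x) :=
  (ite (hf.decide_le hg) hf hg).congr fun _ => min_def _ _

theorem mul {f g : γ → ℕ} (hf : PolyTime f) (hg : PolyTime g) : PolyTime fun x => f x * g x := by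
  refine (foldr (f := fun x b s => if b = true then s + s + g x else s + s) (s := fun _ => 0)
    (l := fun x => (f x).bits) (B := fun x => 2 * (2 * (encSize (f x) + encSize (g x))))
    (ite id.snd.snd.bool_decide ((id.snd.fst.add id.snd.fst).add (hg.comp id.fst))
      (id.snd.fst.add id.snd.fst)) (const _) hf.bits ((PolyBounded.const 2).mul
      ((PolyBounded.const 2).mul (hf.encSize_bounded.add hg.encSize_bounded)))
    fun x l hl => ?_).congr fun _ => by rw [foldr_double_add, foldr_bit_bits]
  rw [foldr_double_add]
  have prefix_le : l.foldr Nat.bit 0 * g x ≤ f x * g x :=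
    Nat.mul_le_mul_right _ ((foldr_bit_le_of_suffix hl).trans (foldr_bit_bits _).le)
  exact (encSize_nat_le_two_mul prefix_le).trans (Nat.mul_le_mul_left _ (encSize_mul_le _ _))

theorem sum {l : γ → List ℕ} (hl : PolyTime l) : PolyTime fun x => (l x).sum :=
  foldr (f := fun _ a s => a + s) (s := fun _ => 0) (id.snd.snd.add id.snd.fst) (const _) hl
    ((PolyBounded.const 2).mul hl.encSize_bounded) fun _ l' hl' =>
      (encSize_sum_le l').trans (Nat.mul_le_mul_left _ (encSize_le_of_suffix hl'))

theorem length {l : γ → List α} (hl : PolyTime l) : PolyTime fun x => (l x).length :=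
  (hl.map (f := fun _ _ => 1) (const 1)).sum.congr fun x => by simp

end PolyTime

theorem foldl_index {α : Type} (l : List α) (i : ℕ) (r : List (α × ℕ)) :
    l.foldl (fun (p : ℕ × List (α × ℕ)) a => (p.1 + 1, (a, p.1) :: p.2)) (i, r) =
      (i + l.length, (l.zipIdx i).reverse ++ r) := by
  induction l generalizing i r with
  | nil => rfl
  | cons a l ih =>
    rw [List.foldl_cons, ih, List.zipIdx_cons, List.reverse_cons, List.append_assoc,
      List.length_cons]
    congr 1
    omega

theorem encSize_zipIdx_le {α : Type} [Enc α] (l : List α) :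
    encSize l.zipIdx ≤ l.length * (encSize l + 4 * l.length + 3) + 1 := by
  rw [← List.length_zipIdx (l := l) (i := 0)]
  refine encSize_le_of_forall_mem_le ?_
  rintro ⟨a, i⟩ h
  have hi := List.snd_lt_of_mem_zipIdx h
  have ha := encSize_lt_of_mem (List.fst_mem_of_mem_zipIdx h)
  have hi' := encSize_nat_le_four_mul i
  dsimp only at hi ha
  rw [encSize_prod]
  rw [List.length_zipIdx]
  omega

namespace PolyTime

variable {α γ : Type} [Enc α] [Enc γ]

theorem zipIdx {l : γ → List α} (hl : PolyTime l) : PolyTime fun x => (l x).zipIdx := by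
  have size := hl.encSize_bounded
  refine (foldl (f := fun _ (p : ℕ × List (α × ℕ)) a => (p.1 + 1, (a, p.1) :: p.2))
    (s := fun _ => (0, [])) (l := l)
    (B := fun x => 4 * encSize (l x) + 1 +
      (encSize (l x) * (encSize (l x) + 4 * encSize (l x) + 3) + 1) + 1)
    ((id.snd.fst.fst.add (const 1)).pair ((id.snd.snd.pair id.snd.fst.fst).cons id.snd.fst.snd))
    (const _) hl ((((PolyBounded.const 4).mul size).add (.const 1)).add
      ((size.mul ((size.add ((PolyBounded.const 4).mul size)).add (.const 3))).add (.const 1))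
      |>.add (.const 1)) fun x l' hl' => ?_).snd.reverse.congr fun x => by simp [foldl_index]
  rw [foldl_index, encSize_prod, List.append_nil, encSize_reverse, zero_add]
  have length_le : l'.length ≤ encSize (l x) := hl'.length_le.trans (length_lt_encSize _).le
  have prefix_le : encSize l' ≤ encSize (l x) := by
    obtain ⟨r, hr⟩ := hl'
    have append_eq := encSize_append l' r
    have r_pos := one_le_encSize r
    rw [hr] at append_eq
    omega
  gcongr
  · exact (encSize_nat_le_four_mul _).trans (by omega)
  · exact (encSize_zipIdx_le l').trans (by gcongr)

end PolyTime

/-- The value of a key in an association list, `0` if the key is absent. -/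
def lookupD {κ : Type} [DecidableEq κ] (l : List (κ × ℕ)) (k : κ) : ℕ := (l.lookup k).getD 0

section lookupD

variable {κ : Type} [DecidableEq κ]

theorem lookupD_cons (p : κ × ℕ) (l : List (κ × ℕ)) (k : κ) :
    lookupD (p :: l) k = if p.1 = k then p.2 else lookupD l k := by
  obtain ⟨a, b⟩ := p
  rcases eq_or_ne a k with rfl | h
  · simp [lookupD]
  · simp [lookupD, List.lookup_cons, h, beq_false_of_ne h.symm]

theorem lookupD_map (l : List κ) (f : κ → ℕ) {k : κ} (hk : k ∈ l) :
    lookupD (l.map fun k => (k, f k)) k = f k := by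
  induction l with
  | nil => exact absurd hk List.not_mem_nil
  | cons a l ih =>
    rw [List.map_cons, lookupD_cons]
    split_ifs with h
    · exact congrArg f h
    · exact ih ((List.mem_cons.1 hk).resolve_left (Ne.symm h))

theorem lookupD_mem_or_eq_zero (l : List (κ × ℕ)) (k : κ) :
    (k, lookupD l k) ∈ l ∨ lookupD l k = 0 := by
  rcases h : l.lookup k with _ | b
  · exact .inr (by rw [lookupD, h, Option.getD_none])
  · obtain ⟨l₁, l₂, hl, -⟩ := List.lookup_eq_some_iff.1 h
    rw [lookupD, h, Option.getD_some, hl]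
    exact .inl (by simp)

theorem lookupD_mem {l : List (κ × ℕ)} {k : κ} (h : ∃ p ∈ l, p.1 = k) : (k, lookupD l k) ∈ l := by
  obtain ⟨p, hp, rfl⟩ := h
  obtain ⟨b, hb⟩ := Option.isSome_iff_exists.1
    (List.lookup_isSome_iff.2 ⟨p, hp, beq_self_eq_true p.1⟩)
  obtain ⟨l₁, l₂, hl, -⟩ := List.lookup_eq_some_iff.1 hb
  rw [lookupD, hb, Option.getD_some, hl]
  simp

theorem lookupD_zipIdx_add (l : List ℕ) (j i : ℕ) :
    lookupD ((l.zipIdx j).map Prod.swap) (j + i) = l.getD i 0 := by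
  induction l generalizing j i with
  | nil => rfl
  | cons a l ih =>
    rw [List.zipIdx_cons, List.map_cons, lookupD_cons]
    cases i with
    | zero => simp
    | succ i =>
      rw [if_neg (by simp), List.getD_cons_succ, ← ih (j + 1) i, add_right_comm, add_assoc]

end lookupD

namespace PolyTime

variable {α γ : Type} [Enc α] [Enc γ]

theorem lookupD {κ : Type} [Enc κ] [DecidableEq κ]
    (heq : PolyTime fun p : κ × κ => decide (p.1 = p.2)) {l : γ → List (κ × ℕ)} {k : γ → κ}
    (hl : PolyTime l) (hk : PolyTime k) : PolyTime fun x => lookupD (l x) (k x) := by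
  refine (foldr_of_le_add (f := fun x p r => if p.1 = k x then p.2 else r) (s := fun _ => 0)
    (l := l) (K := fun x => encSize (l x))
    (ite (heq.comp (g := fun p : γ × ℕ × κ × ℕ => (p.2.2.1, k p.1))
      (id.snd.snd.fst.pair (hk.comp id.fst))) id.snd.snd.snd id.snd.fst) (const _) hl
    hl.encSize_bounded ?_).congr fun x => ?_
  · rintro x s ⟨a, b⟩ hp
    have := encSize_lt_of_mem hp
    rw [encSize_prod] at this
    dsimp only
    split_ifs <;> omega
  · induction l x with
    | nil => rfl
    | cons p l ih => rw [lookupD_cons, List.foldr_cons, ih]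

theorem lookupD_nat {l : γ → List (ℕ × ℕ)} {k : γ → ℕ}
    (hl : PolyTime l) (hk : PolyTime k) : PolyTime fun x => _root_.lookupD (l x) (k x) :=
  lookupD (id.fst.decide_eq id.snd) hl hk

theorem lookupD_pair {l : γ → List ((ℕ × ℕ) × ℕ)} {k : γ → ℕ × ℕ}
    (hl : PolyTime l) (hk : PolyTime k) : PolyTime fun x => _root_.lookupD (l x) (k x) :=
  lookupD (id.fst.decide_eq_pair id.snd) hl hk

theorem getD {l : γ → List ℕ} {i : γ → ℕ} (hl : PolyTime l) (hi : PolyTime i) :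
    PolyTime fun x => (l x).getD (i x) 0 :=
  ((hl.zipIdx.map (f := fun _ p => p.swap) (id.snd.snd.pair id.snd.fst)).lookupD_nat hi).congr
    fun x => by rw [← lookupD_zipIdx_add (l x) 0, zero_add]

theorem foldl_min {f : γ → α → ℕ} {s : γ → α} {l : γ → List α}
    (hf : PolyTime fun p : γ × α => f p.1 p.2) (hs : PolyTime s) (hl : PolyTime l) :
    PolyTime fun x => (l x).foldl (fun s a => if f x a < f x s then a else s) (s x) := by
  refine foldl_of_le_add (f := fun x s a => if f x a < f x s then a else s)
    (K := fun x => encSize (l x)) (ite ((hf.comp (id.fst.pair id.snd.snd)).decide_lt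
      (hf.comp (id.fst.pair id.snd.fst))) id.snd.snd id.snd.fst) hs hl hl.encSize_bounded
    fun x s a ha => ?_
  have := encSize_lt_of_mem ha
  split_ifs <;> omega

end PolyTime

/-! ### Balanced orientations of multigraphs -/

/-- The out-degree minus the in-degree of the vertex `v` in the directed multigraph with the arcs
`L`. -/
def excess {V : Type} [DecidableEq V] (L : List (V × V)) (v : V) : ℤ :=
  (L.countP fun a => a.1 = v) - (L.countP fun a => a.2 = v)

/-- The value at `v` of the indicator of the vertex `u`. -/
def delta {V : Type} [DecidableEq V] (u v : V) : ℤ := if u = v then 1 else 0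

/-- A trail, given by its ends and by its arcs in any order. -/
structure Trail (V : Type) where
  source : V
  target : V
  arcs : List (V × V)

section orient

variable {V : Type} [DecidableEq V]

theorem excess_append (L L' : List (V × V)) (v : V) :
    excess (L ++ L') v = excess L v + excess L' v := by
  simp only [excess, List.countP_append]
  push_cast
  ring

theorem excess_map_swap (L : List (V × V)) (v : V) :
    excess (L.map Prod.swap) v = -excess L v := by
  simp only [excess, List.countP_map, Function.comp_def, Prod.fst_swap, Prod.snd_swap]
  ring

namespace Trail

/-- The trails have a common end. -/
def Meets (e s : Trail V) : Prop :=
  (e.source = s.source ∨ e.source = s.target) ∨ (e.target = s.source ∨ e.target = s.target)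

instance (e s : Trail V) : Decidable (Meets e s) := by unfold Meets; infer_instance

/-- Concatenation of two trails at a common end, after reversal of one of them if necessary. -/
def join (e s : Trail V) : Trail V :=
  if e.target = s.source then ⟨e.source, s.target, e.arcs ++ s.arcs⟩
  else if e.target = s.target then ⟨e.source, s.source, e.arcs ++ s.arcs.map Prod.swap⟩
  else if e.source = s.target then ⟨s.source, e.target, e.arcs ++ s.arcs⟩
  else ⟨s.target, e.target, e.arcs ++ s.arcs.map Prod.swap⟩

/-- Joins the first trail with the given one if they meet, and sets the latter aside if not. -/
def absorb (p : Trail V × List (Trail V)) (s : Trail V) : Trail V × List (Trail V) :=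
  if Meets p.1 s then (join p.1 s, p.2) else (p.1, s :: p.2)

/-- The trail that consists of a single arc. -/
def single (a : V × V) : Trail V := ⟨a.1, a.2, [a]⟩

/-- Adds an edge to a system of trails no two of which meet. -/
def insertEdge (S : List (Trail V)) (a : V × V) : List (Trail V) :=
  (S.foldl absorb (single a, [])).1 :: (S.foldl absorb (single a, [])).2

/-- The vertices have the degrees that they have in a directed trail with the given ends. -/
def Good (e : Trail V) : Prop := ∀ v, excess e.arcs v = delta e.source v - delta e.target v

/-- A system of good trails no two of which meet. -/
def GoodSystem (S : List (Trail V)) : Prop :=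
  (∀ e ∈ S, e.Good) ∧ S.Pairwise fun e s => ¬Meets e s

theorem good_single (a : V × V) : (single a).Good := by
  intro v
  simp only [single, excess, List.countP_singleton, delta]
  split_ifs <;> simp_all

omit [DecidableEq V] in
theorem meets_comm {e s : Trail V} : Meets e s ↔ Meets s e := by
  unfold Meets
  constructor <;> (intro h; rcases h with (h | h) | (h | h) <;> simp [h])

theorem Meets.of_join {e s k : Trail V} (h : Meets (join e s) k) : Meets e k ∨ Meets s k := by
  unfold join at h
  unfold Meets at *
  split_ifs at h <;> dsimp only at h <;> tauto

theorem Good.join {e s : Trail V} (he : e.Good) (hs : s.Good) (h : Meets e s) :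
    (join e s).Good := by
  intro v
  have excess_e := he v
  have excess_s := hs v
  unfold Trail.join
  split_ifs with hts htt hst
  · rw [excess_append, excess_e, excess_s, hts]; ring
  · rw [excess_append, excess_map_swap, excess_e, excess_s, htt]; ring
  · rw [excess_append, excess_e, excess_s, hst]; ring
  · have hss : e.source = s.source := by unfold Meets at h; tauto
    rw [excess_append, excess_map_swap, excess_e, excess_s, hss]; ring

theorem goodSystem_cons {e : Trail V} {S : List (Trail V)} :
    GoodSystem (e :: S) ↔ e.Good ∧ (∀ s ∈ S, ¬Meets e s) ∧ GoodSystem S := by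
  simp only [GoodSystem, List.forall_mem_cons, List.pairwise_cons]
  tauto

theorem GoodSystem.perm {S S' : List (Trail V)} (hS : GoodSystem S) (h : S.Perm S') :
    GoodSystem S' :=
  ⟨fun e he => hS.1 e (h.mem_iff.2 he),
    (h.pairwise_iff fun hes => mt meets_comm.1 hes).1 hS.2⟩

theorem GoodSystem.foldl_absorb {S : List (Trail V)} : ∀ {e : Trail V} {K : List (Trail V)},
    e.Good → GoodSystem (K ++ S) → (∀ k ∈ K, ¬Meets e k) →
    GoodSystem ((S.foldl absorb (e, K)).1 :: (S.foldl absorb (e, K)).2) := by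
  induction S with
  | nil =>
    intro e K he hK h
    rw [List.append_nil] at hK
    exact goodSystem_cons.2 ⟨he, h, hK⟩
  | cons s S ih =>
    intro e K he hKS h
    have hsKS : GoodSystem (s :: (K ++ S)) := hKS.perm List.perm_middle
    obtain ⟨hs, s_not_meets, hKS'⟩ := goodSystem_cons.1 hsKS
    rw [List.foldl_cons, absorb]
    dsimp only
    split_ifs with hes
    · refine ih (he.join hs hes) hKS' fun k hk hj => ?_
      exact hj.of_join.elim (h k hk) (s_not_meets k (List.mem_append_left S hk))
    · exact ih he hsKS (List.forall_mem_cons.2 ⟨hes, h⟩)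

theorem GoodSystem.insertEdge {S : List (Trail V)} (hS : GoodSystem S) (a : V × V) :
    GoodSystem (insertEdge S a) :=
  foldl_absorb (good_single a) hS (by simp)

theorem GoodSystem.foldl_insertEdge (E : List (V × V)) : ∀ {S : List (Trail V)},
    GoodSystem S → GoodSystem (E.foldl Trail.insertEdge S) := by
  induction E with
  | nil => exact fun hS => hS
  | cons a _ ih => exact fun hS => ih (hS.insertEdge a)

theorem excess_flatMap_arcs_of_forall_ne {S : List (Trail V)} (hS : ∀ e ∈ S, e.Good) {v : V}
    (h : ∀ e ∈ S, e.source ≠ v ∧ e.target ≠ v) : excess (S.flatMap arcs) v = 0 := by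
  induction S with
  | nil => simp [excess]
  | cons e S ih =>
    rw [List.forall_mem_cons] at hS h
    rw [List.flatMap_cons, excess_append, ih hS.2 h.2, hS.1 v]
    simp [delta, h.1]

theorem GoodSystem.abs_excess_flatMap_arcs_le {S : List (Trail V)} (hS : GoodSystem S) (v : V) :
    |excess (S.flatMap arcs) v| ≤ 1 := by
  induction S with
  | nil => simp [excess]
  | cons e S ih =>
    obtain ⟨he, e_not_meets, hS⟩ := goodSystem_cons.1 hS
    rw [List.flatMap_cons, excess_append, he v]
    by_cases hv : e.source = v ∨ e.target = v
    · rw [excess_flatMap_arcs_of_forall_ne (v := v) hS.1]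
      · unfold delta
        split_ifs <;> simp
      · intro s hs
        have not_meets := e_not_meets s hs
        unfold Meets at not_meets
        rcases hv with rfl | rfl <;> constructor <;> intro h <;> simp [h] at not_meets
    · obtain ⟨source_ne, target_ne⟩ := not_or.1 hv
      simpa [delta, source_ne, target_ne] using ih hS

section sum

variable {f : V × V → ℕ} (hf : ∀ a, f a.swap = f a)
include hf

theorem sum_map_arcs_join (e s : Trail V) :
    ((join e s).arcs.map f).sum = (e.arcs.map f).sum + (s.arcs.map f).sum := by
  unfold join
  split_ifs <;> simp [Function.comp_def, hf]

theorem sum_map_arcs_foldl_absorb (S : List (Trail V)) : ∀ p : Trail V × List (Trail V),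
    ((((S.foldl absorb p).1 :: (S.foldl absorb p).2).flatMap arcs).map f).sum =
      (((p.1 :: p.2).flatMap arcs).map f).sum + ((S.flatMap arcs).map f).sum := by
  induction S with
  | nil => simp
  | cons s S ih =>
    intro p
    rw [List.foldl_cons, ih, absorb]
    split_ifs <;>
      simp only [List.flatMap_cons, List.map_append, List.sum_append, sum_map_arcs_join hf] <;>
      omega

theorem sum_map_arcs_foldl_insertEdge (E : List (V × V)) : ∀ S : List (Trail V),
    (((E.foldl insertEdge S).flatMap arcs).map f).sum =
      (E.map f).sum + ((S.flatMap arcs).map f).sum := by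
  induction E with
  | nil => simp
  | cons a E ih =>
    intro S
    rw [List.foldl_cons, ih, insertEdge, sum_map_arcs_foldl_absorb hf]
    simp only [single, List.flatMap_cons, List.flatMap_nil, List.append_nil, List.map_cons,
      List.map_nil, List.sum_cons, List.sum_nil]
    omega

end sum

end Trail

/-- An orientation of the multigraph with the edges `E` in which the in-degree and the out-degree
of every vertex differ by at most one. -/
def orient (E : List (V × V)) : List (V × V) := (E.foldl Trail.insertEdge []).flatMap Trail.arcs

theorem abs_excess_orient_le (E : List (V × V)) (v : V) : |excess (orient E) v| ≤ 1 :=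
  (Trail.GoodSystem.foldl_insertEdge E ⟨by simp, by simp⟩).abs_excess_flatMap_arcs_le v

theorem sum_map_orient {f : V × V → ℕ} (hf : ∀ a, f a.swap = f a) (E : List (V × V)) :
    ((orient E).map f).sum = (E.map f).sum := by
  rw [orient, Trail.sum_map_arcs_foldl_insertEdge hf]
  simp

end orient

/-! ### Splitting an assignment into two halves -/

theorem sum_map_ite_eq_countP {α : Type*} (p : α → Bool) (l : List α) :
    (l.map fun a => if p a = true then 1 else 0).sum = l.countP p := by
  induction l with
  | nil => simp
  | cons a l ih => rw [List.map_cons, List.sum_cons, ih, List.countP_cons]; omega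

/-- The edge of a bipartite graph that joins the point `p.1` to the location `p.2`; points are
represented by the even numbers, locations by the odd ones. -/
def toEdge (p : ℕ × ℕ) : ℕ × ℕ := (Nat.bit false p.1, Nat.bit true p.2)

/-- The pairs whose edges are oriented from points to locations. -/
def forwardHalf (E : List (ℕ × ℕ)) : List (ℕ × ℕ) :=
  ((orient (E.map toEdge)).filter fun a => !a.1.bodd).map fun a => (a.1.div2, a.2.div2)

/-- The pairs whose edges are oriented from locations to points. -/
def backwardHalf (E : List (ℕ × ℕ)) : List (ℕ × ℕ) :=
  ((orient (E.map toEdge)).filter fun a => a.1.bodd).map fun a => (a.2.div2, a.1.div2)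

theorem bodd_ne_of_mem_orient {E : List (ℕ × ℕ)} {a : ℕ × ℕ} (h : a ∈ orient (E.map toEdge)) :
    a.1.bodd ≠ a.2.bodd := by
  have sum_eq := sum_map_orient (f := fun a => if a.1.bodd = a.2.bodd then 1 else 0)
    (fun a => by simp only [Prod.fst_swap, Prod.snd_swap, eq_comm]) (E.map toEdge)
  have sum_toEdge : ((E.map toEdge).map fun a => if a.1.bodd = a.2.bodd then 1 else 0).sum = 0 := by
    simp [List.map_map, Function.comp_def, toEdge]
  rw [sum_toEdge] at sum_eq
  simpa using List.sum_eq_zero_iff.1 sum_eq _ (List.mem_map_of_mem h)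

theorem sum_halves (f : ℕ × ℕ → ℕ) (E : List (ℕ × ℕ)) :
    ((forwardHalf E).map f).sum + ((backwardHalf E).map f).sum = (E.map f).sum := by
  let F : ℕ × ℕ → ℕ := fun a =>
    if a.1.bodd = a.2.bodd then 0
    else if a.1.bodd then f (a.2.div2, a.1.div2) else f (a.1.div2, a.2.div2)
  have F_swap : ∀ a, F a.swap = F a := by
    rintro ⟨a, b⟩
    simp only [F, Prod.swap_prod_mk]
    cases a.bodd <;> cases b.bodd <;> simp
  have sum_F : ((orient (E.map toEdge)).map F).sum = (E.map f).sum := by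
    rw [sum_map_orient F_swap, List.map_map]
    congr 2
    ext p
    simp [F, toEdge]
  have bodd_ne : ∀ a ∈ orient (E.map toEdge), a.1.bodd ≠ a.2.bodd :=
    fun a ha => bodd_ne_of_mem_orient ha
  rw [← sum_F, forwardHalf, backwardHalf]
  generalize orient (E.map toEdge) = O at bodd_ne
  induction O with
  | nil => simp
  | cons a O ih =>
    obtain ⟨ha, hO⟩ := List.forall_mem_cons.1 bodd_ne
    rw [List.map_cons, List.sum_cons, ← ih hO]
    simp only [F, if_neg ha]
    cases h : a.1.bodd <;>
      simp only [h, Bool.not_false, Bool.not_true, List.filter_cons_of_pos, List.map_cons,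
        List.sum_cons, Bool.false_eq_true, not_false_eq_true, List.filter_cons_of_neg, if_false,
        if_true] <;>
      omega

theorem countP_halves (p : ℕ × ℕ → Bool) (E : List (ℕ × ℕ)) :
    (forwardHalf E).countP p + (backwardHalf E).countP p = E.countP p := by
  simp only [← sum_map_ite_eq_countP]
  exact sum_halves _ E

theorem bodd_eq_and_div2_eq_iff {b : Bool} {a x : ℕ} :
    (a.bodd = b ∧ a.div2 = x) ↔ a = Nat.bit b x := by
  constructor
  · rintro ⟨rfl, rfl⟩
    exact (Nat.bit_bodd_div2 a).symm
  · rintro rfl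
    simp

theorem abs_countP_fst_halves_le (E : List (ℕ × ℕ)) (x : ℕ) :
    |((forwardHalf E).countP fun p => p.1 = x : ℤ) -
      (backwardHalf E).countP fun p => p.1 = x| ≤ 1 := by
  convert abs_excess_orient_le (E.map toEdge) (Nat.bit false x) using 1
  rw [excess, forwardHalf, backwardHalf, List.countP_map, List.countP_map, List.countP_filter,
    List.countP_filter]
  congr 3 <;> refine List.countP_congr fun a ha => ?_
  all_goals
    have bodd_ne := bodd_ne_of_mem_orient ha
    simp only [Function.comp_apply, Bool.and_eq_true, decide_eq_true_eq,
      ← bodd_eq_and_div2_eq_iff]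
    cases h : a.1.bodd <;> cases h' : a.2.bodd <;> simp_all

theorem abs_countP_snd_halves_le (E : List (ℕ × ℕ)) (x : ℕ) :
    |((forwardHalf E).countP fun p => p.2 = x : ℤ) -
      (backwardHalf E).countP fun p => p.2 = x| ≤ 1 := by
  rw [abs_sub_comm]
  convert abs_excess_orient_le (E.map toEdge) (Nat.bit true x) using 1
  rw [excess, forwardHalf, backwardHalf, List.countP_map, List.countP_map, List.countP_filter,
    List.countP_filter]
  congr 3 <;> refine List.countP_congr fun a ha => ?_
  all_goals
    have bodd_ne := bodd_ne_of_mem_orient ha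
    simp only [Function.comp_apply, Bool.and_eq_true, decide_eq_true_eq,
      ← bodd_eq_and_div2_eq_iff]
    cases h : a.1.bodd <;> cases h' : a.2.bodd <;> simp_all

/-- The cheaper one of the two halves of an assignment `E`, for the weights `w`. -/
def halve (w : ℕ × ℕ → ℕ) (E : List (ℕ × ℕ)) : List (ℕ × ℕ) :=
  if ((forwardHalf E).map w).sum ≤ ((backwardHalf E).map w).sum then forwardHalf E
  else backwardHalf E

section halve

variable (w : ℕ × ℕ → ℕ)

theorem halve_eq_or_eq (E : List (ℕ × ℕ)) :
    halve w E = forwardHalf E ∨ halve w E = backwardHalf E := by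
  unfold halve
  split_ifs <;> simp

theorem two_mul_sum_map_halve_le (E : List (ℕ × ℕ)) :
    2 * ((halve w E).map w).sum ≤ (E.map w).sum := by
  have := sum_halves w E
  unfold halve
  split_ifs <;> omega

theorem countP_fst_halve {E : List (ℕ × ℕ)} {x h : ℕ} (hE : (E.countP fun p => p.1 = x) = 2 * h) :
    ((halve w E).countP fun p => p.1 = x) = h := by
  have := countP_halves (fun p => p.1 = x) E
  have := abs_le.1 (abs_countP_fst_halves_le E x)
  rcases halve_eq_or_eq w E with h | h <;> rw [h] <;> omega

theorem countP_snd_halve_le {E : List (ℕ × ℕ)} {x h : ℕ}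
    (hE : (E.countP fun p => p.2 = x) ≤ 2 * h) : ((halve w E).countP fun p => p.2 = x) ≤ h := by
  have := countP_halves (fun p => p.2 = x) E
  have := abs_le.1 (abs_countP_snd_halves_le E x)
  rcases halve_eq_or_eq w E with h | h <;> rw [h] <;> omega

theorem countP_halve_le (E : List (ℕ × ℕ)) (p : ℕ × ℕ → Bool) :
    (halve w E).countP p ≤ E.countP p := by
  have := countP_halves p E
  rcases halve_eq_or_eq w E with h | h <;> rw [h] <;> omega

theorem two_pow_mul_sum_map_iterate_halve_le (r : ℕ) : ∀ E : List (ℕ × ℕ),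
    2 ^ r * (((halve w)^[r] E).map w).sum ≤ (E.map w).sum := by
  induction r with
  | zero => simp
  | succ r ih =>
    intro E
    calc 2 ^ (r + 1) * (((halve w)^[r] (halve w E)).map w).sum
        = 2 * (2 ^ r * (((halve w)^[r] (halve w E)).map w).sum) := by ring
      _ ≤ 2 * ((halve w E).map w).sum := by gcongr; exact ih _
      _ ≤ (E.map w).sum := two_mul_sum_map_halve_le w E

theorem countP_fst_iterate_halve {x h : ℕ} (r : ℕ) : ∀ E : List (ℕ × ℕ),
    (E.countP fun p => p.1 = x) = 2 ^ r * h → (((halve w)^[r] E).countP fun p => p.1 = x) = h := by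
  induction r with
  | zero => simp
  | succ r ih =>
    intro E hE
    exact ih (halve w E) (countP_fst_halve w (hE.trans (by ring)))

theorem countP_snd_iterate_halve_le {x h : ℕ} (r : ℕ) : ∀ E : List (ℕ × ℕ),
    (E.countP fun p => p.2 = x) ≤ 2 ^ r * h →
    (((halve w)^[r] E).countP fun p => p.2 = x) ≤ h := by
  induction r with
  | zero => simp
  | succ r ih =>
    intro E hE
    exact ih (halve w E) (countP_snd_halve_le w (hE.trans_eq (by ring)))

theorem countP_iterate_halve_le (p : ℕ × ℕ → Bool) (r : ℕ) : ∀ E : List (ℕ × ℕ),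
    ((halve w)^[r] E).countP p ≤ E.countP p := by
  induction r with
  | zero => simp
  | succ r ih => exact fun E => (ih (halve w E)).trans (countP_halve_le w E p)

theorem mem_of_mem_iterate_halve {r : ℕ} {E : List (ℕ × ℕ)} {p : ℕ × ℕ}
    (h : p ∈ (halve w)^[r] E) : p ∈ E := by
  have countP_pos : 0 < ((halve w)^[r] E).countP fun q => q = p :=
    List.countP_pos_iff.2 ⟨p, h, by simp⟩
  obtain ⟨q, hq, hqp⟩ :=
    List.countP_pos_iff.1 (countP_pos.trans_le (countP_iterate_halve_le w _ r E))
  rwa [← of_decide_eq_true hqp]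

theorem length_iterate_halve_le (r : ℕ) (E : List (ℕ × ℕ)) :
    ((halve w)^[r] E).length ≤ E.length := by
  simpa using countP_iterate_halve_le w (fun _ => true) r E

end halve

/-! ### Halving in polynomial time -/

instance {V : Type} [Enc V] : Enc (Trail V) := ⟨fun e => enc (e.source, e.target, e.arcs)⟩

section encSize

variable {V : Type} [Enc V]

theorem encSize_trail (e : Trail V) :
    encSize e = encSize e.source + (encSize e.target + encSize e.arcs + 1) + 1 := rfl

theorem encSize_map_swap (L : List (V × V)) : encSize (L.map Prod.swap) = encSize L := by
  induction L with
  | nil => rfl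
  | cons a L ih =>
    rw [List.map_cons, encSize_cons, encSize_cons, ih, ← Prod.mk.eta (p := a), Prod.swap_prod_mk,
      encSize_prod, encSize_prod, add_comm (encSize a.2)]

variable [DecidableEq V]

theorem encSize_join_le (e s : Trail V) : encSize (e.join s) ≤ encSize e + encSize s := by
  have := encSize_append e.arcs s.arcs
  have := encSize_append e.arcs (s.arcs.map Prod.swap)
  have := encSize_map_swap s.arcs
  unfold Trail.join
  split_ifs <;> simp only [encSize_trail] <;> omega

theorem encSize_absorb_le (p : Trail V × List (Trail V)) (s : Trail V) :
    encSize (Trail.absorb p s) ≤ encSize p + encSize s + 1 := by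
  obtain ⟨e, K⟩ := p
  have := encSize_join_le e s
  unfold Trail.absorb
  split_ifs <;> simp only [encSize_prod, encSize_cons] <;> omega

theorem encSize_foldl_absorb_le (S : List (Trail V)) : ∀ p : Trail V × List (Trail V),
    encSize (S.foldl Trail.absorb p) + 1 ≤ encSize p + encSize S := by
  induction S with
  | nil => intro p; simp [encSize_nil]
  | cons s S ih =>
    intro p
    have := ih (Trail.absorb p s)
    have := encSize_absorb_le p s
    rw [List.foldl_cons, encSize_cons]
    omega

theorem encSize_insertEdge_le (S : List (Trail V)) (a : V × V) :
    encSize (Trail.insertEdge S a) ≤ encSize S + (2 * encSize a + 6) := by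
  have foldl_le := encSize_foldl_absorb_le S (Trail.single a, [])
  have encSize_a : encSize a = encSize a.1 + encSize a.2 + 1 := rfl
  change encSize (S.foldl Trail.absorb (Trail.single a, [])) ≤ _
  simp only [encSize_prod, Trail.single, encSize_trail, encSize_cons, encSize_nil] at foldl_le ⊢
  omega

end encSize

namespace PolyTime

variable {α V : Type} [Enc α] [Enc V]

theorem decide_or {P Q : α → Prop} [DecidablePred P] [DecidablePred Q]
    (hP : PolyTime fun a => decide (P a)) (hQ : PolyTime fun a => decide (Q a)) :
    PolyTime fun a => decide (P a ∨ Q a) :=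
  (hP.or hQ).congr fun a => Bool.decide_or (P a) (Q a)

theorem map_swap {L : α → List (V × V)} (hL : PolyTime L) :
    PolyTime fun a => (L a).map Prod.swap :=
  hL.map (f := fun _ p => p.swap) (id.snd.snd.pair id.snd.fst)

theorem trail_mk {s t : α → V} {L : α → List (V × V)} (hs : PolyTime s) (ht : PolyTime t)
    (hL : PolyTime L) : PolyTime fun a => Trail.mk (s a) (t a) (L a) :=
  (hs.pair (ht.pair hL)).congr_enc fun _ => rfl

theorem source {e : α → Trail V} (he : PolyTime e) : PolyTime fun a => (e a).source :=
  (he.congr_enc (f := fun a => ((e a).source, (e a).target, (e a).arcs)) fun _ => rfl).fst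

theorem target {e : α → Trail V} (he : PolyTime e) : PolyTime fun a => (e a).target :=
  (he.congr_enc (f := fun a => ((e a).source, (e a).target, (e a).arcs)) fun _ => rfl).snd.fst

theorem arcs {e : α → Trail V} (he : PolyTime e) : PolyTime fun a => (e a).arcs :=
  (he.congr_enc (f := fun a => ((e a).source, (e a).target, (e a).arcs)) fun _ => rfl).snd.snd

theorem join {e s : α → Trail ℕ} (he : PolyTime e) (hs : PolyTime s) :
    PolyTime fun a => (e a).join (s a) :=
  ite (he.target.decide_eq hs.source) (he.source.trail_mk hs.target (he.arcs.append hs.arcs))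
    (ite (he.target.decide_eq hs.target)
      (he.source.trail_mk hs.source (he.arcs.append hs.arcs.map_swap))
    (ite (he.source.decide_eq hs.target)
      (hs.source.trail_mk he.target (he.arcs.append hs.arcs))
      (hs.target.trail_mk he.target (he.arcs.append hs.arcs.map_swap))))

theorem absorb {p : α → Trail ℕ × List (Trail ℕ)} {s : α → Trail ℕ} (hp : PolyTime p)
    (hs : PolyTime s) : PolyTime fun a => Trail.absorb (p a) (s a) := by
  refine ite ?_ ((hp.fst.join hs).pair hp.snd) (hp.fst.pair (hs.cons hp.snd))
  exact ((hp.fst.source.decide_eq hs.source).decide_or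
    (hp.fst.source.decide_eq hs.target)).decide_or
    ((hp.fst.target.decide_eq hs.source).decide_or (hp.fst.target.decide_eq hs.target))

theorem insertEdge {S : α → List (Trail ℕ)} {a : α → ℕ × ℕ} (hS : PolyTime S) (ha : PolyTime a) :
    PolyTime fun x => Trail.insertEdge (S x) (a x) := by
  have foldl_absorb : PolyTime fun x => (S x).foldl Trail.absorb (Trail.single (a x), []) := by
    refine foldl_of_le_add (f := fun _ p s => Trail.absorb p s) (K := fun x => encSize (S x) + 1)
      (id.snd.fst.absorb id.snd.snd)
      ((ha.fst.trail_mk ha.snd (ha.cons (const []))).pair (const [])) hS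
      (hS.encSize_bounded.add (.const 1)) ?_
    intro x p s hs
    have := encSize_absorb_le p s
    have := encSize_lt_of_mem hs
    omega
  exact foldl_absorb.fst.cons foldl_absorb.snd

theorem orient {E : α → List (ℕ × ℕ)} (hE : PolyTime E) : PolyTime fun x => orient (E x) := by
  have foldl_insertEdge : PolyTime fun x => (E x).foldl Trail.insertEdge [] := by
    refine foldl_of_le_add (f := fun _ S a => Trail.insertEdge S a) (s := fun _ => [])
      (K := fun x => 2 * encSize (E x) + 6)
      (id.snd.fst.insertEdge id.snd.snd) (const []) hE
      (((PolyBounded.const 2).mul hE.encSize_bounded).add (.const 6)) ?_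
    intro x S a ha
    have := encSize_insertEdge_le S a
    have := encSize_lt_of_mem ha
    omega
  exact foldl_insertEdge.flatMap (f := fun _ e => e.arcs) id.snd.arcs

theorem orient_map_toEdge {E : α → List (ℕ × ℕ)} (hE : PolyTime E) :
    PolyTime fun x => _root_.orient ((E x).map toEdge) :=
  (hE.map (f := fun _ p => toEdge p) (((const false).bit id.snd.fst).pair
    ((const true).bit id.snd.snd))).orient

theorem forwardHalf {E : α → List (ℕ × ℕ)} (hE : PolyTime E) :
    PolyTime fun x => forwardHalf (E x) :=
  map (f := fun _ (a : ℕ × ℕ) => (a.1.div2, a.2.div2))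
    (hE.orient_map_toEdge.filter (p := fun _ (a : ℕ × ℕ) => !a.1.bodd) id.snd.fst.bodd.not)
    (id.snd.fst.div2.pair id.snd.snd.div2)

theorem backwardHalf {E : α → List (ℕ × ℕ)} (hE : PolyTime E) :
    PolyTime fun x => backwardHalf (E x) :=
  map (f := fun _ (a : ℕ × ℕ) => (a.2.div2, a.1.div2))
    (hE.orient_map_toEdge.filter (p := fun _ (a : ℕ × ℕ) => a.1.bodd) id.snd.fst.bodd)
    (id.snd.snd.div2.pair id.snd.fst.div2)

theorem sum_map_lookupD {T : α → List ((ℕ × ℕ) × ℕ)} {E : α → List (ℕ × ℕ)} (hT : PolyTime T)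
    (hE : PolyTime E) : PolyTime fun x => ((E x).map (_root_.lookupD (T x))).sum :=
  (hE.map (f := fun x p => _root_.lookupD (T x) p) ((hT.comp id.fst).lookupD_pair id.snd)).sum

theorem halve {T : α → List ((ℕ × ℕ) × ℕ)} {E : α → List (ℕ × ℕ)} (hT : PolyTime T)
    (hE : PolyTime E) : PolyTime fun x => halve (_root_.lookupD (T x)) (E x) :=
  ite ((hT.sum_map_lookupD hE.forwardHalf).decide_le (hT.sum_map_lookupD hE.backwardHalf))
    hE.forwardHalf hE.backwardHalf

theorem iterate_halve {β : Type} [Enc β] {T : α → List ((ℕ × ℕ) × ℕ)} {m : α → List β}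
    {E : α → List (ℕ × ℕ)} (hT : PolyTime T) (hm : PolyTime m) (hE : PolyTime E) :
    PolyTime fun x => (_root_.halve (_root_.lookupD (T x)))^[(m x).length] (E x) := by
  simp only [← List.foldl_const]
  refine foldl (f := fun x E _ => _root_.halve (_root_.lookupD (T x)) E)
    ((hT.comp id.fst).halve id.snd.fst) hE hm
    (B := fun x => encSize (E x) * (encSize (E x) + 1) + 1)
    ((hE.encSize_bounded.mul (hE.encSize_bounded.add (.const 1))).add (.const 1)) ?_
  intro x l' _
  rw [List.foldl_const]
  refine (encSize_le_of_forall_mem_le (K := encSize (E x)) fun p hp =>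
    (encSize_lt_of_mem (mem_of_mem_iterate_halve _ hp)).le).trans ?_
  gcongr
  exact (length_iterate_halve_le _ _ _).trans (length_lt_encSize _).le

end PolyTime

/-! ### Opening facilities of bounded capacity -/

section place

variable {κ : Type} [DecidableEq κ]

/-- Assigns a further client to a facility at location `c`: the first one in the list that is not
full, or a new one. The list consists of the locations and the loads of the open facilities; the
result also contains the position of the chosen facility. -/
def place (u : ℕ) (c : κ) : List (κ × ℕ) → List (κ × ℕ) × ℕ
  | [] => ([(c, 1)], 0)
  | f :: F => if f.1 = c ∧ f.2 < u then ((f.1, f.2 + 1) :: F, 0)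
      else (f :: (place u c F).1, (place u c F).2 + 1)

/-- Assigns clients one by one to facilities at the given locations: the locations and the loads of
the facilities that are opened, and the positions of the facilities that the clients get. -/
def pack (u : ℕ) (l : List κ) : List (κ × ℕ) × List ℕ :=
  l.foldl (fun p c => ((place u c p.1).1, p.2 ++ [(place u c p.1).2])) ([], [])

/-- The number of clients served from location `c`. -/
def loadAt (c : κ) (F : List (κ × ℕ)) : ℕ := (F.map fun f => if f.1 = c then f.2 else 0).sum

variable (u : ℕ) (c : κ)

theorem loadAt_cons (f : κ × ℕ) (F : List (κ × ℕ)) :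
    loadAt c (f :: F) = (if f.1 = c then f.2 else 0) + loadAt c F := by
  rw [loadAt, List.map_cons, List.sum_cons, loadAt]

theorem loadAt_place (c' : κ) (F : List (κ × ℕ)) :
    loadAt c' (place u c F).1 = loadAt c' F + if c = c' then 1 else 0 := by
  induction F with
  | nil => simp [place, loadAt]
  | cons f F ih =>
    rw [place]
    split_ifs with h h'
    · rw [loadAt_cons, loadAt_cons, if_pos (h.1.trans h'), if_pos (h.1.trans h')]
      ring
    · have hf : f.1 ≠ c' := h.1.trans_ne h'
      rw [loadAt_cons, loadAt_cons, if_neg hf, if_neg hf]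
      rfl
    all_goals
      rw [loadAt_cons, loadAt_cons, ih, add_assoc]
      simp [*]

theorem map_fst_place (F : List (κ × ℕ)) :
    (place u c F).1.map Prod.fst = F.map Prod.fst ∨
      (place u c F).1.map Prod.fst = F.map Prod.fst ++ [c] ∧
        u * (F.map Prod.fst).count c ≤ loadAt c F := by
  induction F with
  | nil => exact .inr (by simp [place])
  | cons f F ih =>
    rw [place]
    split_ifs with h
    · exact .inl (by simp)
    refine ih.imp (fun ih => by simp [ih]) fun ⟨ih, hload⟩ => ⟨by simp [ih], ?_⟩
    rw [loadAt_cons, List.map_cons, List.count_cons, mul_add, add_comm]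
    refine add_le_add ?_ hload
    by_cases hc : f.1 = c
    · simpa [hc] using h
    · simp [hc]

theorem map_fst_prefix_place (F : List (κ × ℕ)) :
    F.map Prod.fst <+: (place u c F).1.map Prod.fst := by
  rcases map_fst_place u c F with h | ⟨h, -⟩
  · rw [h]
  · rw [h]
    exact List.prefix_append _ _

theorem getElem?_map_fst_place (F : List (κ × ℕ)) :
    ((place u c F).1.map Prod.fst)[(place u c F).2]? = some c := by
  induction F with
  | nil => rfl
  | cons f F ih =>
    rw [place]
    split_ifs with h
    · simp [h.1]
    · simpa using ih

theorem getD_map_snd_place (F : List (κ × ℕ)) (j : ℕ) :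
    ((place u c F).1.map Prod.snd).getD j 0 =
      (F.map Prod.snd).getD j 0 + if (place u c F).2 = j then 1 else 0 := by
  induction F generalizing j with
  | nil => cases j <;> simp [place]
  | cons f F ih =>
    rw [place]
    split_ifs with h <;> cases j
    all_goals simp_all

theorem place_snd_le_length (F : List (κ × ℕ)) : (place u c F).2 ≤ F.length := by
  induction F with
  | nil => rfl
  | cons f F ih =>
    rw [place]
    split_ifs
    · exact Nat.zero_le _
    · exact Nat.succ_le_succ ih

variable {u c}

theorem mem_place {F : List (κ × ℕ)} {f : κ × ℕ} (hf : f ∈ (place u c F).1) :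
    f ∈ F ∨ f = (c, 1) ∨ ∃ g ∈ F, f = (g.1, g.2 + 1) ∧ g.2 < u := by
  induction F with
  | nil => simpa [place] using hf
  | cons g F ih =>
    rw [place] at hf
    split_ifs at hf with h
    · rcases List.mem_cons.1 hf with rfl | hf
      · exact .inr (.inr ⟨g, by simp, rfl, h.2⟩)
      · exact .inl (by simp [hf])
    · rcases List.mem_cons.1 hf with rfl | hf
      · simp
      · rcases ih hf with h | h | ⟨g', hg, h⟩
        · simp [h]
        · simp [h]
        · exact .inr (.inr ⟨g', by simp [hg], h⟩)

variable (u)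

theorem pack_concat (l : List κ) (c : κ) : pack u (l ++ [c]) =
    ((place u c (pack u l).1).1, (pack u l).2 ++ [(place u c (pack u l).1).2]) := by
  simp [pack]

theorem forall₂_pack (l : List κ) :
    List.Forall₂ (fun j c => ((pack u l).1.map Prod.fst)[j]? = some c) (pack u l).2 l := by
  induction l using List.reverseRecOn with
  | nil => exact .nil
  | append_singleton l c ih =>
    rw [pack_concat]
    refine List.rel_append (ih.imp fun j c' hj => ?_)
      (.cons (getElem?_map_fst_place u c _) .nil)
    obtain ⟨L, hL⟩ := map_fst_prefix_place u c (pack u l).1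
    rw [← hL, List.getElem?_append_left (List.getElem?_eq_some_iff.1 hj).1, hj]

theorem length_pack_snd (l : List κ) : (pack u l).2.length = l.length :=
  (forall₂_pack u l).length_eq

theorem count_pack (l : List κ) (j : ℕ) :
    (pack u l).2.count j = ((pack u l).1.map Prod.snd).getD j 0 := by
  induction l using List.reverseRecOn with
  | nil => simp [pack]
  | append_singleton l c ih =>
    rw [pack_concat, List.count_append, ih, getD_map_snd_place, List.count_singleton]
    simp only [beq_iff_eq]

theorem loadAt_pack (l : List κ) (c : κ) : loadAt c (pack u l).1 = l.count c := by
  induction l using List.reverseRecOn with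
  | nil => rfl
  | append_singleton l c' ih =>
    rw [pack_concat, List.count_append, ← ih, loadAt_place, List.count_singleton]
    simp only [beq_iff_eq]

theorem length_pack_fst_le (l : List κ) : (pack u l).1.length ≤ l.length := by
  induction l using List.reverseRecOn with
  | nil => rfl
  | append_singleton l c ih =>
    rw [pack_concat, ← List.length_map Prod.fst, List.length_append]
    rcases map_fst_place u c (pack u l).1 with h | ⟨h, -⟩ <;> rw [h] <;> simp <;> omega

variable {u}

theorem mem_pack {l : List κ} {f : κ × ℕ} (hf : f ∈ (pack u l).1) :
    f.1 ∈ l ∧ f.2 ≤ l.length ∧ (1 ≤ u → f.2 ≤ u) := by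
  induction l using List.reverseRecOn generalizing f with
  | nil => simp [pack] at hf
  | append_singleton l c ih =>
    rw [pack_concat] at hf
    rw [List.mem_append, List.length_append, List.length_singleton]
    rcases mem_place hf with h | rfl | ⟨g, hg, rfl, h⟩
    · exact ⟨.inl (ih h).1, (ih h).2.1.trans (Nat.le_succ _), (ih h).2.2⟩
    · exact ⟨.inr (List.mem_singleton.2 rfl), Nat.le_add_left _ _, fun hu => hu⟩
    · exact ⟨.inl (ih hg).1, Nat.succ_le_succ (ih hg).2.1, fun _ => h⟩

theorem count_pack_le (hu : 1 ≤ u) (l : List κ) (j : ℕ) : (pack u l).2.count j ≤ u := by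
  rw [count_pack]
  rcases lt_or_ge j ((pack u l).1.map Prod.snd).length with hj | hj
  · rw [List.getD_eq_getElem _ _ hj, List.getElem_map]
    exact (mem_pack (List.getElem_mem _)).2.2 hu
  · rw [List.getD_eq_default _ _ hj]
    exact Nat.zero_le u

/-- A facility is opened only when those at the same location are full. -/
theorem mul_count_map_fst_pack_lt (hu : 1 ≤ u) (l : List κ) (c : κ) :
    u * ((pack u l).1.map Prod.fst).count c < l.count c + u := by
  induction l using List.reverseRecOn with
  | nil => simpa [pack] using Nat.succ_le_iff.1 hu
  | append_singleton l c' ih =>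
    rw [pack_concat, List.count_append]
    rcases map_fst_place u c' (pack u l).1 with h | ⟨h, hload⟩ <;> rw [h]
    · omega
    · rw [loadAt_pack] at hload
      rw [List.count_append, mul_add]
      by_cases hc : c' = c
      · subst hc
        simp only [List.count_singleton_self]
        omega
      · simp only [List.count_singleton, beq_iff_eq, hc, if_false]
        omega

theorem length_pack_fst_le_sum (hu : 1 ≤ u) {l : List κ} {s : Finset κ} (hl : ∀ c ∈ l, c ∈ s)
    {b : κ → ℕ} (hb : ∀ c ∈ s, l.count c ≤ u * b c) : (pack u l).1.length ≤ ∑ c ∈ s, b c := by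
  have hmem : ∀ c ∈ (pack u l).1.map Prod.fst, c ∈ s := by
    intro c hc
    obtain ⟨f, hf, rfl⟩ := List.mem_map.1 hc
    exact hl _ (mem_pack hf).1
  calc (pack u l).1.length = ∑ c ∈ s, ((pack u l).1.map Prod.fst).count c := by
        rw [← List.length_map Prod.fst]
        simpa only [Multiset.coe_card, Multiset.coe_count] using
          (Multiset.sum_count_eq_card (m := .ofList ((pack u l).1.map Prod.fst)) hmem).symm
    _ ≤ ∑ c ∈ s, b c := Finset.sum_le_sum fun c hc => by
        have h := (mul_count_map_fst_pack_lt hu l c).trans_le (Nat.add_le_add_right (hb c hc) u)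
        exact Nat.lt_succ_iff.1 (Nat.lt_of_mul_lt_mul_left (h.trans_eq (Nat.mul_succ u _).symm))

end place

section encSize

theorem encSize_succ_le (n : ℕ) : encSize (n + 1) ≤ 2 * encSize n + 7 := by
  have hsize := size_add_le n 1
  rw [Nat.size_one] at hsize
  have henc := encSize_nat_le (n + 1)
  have hn := two_mul_size_lt_encSize n
  omega

variable {κ : Type} [DecidableEq κ] [Enc κ]

theorem encSize_place_fst_le (u : ℕ) (c : κ) (F : List (κ × ℕ)) :
    encSize (place u c F).1 ≤ 2 * encSize F + encSize c + 10 := by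
  induction F with
  | nil =>
    rw [place, encSize_cons, encSize_prod, encSize_nil]
    have hone := encSize_nat_le_four_mul 1
    omega
  | cons f F ih =>
    have hf : encSize f = encSize f.1 + encSize f.2 + 1 := rfl
    have hsucc := encSize_succ_le f.2
    rw [place]
    split_ifs <;> rw [encSize_cons, encSize_cons]
    · rw [encSize_prod]
      omega
    · omega

theorem encSize_place_le (u : ℕ) (c : κ) (F : List (κ × ℕ)) :
    encSize (place u c F) ≤ 6 * encSize F + encSize c + 12 := by
  have hfst := encSize_place_fst_le u c F
  have hsnd := encSize_nat_le_four_mul (place u c F).2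
  have hindex := place_snd_le_length u c F
  have hlength := length_lt_encSize F
  have hpair : encSize (place u c F) = encSize (place u c F).1 + encSize (place u c F).2 + 1 := rfl
  omega

theorem encSize_le_of_prefix {α : Type} [Enc α] {l l' : List α} (h : l' <+: l) :
    encSize l' ≤ encSize l := by
  obtain ⟨L, rfl⟩ := h
  have happend := encSize_append l' L
  have hpos := one_le_encSize L
  omega

theorem encSize_pack_le (u : ℕ) (l : List κ) :
    encSize (pack u l) ≤ 2 * (encSize l * (5 * encSize l + 3) + 1) + 1 := by
  have hlength := (length_lt_encSize l).le
  have hfst : encSize (pack u l).1 ≤ l.length * (5 * encSize l + 3) + 1 := by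
    refine (encSize_le_of_forall_mem_le (K := 5 * encSize l + 2) fun f hf => ?_).trans
      (Nat.add_le_add_right (Nat.mul_le_mul_right _ (length_pack_fst_le u l)) 1)
    obtain ⟨hloc, hload, -⟩ := mem_pack hf
    have henc_loc := encSize_lt_of_mem hloc
    have henc_load := encSize_nat_le_four_mul f.2
    have hf : encSize f = encSize f.1 + encSize f.2 + 1 := rfl
    omega
  have hsnd : encSize (pack u l).2 ≤ l.length * (5 * encSize l + 3) + 1 := by
    rw [← length_pack_snd u l]
    refine encSize_le_of_forall_mem_le fun j hj => ?_
    obtain ⟨i, hi, rfl⟩ := List.mem_iff_getElem.1 hj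
    have hopen := List.forall₂_iff_get.1 (forall₂_pack u l) |>.2 i hi
      (length_pack_snd u l ▸ hi)
    have hlt := (List.getElem?_eq_some_iff.1 hopen).1
    rw [List.length_map] at hlt
    have henc := encSize_nat_le_four_mul (pack u l).2[i]
    have := length_pack_fst_le u l
    simp only [List.get_eq_getElem] at hlt
    omega
  have hmul := Nat.mul_le_mul_right (5 * encSize l + 3) hlength
  have hpair : encSize (pack u l) = encSize (pack u l).1 + encSize (pack u l).2 + 1 := rfl
  omega

end encSize

theorem foldr_eq_place {κ : Type} [DecidableEq κ] (u : ℕ) (c : κ) (F : List (κ × ℕ)) :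
    F.foldr (fun f s => (f :: s.1, if f.1 = c ∧ f.2 < u then ((f.1, f.2 + 1) :: s.1, 0)
      else (f :: s.2.1, s.2.2 + 1))) (([] : List (κ × ℕ)), [(c, 1)], 0) = (F, place u c F) := by
  induction F with
  | nil => rfl
  | cons f F ih => rw [List.foldr_cons, ih, place]

namespace PolyTime

variable {α : Type} [Enc α]

theorem place {u c : α → ℕ} {F : α → List (ℕ × ℕ)} (hu : PolyTime u) (hc : PolyTime c)
    (hF : PolyTime F) : PolyTime fun x => place (u x) (c x) (F x) := by
  have hf : PolyTime fun p : α × (List (ℕ × ℕ) × List (ℕ × ℕ) × ℕ) × (ℕ × ℕ) => p.2.2 := id.snd.snd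
  have hs : PolyTime fun p : α × (List (ℕ × ℕ) × List (ℕ × ℕ) × ℕ) × (ℕ × ℕ) => p.2.1 := id.snd.fst
  have hfree := (hf.fst.decide_eq (hc.comp id.fst)).decide_and (hf.snd.decide_lt (hu.comp id.fst))
  refine (foldr (f := fun x (f : ℕ × ℕ) (s : List (ℕ × ℕ) × List (ℕ × ℕ) × ℕ) =>
      (f :: s.1, if f.1 = c x ∧ f.2 < u x then ((f.1, f.2 + 1) :: s.1, 0)
        else (f :: s.2.1, s.2.2 + 1)))
    (s := fun x => ([], [(c x, 1)], 0)) (l := F)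
    (B := fun x => 7 * encSize (F x) + encSize (c x) + 13)
    ((hf.cons hs.fst).pair (ite hfree
      (((hf.fst.pair (hf.snd.add (const 1))).cons hs.fst).pair (const 0))
      ((hf.cons hs.snd.fst).pair (hs.snd.snd.add (const 1)))))
    ((const []).pair (((hc.pair (const 1)).cons (const [])).pair (const 0))) hF
    ((((PolyBounded.const 7).mul hF.encSize_bounded).add hc.encSize_bounded).add (.const 13))
    fun x F' hF' => ?_).snd.congr fun x => by rw [foldr_eq_place]
  rw [foldr_eq_place, encSize_prod]
  have hsuffix := encSize_le_of_suffix hF'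
  have hplace := encSize_place_le (u x) (c x) F'
  omega

theorem pack {u : α → ℕ} {l : α → List ℕ} (hu : PolyTime u) (hl : PolyTime l) :
    PolyTime fun x => pack (u x) (l x) := by
  have hp : PolyTime fun p : α × (List (ℕ × ℕ) × List ℕ) × ℕ => p.2.1 := id.snd.fst
  have hplace := (hu.comp (g := fun p : α × (List (ℕ × ℕ) × List ℕ) × ℕ => p.1) id.fst).place
    id.snd.snd hp.fst
  have hB : PolyBounded fun x =>
      2 * (encSize (l x) * (5 * encSize (l x) + 3) + 1) + 1 :=
    ((PolyBounded.const 2).mul ((hl.encSize_bounded.mul (((PolyBounded.const 5).mul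
      hl.encSize_bounded).add (.const 3))).add (.const 1))).add (.const 1)
  refine foldl (f := fun x (p : List (ℕ × ℕ) × List ℕ) c =>
      ((_root_.place (u x) c p.1).1, p.2 ++ [(_root_.place (u x) c p.1).2]))
    (s := fun _ => ([], []))
    (hplace.fst.pair (hp.snd.append (hplace.snd.cons (const [])))) (const _) hl hB
    fun x l' hl' => (encSize_pack_le (u x) l').trans ?_
  have hprefix := encSize_le_of_prefix hl'
  gcongr

end PolyTime

/-! ### Clearing denominators -/

/-- The entries of a matrix, with their positions. -/
def entries {α : Type} (m : List (List α)) : List ((ℕ × ℕ) × α) :=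
  m.zipIdx.flatMap fun r => r.1.zipIdx.map fun q => ((r.2, q.2), q.1)

/-- Multiplies a list of fractions by the product of their denominators, which is also returned. A
fraction is given by its numerator and its denominator and carries a key. -/
def scale {κ : Type} (l : List (κ × ℕ × ℕ)) : List (κ × ℕ) × ℕ :=
  l.foldr (fun e s => ((e.1, e.2.1 * s.2) :: s.1.map (fun r => (r.1, r.2 * e.2.2)), e.2.2 * s.2))
    ([], 1)

section scale

variable {κ : Type}

theorem scale_cons (e : κ × ℕ × ℕ) (l : List (κ × ℕ × ℕ)) : scale (e :: l) =
    ((e.1, e.2.1 * (scale l).2) :: (scale l).1.map (fun r => (r.1, r.2 * e.2.2)),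
      e.2.2 * (scale l).2) := rfl

theorem map_fst_scale (l : List (κ × ℕ × ℕ)) : (scale l).1.map Prod.fst = l.map Prod.fst := by
  induction l with
  | nil => rfl
  | cons e l ih =>
    rw [scale_cons, List.map_cons, List.map_cons, ← ih, List.map_map]
    rfl

theorem cast_snd_of_mem_scale (q : κ → ℚ≥0) {l : List κ} {r : κ × ℕ}
    (hr : r ∈ (scale (l.map fun k => (k, (q k).num, (q k).den))).1) :
    (r.2 : ℚ≥0) = (scale (l.map fun k => (k, (q k).num, (q k).den))).2 * q r.1 := by
  induction l generalizing r with
  | nil => exact absurd hr List.not_mem_nil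
  | cons a l ih =>
    rw [List.map_cons, scale_cons] at hr ⊢
    rcases List.mem_cons.1 hr with rfl | hr
    · push_cast
      rw [← NNRat.mul_den_eq_num]
      ring
    · obtain ⟨s, hs, rfl⟩ := List.mem_map.1 hr
      push_cast
      rw [ih hs]
      ring

theorem scale_snd_pos (q : κ → ℚ≥0) (l : List κ) :
    0 < (scale (l.map fun k => (k, (q k).num, (q k).den))).2 := by
  induction l with
  | nil => exact Nat.one_pos
  | cons a l ih => exact Nat.mul_pos (q a).den_pos ih

theorem exists_scale_eq (q : κ → ℚ≥0) (l : List κ) : ∃ L > 0, ∃ W : κ → ℕ,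
    scale (l.map fun k => (k, (q k).num, (q k).den)) = (l.map fun k => (k, W k), L) ∧
      ∀ k ∈ l, (W k : ℚ≥0) = L * q k := by
  set s := scale (l.map fun k => (k, (q k).num, (q k).den))
  have hkeys : s.1.map Prod.fst = l := by rw [map_fst_scale, List.map_map]; exact l.map_id
  have hval : ∀ r ∈ s.1, (r.2 : ℚ≥0) = s.2 * q r.1 := fun r => cast_snd_of_mem_scale q
  have hnum : ∀ r ∈ s.1, (s.2 * q r.1).num = r.2 := fun r hr => by
    rw [← hval r hr, NNRat.num_natCast]
  refine ⟨s.2, scale_snd_pos q l, fun k => (s.2 * q k).num, Prod.ext ?_ rfl, fun k hk => ?_⟩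
  · conv_rhs => rw [← hkeys]
    rw [List.map_map]
    exact (List.map_id _).symm.trans (List.map_congr_left fun r hr => Prod.ext rfl (hnum r hr).symm)
  · rw [← hkeys] at hk
    obtain ⟨r, hr, rfl⟩ := List.mem_map.1 hk
    dsimp only
    rw [hnum r hr, hval r hr]

variable [Enc κ]

theorem two_mul_size_scale_snd_le (l : List (κ × ℕ × ℕ)) :
    2 * (scale l).2.size ≤ encSize l + 1 := by
  induction l with
  | nil => simp [scale, encSize_nil]
  | cons e l ih =>
    have hden := two_mul_size_lt_encSize e.2.2
    have hmul := size_mul_le e.2.2 (scale l).2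
    have hl : encSize (e :: l) =
        encSize e.1 + (encSize e.2.1 + encSize e.2.2 + 1) + 1 + encSize l + 1 := rfl
    rw [scale_cons]
    dsimp only
    omega

theorem encSize_le_of_mem_scale (l : List (κ × ℕ × ℕ)) {r : κ × ℕ} (hr : r ∈ (scale l).1) :
    encSize r.1 ≤ encSize l ∧ 2 * r.2.size ≤ encSize l + 1 := by
  induction l generalizing r with
  | nil => exact absurd hr List.not_mem_nil
  | cons e l ih =>
    have hnum := two_mul_size_lt_encSize e.2.1
    have hden := two_mul_size_lt_encSize e.2.2
    have hl : encSize (e :: l) =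
        encSize e.1 + (encSize e.2.1 + encSize e.2.2 + 1) + 1 + encSize l + 1 := rfl
    rw [scale_cons] at hr
    rcases List.mem_cons.1 hr with rfl | hr
    · have hmul := size_mul_le e.2.1 (scale l).2
      have hscale := two_mul_size_scale_snd_le l
      dsimp only
      omega
    · obtain ⟨s, hs, rfl⟩ := List.mem_map.1 hr
      have hmul := size_mul_le s.2 e.2.2
      have hs := ih hs
      dsimp only
      omega

theorem encSize_scale_le (l : List (κ × ℕ × ℕ)) :
    encSize (scale l) ≤ encSize l * (3 * encSize l + 5) + 2 * encSize l + 5 := by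
  have hden := encSize_nat_le (scale l).2
  have hsize := two_mul_size_scale_snd_le l
  have hlist : encSize (scale l).1 ≤ encSize l * (3 * encSize l + 5) + 1 := by
    refine (encSize_le_of_forall_mem_le (K := 3 * encSize l + 4) fun r hr => ?_).trans
      (Nat.add_le_add_right (Nat.mul_le_mul_right _ ?_) 1)
    · have hr := encSize_le_of_mem_scale l hr
      have henc := encSize_nat_le r.2
      have hpair : encSize r = encSize r.1 + encSize r.2 + 1 := rfl
      omega
    · rw [← List.length_map Prod.fst, map_fst_scale, List.length_map]
      exact (length_lt_encSize l).le
  have hpair : encSize (scale l) = encSize (scale l).1 + encSize (scale l).2 + 1 := rfl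
  omega

end scale

/-! ### Components of threshold graphs -/

/-- Replaces the label `a` by `b`. -/
def relabel (a b : ℕ) (g : List (ℕ × ℕ)) : List (ℕ × ℕ) :=
  g.map fun p => (p.1, if p.2 = a then b else p.2)

/-- Labels the points `P` by representatives of the components of the graph whose edges are the
pairs in the table `T` with a value of at most `D`. -/
def components (T : List ((ℕ × ℕ) × ℕ)) (D : ℕ) (P : List ℕ) : List (ℕ × ℕ) :=
  T.foldl (fun g e => if e.2 ≤ D then relabel (lookupD g e.1.1) (lookupD g e.1.2) g else g)
    (P.map fun x => (x, x))

theorem components_concat (T : List ((ℕ × ℕ) × ℕ)) (e : (ℕ × ℕ) × ℕ) (D : ℕ) (P : List ℕ) :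
    components (T ++ [e]) D P = if e.2 ≤ D then
      relabel (lookupD (components T D P) e.1.1) (lookupD (components T D P) e.1.2)
        (components T D P) else components T D P := by
  rw [components, List.foldl_append, List.foldl_cons, List.foldl_nil, ← components]

theorem exists_components_eq_map {P : List ℕ} {R : ℕ → ℕ → Prop} (hR : Equivalence R) {D : ℕ}
    (T : List ((ℕ × ℕ) × ℕ)) (hT : ∀ e ∈ T, e.1.1 ∈ P ∧ e.1.2 ∈ P)
    (hTR : ∀ e ∈ T, e.2 ≤ D → R e.1.1 e.1.2) :
    ∃ f : ℕ → ℕ, components T D P = P.map (fun x => (x, f x)) ∧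
      (∀ x ∈ P, f x ∈ P ∧ R x (f x)) ∧ ∀ e ∈ T, e.2 ≤ D → f e.1.1 = f e.1.2 := by
  induction T using List.reverseRecOn with
  | nil => exact ⟨fun x => x, rfl, fun x hx => ⟨hx, hR.refl x⟩, by simp⟩
  | append_singleton T e ih =>
    simp only [List.mem_append, List.mem_singleton, or_imp, forall_and, forall_eq] at hT hTR
    obtain ⟨f, hf, hfR, hfT⟩ := ih (fun a ha => ⟨hT.1.1 a ha, hT.2.1 a ha⟩) hTR.1
    have he : e.1.1 ∈ P ∧ e.1.2 ∈ P := ⟨hT.1.2, hT.2.2⟩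
    rw [components_concat, hf]
    simp only [List.mem_append, List.mem_singleton, or_imp, forall_and, forall_eq]
    by_cases hD : e.2 ≤ D
    · rw [if_pos hD, lookupD_map _ _ he.1, lookupD_map _ _ he.2]
      refine ⟨fun x => if f x = f e.1.1 then f e.1.2 else f x, by simp [relabel],
        forall_and.1 fun x => forall_and.1 fun hx => ?_,
        fun a ha haD => by simp only [hfT a ha haD], fun _ => by simp⟩
      dsimp only
      split_ifs with h
      · have hx' : R x (f e.1.1) := h ▸ (hfR x hx).2
        exact ⟨(hfR _ he.2).1, hR.trans hx' (hR.trans (hR.symm (hfR _ he.1).2)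
          (hR.trans (hTR.2 hD) (hfR _ he.2).2))⟩
      · exact hfR x hx
    · rw [if_neg hD]
      exact ⟨f, rfl, forall_and.1 fun x => forall_and.1 (hfR x), hfT, fun h => absurd h hD⟩

theorem map_fst_components (T : List ((ℕ × ℕ) × ℕ)) (D : ℕ) (P : List ℕ) :
    (components T D P).map Prod.fst = P := by
  induction T using List.reverseRecOn with
  | nil => rw [components, List.foldl_nil, List.map_map]; exact P.map_id
  | append_singleton T e ih =>
    rw [components_concat]
    split_ifs
    · rw [relabel, List.map_map]
      exact ih
    · exact ih

theorem snd_mem_or_eq_zero_of_mem_components {T : List ((ℕ × ℕ) × ℕ)} {D : ℕ} {P : List ℕ}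
    {p : ℕ × ℕ} (hp : p ∈ components T D P) : p.2 ∈ P ∨ p.2 = 0 := by
  induction T using List.reverseRecOn generalizing p with
  | nil =>
    obtain ⟨x, hx, rfl⟩ := List.mem_map.1 hp
    exact .inl hx
  | append_singleton T e ih =>
    rw [components_concat] at hp
    split_ifs at hp
    · obtain ⟨q, hq, rfl⟩ := List.mem_map.1 hp
      dsimp only
      split_ifs
      · exact (lookupD_mem_or_eq_zero (components T D P) e.1.2).elim (fun h => ih h) .inr
      · exact ih hq
    · exact ih hp

theorem encSize_components_le (T : List ((ℕ × ℕ) × ℕ)) (D : ℕ) (P : List ℕ) :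
    encSize (components T D P) ≤ encSize P * (2 * encSize P + 2) + 1 := by
  refine (encSize_le_of_forall_mem_le (K := 2 * encSize P + 1) fun p hp => ?_).trans
    (Nat.add_le_add_right (Nat.mul_le_mul_right _ ?_) 1)
  · have hfst := encSize_lt_of_mem (map_fst_components T D P ▸ List.mem_map_of_mem hp)
    have hpair : encSize p = encSize p.1 + encSize p.2 + 1 := rfl
    rcases snd_mem_or_eq_zero_of_mem_components hp with h | h
    · have hsnd := encSize_lt_of_mem h
      omega
    · have hzero := encSize_nat_le_four_mul 0
      rw [h] at hpair
      omega
  · rw [← List.length_map Prod.fst, map_fst_components]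
    exact (length_lt_encSize P).le

section foldl_min

variable {α : Type} (f : α → ℕ)

theorem foldl_min_le (l : List α) (s : α) :
    ∀ a ∈ s :: l, f (l.foldl (fun s a => if f a < f s then a else s) s) ≤ f a := by
  induction l generalizing s with
  | nil => simp
  | cons b l ih =>
    rw [List.foldl_cons]
    have h := ih (if f b < f s then b else s)
    have hmin : f (if f b < f s then b else s) ≤ f b ∧ f (if f b < f s then b else s) ≤ f s := by
      split_ifs <;> omega
    have hhead := h _ List.mem_cons_self
    simp only [List.mem_cons, forall_eq_or_imp]
    exact ⟨hhead.trans hmin.2, hhead.trans hmin.1, fun a ha => h a (List.mem_cons_of_mem _ ha)⟩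

theorem foldl_min_mem (l : List α) (s : α) :
    l.foldl (fun s a => if f a < f s then a else s) s ∈ s :: l := by
  induction l generalizing s with
  | nil => simp
  | cons b l ih =>
    rw [List.foldl_cons]
    rcases List.mem_cons.1 (ih (if f b < f s then b else s)) with h | h
    · rw [h]
      split_ifs <;> simp
    · simp [h]

end foldl_min

/-- The total weight of an assignment. -/
def totalCost (T : List ((ℕ × ℕ) × ℕ)) (E : List (ℕ × ℕ)) : ℕ := (E.map (lookupD T)).sum

/-- The assignments of the points to representatives of their components, for the thresholds for
which `k` facilities of capacity `u` suffice. -/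
def candidates (T : List ((ℕ × ℕ) × ℕ)) (P : List ℕ) (k u : ℕ) : List (List (ℕ × ℕ)) :=
  (T.map fun e => components T e.2 P).filter fun g =>
    decide ((pack u (g.map Prod.snd)).1.length ≤ k)

/-- The cheapest candidate, or the assignment of all points to the point `0`. -/
def fallback (T : List ((ℕ × ℕ) × ℕ)) (P : List ℕ) (k u : ℕ) : List (ℕ × ℕ) :=
  (candidates T P k u).foldl (fun s g => if totalCost T g < totalCost T s then g else s)
    (P.map fun x => (x, 0))

namespace PolyTime

variable {α β γ : Type} [Enc α] [Enc β] [Enc γ]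

theorem entries {m : α → List (List β)} (hm : PolyTime m) : PolyTime fun x => entries (m x) :=
  hm.zipIdx.flatMap
    (f := fun _ (r : List β × ℕ) => r.1.zipIdx.map fun (q : β × ℕ) => ((r.2, q.2), q.1))
    (id.snd.fst.zipIdx.map (f := fun (p : α × List β × ℕ) (q : β × ℕ) => ((p.2.2, q.2), q.1))
      ((id.fst.snd.snd.pair id.snd.snd).pair id.snd.fst))

theorem scale {κ : Type} [Enc κ] {l : α → List (κ × ℕ × ℕ)} (hl : PolyTime l) :
    PolyTime fun x => scale (l x) := by
  have he : PolyTime fun p : α × (List (κ × ℕ) × ℕ) × (κ × ℕ × ℕ) => p.2.2 := id.snd.snd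
  have hs : PolyTime fun p : α × (List (κ × ℕ) × ℕ) × (κ × ℕ × ℕ) => p.2.1 := id.snd.fst
  have hstep := ((he.fst.pair (he.snd.fst.mul hs.snd)).cons (hs.fst.map
      (f := fun (p : α × (List (κ × ℕ) × ℕ) × (κ × ℕ × ℕ)) (r : κ × ℕ) => (r.1, r.2 * p.2.2.2.2))
      (id.snd.fst.pair (id.snd.snd.mul id.fst.snd.snd.snd.snd)))).pair (he.snd.snd.mul hs.snd)
  have hB : PolyBounded fun x =>
      encSize (l x) * (3 * encSize (l x) + 5) + 2 * encSize (l x) + 5 :=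
    ((hl.encSize_bounded.mul (((PolyBounded.const 3).mul hl.encSize_bounded).add (.const 5))).add
      ((PolyBounded.const 2).mul hl.encSize_bounded)).add (.const 5)
  refine foldr (f := fun _ (e : κ × ℕ × ℕ) (s : List (κ × ℕ) × ℕ) =>
      ((e.1, e.2.1 * s.2) :: s.1.map (fun r => (r.1, r.2 * e.2.2)), e.2.2 * s.2))
    (s := fun _ => ([], 1)) hstep (const _) hl hB fun x l' hl' => (encSize_scale_le l').trans ?_
  have hsuffix := encSize_le_of_suffix hl'
  gcongr

theorem relabel {a b : α → ℕ} {g : α → List (ℕ × ℕ)} (ha : PolyTime a) (hb : PolyTime b)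
    (hg : PolyTime g) : PolyTime fun x => relabel (a x) (b x) (g x) :=
  hg.map (f := fun x (p : ℕ × ℕ) => (p.1, if p.2 = a x then b x else p.2))
    (id.snd.fst.pair (ite (id.snd.snd.decide_eq (ha.comp id.fst)) (hb.comp id.fst) id.snd.snd))

theorem components {T : α → List ((ℕ × ℕ) × ℕ)} {D : α → ℕ} {P : α → List ℕ} (hT : PolyTime T)
    (hD : PolyTime D) (hP : PolyTime P) : PolyTime fun x => components (T x) (D x) (P x) := by
  have hg : PolyTime fun p : α × List (ℕ × ℕ) × ((ℕ × ℕ) × ℕ) => p.2.1 := id.snd.fst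
  have he : PolyTime fun p : α × List (ℕ × ℕ) × ((ℕ × ℕ) × ℕ) => p.2.2 := id.snd.snd
  exact foldl (f := fun x (g : List (ℕ × ℕ)) (e : (ℕ × ℕ) × ℕ) => if e.2 ≤ D x then
      _root_.relabel (_root_.lookupD g e.1.1) (_root_.lookupD g e.1.2) g else g)
    (s := fun x => (P x).map fun y => (y, y))
    (ite (he.snd.decide_le (hD.comp id.fst))
      (relabel (hg.lookupD_nat he.fst.fst) (hg.lookupD_nat he.fst.snd) hg) hg)
    (hP.map (f := fun _ y => (y, y)) (id.snd.pair id.snd)) hT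
    ((hP.encSize_bounded.mul (((PolyBounded.const 2).mul hP.encSize_bounded).add (.const 2))).add
      (.const 1))
    fun x T' _ => encSize_components_le T' (D x) (P x)

theorem totalCost {T : α → List ((ℕ × ℕ) × ℕ)} {E : α → List (ℕ × ℕ)} (hT : PolyTime T)
    (hE : PolyTime E) : PolyTime fun x => totalCost (T x) (E x) := hT.sum_map_lookupD hE

theorem map_snd {E : α → List (β × γ)} (hE : PolyTime E) :
    PolyTime fun x => (E x).map Prod.snd :=
  hE.map (f := fun _ p => p.2) id.snd.snd

theorem map_fst {E : α → List (β × γ)} (hE : PolyTime E) :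
    PolyTime fun x => (E x).map Prod.fst :=
  hE.map (f := fun _ p => p.1) id.snd.fst

theorem candidates {T : α → List ((ℕ × ℕ) × ℕ)} {P : α → List ℕ} {k u : α → ℕ}
    (hT : PolyTime T) (hP : PolyTime P) (hk : PolyTime k) (hu : PolyTime u) :
    PolyTime fun x => candidates (T x) (P x) (k x) (u x) :=
  filter
    (p := fun x (g : List (ℕ × ℕ)) =>
      decide ((_root_.pack (u x) (g.map Prod.snd)).1.length ≤ k x))
    (hT.map (f := fun x (e : (ℕ × ℕ) × ℕ) => _root_.components (T x) e.2 (P x))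
      ((hT.comp id.fst).components id.snd.snd (hP.comp id.fst)))
    (((hu.comp id.fst).pack id.snd.map_snd).fst.length.decide_le (hk.comp id.fst))

theorem fallback {T : α → List ((ℕ × ℕ) × ℕ)} {P : α → List ℕ} {k u : α → ℕ}
    (hT : PolyTime T) (hP : PolyTime P) (hk : PolyTime k) (hu : PolyTime u) :
    PolyTime fun x => fallback (T x) (P x) (k x) (u x) :=
  foldl_min (f := fun x g => _root_.totalCost (T x) g) ((hT.comp id.fst).totalCost id.snd)
    (hP.map (f := fun _ x => (x, 0)) (id.snd.pair (const 0))) (hT.candidates hP hk hu)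

end PolyTime

/-! ### Integral metrics and the fallback solution -/

/-- All pairs of numbers below `n`. -/
def pairs (n : ℕ) : List (ℕ × ℕ) :=
  (List.range n).flatMap fun x => (List.range n).map fun y => (x, y)

/-- The table of a function on pairs. -/
def table (n : ℕ) (W : ℕ × ℕ → ℕ) : List ((ℕ × ℕ) × ℕ) := (pairs n).map fun p => (p, W p)

/-- The function `W` is a metric on the numbers below `n`. -/
structure IsNatMetric (n : ℕ) (W : ℕ × ℕ → ℕ) : Prop where
  eq_zero : ∀ x < n, ∀ y < n, W (x, y) = 0 ↔ x = y
  comm : ∀ x < n, ∀ y < n, W (x, y) = W (y, x)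
  triangle : ∀ x < n, ∀ y < n, ∀ z < n, W (x, z) ≤ W (x, y) + W (y, z)

/-- The graph that joins the points at a distance of at most `D`. -/
def thresholdGraph (n : ℕ) (W : ℕ × ℕ → ℕ) (D : ℕ) : SimpleGraph ℕ :=
  .fromRel fun x y => x < n ∧ y < n ∧ W (x, y) ≤ D

section table

variable {n : ℕ} {W : ℕ × ℕ → ℕ}

theorem mem_pairs {p : ℕ × ℕ} : p ∈ pairs n ↔ p.1 < n ∧ p.2 < n := by
  obtain ⟨x, y⟩ := p
  simp [pairs]

theorem mem_table {e : (ℕ × ℕ) × ℕ} : e ∈ table n W ↔ (e.1.1 < n ∧ e.1.2 < n) ∧ W e.1 = e.2 := by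
  rw [table, List.mem_map, ← mem_pairs]
  exact ⟨fun ⟨p, hp, he⟩ => he ▸ ⟨hp, rfl⟩, fun ⟨he, hW⟩ => ⟨e.1, he, Prod.ext rfl hW⟩⟩

theorem lookupD_table (W : ℕ × ℕ → ℕ) {p : ℕ × ℕ} (hp : p.1 < n ∧ p.2 < n) :
    lookupD (table n W) p = W p :=
  lookupD_map _ _ (mem_pairs.2 hp)

theorem totalCost_table (W : ℕ × ℕ → ℕ) {E : List (ℕ × ℕ)} (hE : ∀ p ∈ E, p.1 < n ∧ p.2 < n) :
    totalCost (table n W) E = (E.map W).sum := by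
  rw [totalCost, List.map_congr_left fun p hp => lookupD_table W (hE p hp)]

theorem sum_map_range (n : ℕ) (F : ℕ → ℕ) : ((List.range n).map F).sum = ∑ x : Fin n, F x :=
  Finset.sum_range F

theorem totalCost_table_map_range (W : ℕ × ℕ → ℕ) {f : ℕ → ℕ} (hf : ∀ x < n, f x < n) :
    totalCost (table n W) ((List.range n).map fun x => (x, f x)) = ∑ x : Fin n, W (x, f x) := by
  rw [totalCost_table, List.map_map, sum_map_range]
  · rfl
  · intro p hp
    obtain ⟨x, hx, rfl⟩ := List.mem_map.1 hp
    rw [List.mem_range] at hx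
    exact ⟨hx, hf x hx⟩

theorem count_map_range (n : ℕ) (f : ℕ → ℕ) (c : ℕ) :
    ((List.range n).map f).count c = (Finset.univ.filter fun x : Fin n => f x = c).card := by
  rw [Finset.card_filter, ← sum_map_range n fun x => if f x = c then 1 else 0,
    List.count, List.countP_map, ← sum_map_ite_eq_countP]
  simp only [Function.comp_apply, beq_iff_eq]

namespace IsNatMetric

variable (hW : IsNatMetric n W) {D : ℕ}
include hW

theorem of_thresholdGraph_adj {x y : ℕ} (h : (thresholdGraph n W D).Adj x y) :
    x < n ∧ y < n ∧ W (x, y) ≤ D := by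
  obtain ⟨-, h | ⟨hy, hx, h⟩⟩ := (SimpleGraph.fromRel_adj _ _ _).1 h
  · exact h
  · exact ⟨hx, hy, hW.comm x hx y hy ▸ h⟩

theorem le_length_mul {x y : ℕ} (p : (thresholdGraph n W D).Walk x y) (hx : x < n) :
    W (x, y) ≤ p.length * D ∧ ∀ z ∈ p.support, z < n := by
  induction p with
  | nil => simp [(hW.eq_zero _ hx _ hx).2 rfl, hx]
  | @cons x y z hxy p ih =>
    obtain ⟨-, hy, hle⟩ := hW.of_thresholdGraph_adj hxy
    obtain ⟨ih, hsupport⟩ := ih hy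
    have htri := hW.triangle x hx y hy z (hsupport _ p.end_mem_support)
    rw [SimpleGraph.Walk.length_cons, add_mul, one_mul, SimpleGraph.Walk.support_cons]
    exact ⟨by omega, List.forall_mem_cons.2 ⟨hx, hsupport⟩⟩

theorem le_of_reachable {x y : ℕ} (h : (thresholdGraph n W D).Reachable x y) (hx : x < n) :
    W (x, y) ≤ n * D := by
  obtain ⟨p, hp⟩ := h.exists_isPath
  obtain ⟨hle, hsupport⟩ := hW.le_length_mul p hx
  have hlength : p.support.length ≤ n := by
    have hsubset : p.support.toFinset ⊆ Finset.range n := fun z hz =>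
      Finset.mem_range.2 (hsupport z (List.mem_toFinset.1 hz))
    simpa only [List.toFinset_card_of_nodup hp.support_nodup, Finset.card_range] using
      Finset.card_le_card hsubset
  rw [SimpleGraph.Walk.length_support] at hlength
  exact hle.trans (Nat.mul_le_mul_right _ (Nat.le_of_succ_le hlength))

theorem exists_components_table_eq_map (D : ℕ) : ∃ f : ℕ → ℕ,
    components (table n W) D (List.range n) = (List.range n).map (fun x => (x, f x)) ∧
      (∀ x < n, f x < n ∧ W (x, f x) ≤ n * D) ∧
      ∀ x < n, ∀ y < n, W (x, y) ≤ D → f x = f y := by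
  obtain ⟨f, hf, hreach, hconst⟩ := exists_components_eq_map (P := List.range n)
    (thresholdGraph n W D).reachable_is_equivalence (D := D) (table n W)
    (fun e he => by simpa only [List.mem_range] using (mem_table.1 he).1)
    (fun e he hD => by
      obtain ⟨⟨hx, hy⟩, hval⟩ := mem_table.1 he
      by_cases hxy : e.1.1 = e.1.2
      · rw [hxy]
      · exact ((SimpleGraph.fromRel_adj _ _ _).2 ⟨hxy, .inl ⟨hx, hy, hval ▸ hD⟩⟩).reachable)
  simp only [List.mem_range] at hreach
  exact ⟨f, hf, fun x hx => ⟨(hreach x hx).1, hW.le_of_reachable (hreach x hx).2 hx⟩,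
    fun x hx y hy hD => hconst ((x, y), W (x, y)) (mem_table.2 ⟨⟨hx, hy⟩, rfl⟩) hD⟩

end IsNatMetric

end table

theorem length_pack_replicate_le {u k m : ℕ} (hu : 1 ≤ u) (hm : m ≤ k * u) (c : ℕ) :
    (pack u (List.replicate m c)).1.length ≤ k := by
  refine (length_pack_fst_le_sum hu (s := {c}) (b := fun _ => k)
    (fun c' h => Finset.mem_singleton.2 (List.eq_of_mem_replicate h)) fun c' _ => ?_).trans_eq
    (Finset.sum_singleton _ _)
  rw [mul_comm]
  exact List.count_le_length.trans (by rwa [List.length_replicate])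

namespace SoftCkMSol

variable {I : SoftCkMInst} (S : SoftCkMSol I)

theorem length_pack_le (hu : 1 ≤ I.u) {f : ℕ → ℕ} (hf : ∀ x < I.space.n, f x < I.space.n)
    (h : ∀ x : Fin I.space.n, f x = f (S.facility (S.assign x))) :
    (pack I.u ((List.range I.space.n).map f)).1.length ≤ I.k := by
  refine (length_pack_fst_le_sum hu (s := Finset.range I.space.n) (b := fun c =>
    (Finset.univ.filter fun j => f (S.facility j) = c).card) (fun c hc => ?_)
    fun c _ => ?_).trans ?_
  · obtain ⟨x, hx, rfl⟩ := List.mem_map.1 hc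
    exact Finset.mem_range.2 (hf x (List.mem_range.1 hx))
  · rw [count_map_range]
    refine Finset.card_le_mul_card_image_of_maps_to (f := S.assign) (fun x hx => ?_) _ fun j _ => ?_
    · rw [Finset.mem_filter] at hx ⊢
      exact ⟨Finset.mem_univ _, (h x).symm.trans hx.2⟩
    · exact (Finset.card_le_card
        (Finset.filter_subset_filter _ (Finset.filter_subset _ _))).trans (S.capacity j)
  · rw [← Finset.card_eq_sum_card_fiberwise (f := fun j => f (S.facility j)) (s := Finset.univ)
      fun j _ => Finset.mem_coe.2 (Finset.mem_range.2 (hf _ (Fin.is_lt _)))]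
    simpa using S.numFacilities_le

/-- The cost of a solution with respect to integral distances. -/
def natCost (W : ℕ × ℕ → ℕ) : ℕ := ∑ x : Fin I.space.n, W (x, S.facility (S.assign x))

end SoftCkMSol

theorem fallback_eq_or_mem (T : List ((ℕ × ℕ) × ℕ)) (P : List ℕ) (k u : ℕ) :
    fallback T P k u = P.map (fun x => (x, 0)) ∨ fallback T P k u ∈ candidates T P k u :=
  List.mem_cons.1 (foldl_min_mem (totalCost T) _ _)

theorem totalCost_fallback_le {T : List ((ℕ × ℕ) × ℕ)} {P : List ℕ} {k u : ℕ} {g : List (ℕ × ℕ)}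
    (hg : g ∈ candidates T P k u) : totalCost T (fallback T P k u) ≤ totalCost T g :=
  foldl_min_le (totalCost T) _ _ g (List.mem_cons_of_mem _ hg)

theorem exists_fallback_table_eq_map {n k u : ℕ} {W : ℕ × ℕ → ℕ} (hW : IsNatMetric n W)
    (hn : 0 < n) (hu : 1 ≤ u) (hk : n ≤ k * u) :
    ∃ f : ℕ → ℕ, fallback (table n W) (List.range n) k u = (List.range n).map (fun x => (x, f x)) ∧
      (∀ x < n, f x < n) ∧ (pack u ((List.range n).map f)).1.length ≤ k := by
  rcases fallback_eq_or_mem (table n W) (List.range n) k u with h | h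
  · refine ⟨fun _ => 0, h, fun _ _ => hn, ?_⟩
    rw [List.map_const', List.length_range]
    exact length_pack_replicate_le hu hk 0
  · obtain ⟨hmem, hlength⟩ := List.mem_filter.1 h
    obtain ⟨e, -, he⟩ := List.mem_map.1 hmem
    obtain ⟨f, hf, hlt, -⟩ := hW.exists_components_table_eq_map e.2
    rw [← he, hf, List.map_map] at hlength
    exact ⟨f, he.symm.trans hf, fun x hx => (hlt x hx).1, of_decide_eq_true hlength⟩

/-- The largest distance `D` of `S` is the threshold of a candidate, whose labels are within `n * D`
of the points. -/
theorem totalCost_fallback_table_le {I : SoftCkMInst} {W : ℕ × ℕ → ℕ}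
    (hW : IsNatMetric I.space.n W) (hn : 0 < I.space.n) (hu : 1 ≤ I.u) (S : SoftCkMSol I) :
    totalCost (table I.space.n W) (fallback (table I.space.n W) (List.range I.space.n) I.k I.u) ≤
      I.space.n * I.space.n * S.natCost W := by
  set n := I.space.n
  obtain ⟨x₀, -, hx₀⟩ := Finset.exists_max_image (Finset.univ : Finset (Fin n))
    (fun x => W (x, S.facility (S.assign x))) ⟨⟨0, hn⟩, Finset.mem_univ _⟩
  set D := W (x₀, S.facility (S.assign x₀))
  obtain ⟨g, hg, hgD, hconst⟩ := hW.exists_components_table_eq_map D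
  have hlength : (pack I.u ((List.range n).map g)).1.length ≤ I.k :=
    S.length_pack_le hu (fun x hx => (hgD x hx).1)
      fun x => hconst x x.2 _ (Fin.is_lt _) (hx₀ x (Finset.mem_univ x))
  have hmem : (List.range n).map (fun x => (x, g x)) ∈
      candidates (table n W) (List.range n) I.k I.u := by
    refine List.mem_filter.2 ⟨List.mem_map.2 ⟨((x₀, S.facility (S.assign x₀)), D),
      mem_table.2 ⟨⟨x₀.2, Fin.is_lt _⟩, rfl⟩, hg⟩, decide_eq_true ?_⟩
    rwa [List.map_map]
  refine (totalCost_fallback_le hmem).trans ?_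
  rw [totalCost_table_map_range W fun x hx => (hgD x hx).1]
  calc ∑ x : Fin n, W (x, g x) ≤ ∑ _x : Fin n, n * D :=
        Finset.sum_le_sum fun x _ => (hgD x x.2).2
    _ = n * n * D := by simp [mul_assoc]
    _ ≤ n * n * S.natCost W := Nat.mul_le_mul_left _ (Finset.single_le_sum
        (f := fun x : Fin n => W (x, S.facility (S.assign x)))
        (fun _ _ => Nat.zero_le _) (Finset.mem_univ x₀))

/-! ### The integral metric of a rational metric -/

theorem ofFn_eq_map_range {α : Type*} {n : ℕ} (f : Fin n → α) (g : ℕ → α)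
    (h : ∀ x : Fin n, f x = g x) : List.ofFn f = (List.range n).map g := by
  rw [List.ofFn_eq_map, ← List.map_coe_finRange_eq_range, List.map_map]
  exact List.map_congr_left fun x _ => h x

theorem zipIdx_map_range {α : Type*} (n : ℕ) (g : ℕ → α) :
    ((List.range n).map g).zipIdx = (List.range n).map fun x => (g x, x) :=
  List.ext_getElem (by simp) fun i _ _ => by simp

theorem entries_map_range {α : Type} (n : ℕ) (g : ℕ × ℕ → α) :
    entries ((List.range n).map fun x => (List.range n).map fun y => g (x, y)) =
      (pairs n).map fun p => (p, g p) := by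
  rw [entries, pairs, zipIdx_map_range, List.map_flatMap, List.flatMap_map]
  congr 1
  funext x
  rw [zipIdx_map_range, List.map_map, List.map_map]
  rfl

/-- The table of the distances in a matrix of fractions, multiplied by a common denominator. -/
def distTable (m : List (List (ℕ × ℕ))) : List ((ℕ × ℕ) × ℕ) := (scale (entries m)).1

theorem PolyTime.distTable {α : Type} [Enc α] {m : α → List (List (ℕ × ℕ))} (hm : PolyTime m) :
    PolyTime fun x => distTable (m x) := hm.entries.scale.fst

namespace FinMetric

variable (X : FinMetric)

/-- The distance matrix, with fractions as pairs of numerator and denominator. -/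
def matrix : List (List (ℕ × ℕ)) :=
  List.ofFn fun x => List.ofFn fun y => ((X.dist x y).num, (X.dist x y).den)

theorem enc_matrix : enc X.matrix = X.encode := by
  simp only [enc, matrix, encode, Data.ofFn, List.map_ofFn, Function.comp_def]
  rfl

/-- The distance as a function on natural numbers, with the value `0` outside of the space. -/
def natDist (p : ℕ × ℕ) : ℚ≥0 :=
  if h : p.1 < X.n ∧ p.2 < X.n then X.dist ⟨p.1, h.1⟩ ⟨p.2, h.2⟩ else 0

theorem natDist_coe (x y : Fin X.n) : X.natDist (x, y) = X.dist x y := by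
  simp [natDist]

theorem matrix_eq : X.matrix = (List.range X.n).map fun x => (List.range X.n).map fun y =>
    ((X.natDist (x, y)).num, (X.natDist (x, y)).den) := by
  refine ofFn_eq_map_range _ _ fun x => ofFn_eq_map_range _ _ fun y => ?_
  rw [natDist_coe]

theorem isNatMetric {L : ℕ} (hL : 0 < L) {W : ℕ × ℕ → ℕ}
    (h : ∀ x y : Fin X.n, (W (x, y) : ℚ≥0) = L * X.dist x y) : IsNatMetric X.n W where
  eq_zero x hx y hy := by
    have hxy := h ⟨x, hx⟩ ⟨y, hy⟩
    rw [← Nat.cast_eq_zero (R := ℚ≥0), hxy, mul_eq_zero, X.dist_eq_zero, Nat.cast_eq_zero]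
    simp [hL.ne']
  comm x hx y hy := by
    have hxy := h ⟨x, hx⟩ ⟨y, hy⟩
    rw [X.dist_comm, ← h] at hxy
    exact_mod_cast hxy
  triangle x hx y hy z hz := by
    rw [← Nat.cast_le (α := ℚ≥0), Nat.cast_add, h ⟨x, hx⟩ ⟨z, hz⟩, h ⟨x, hx⟩ ⟨y, hy⟩,
      h ⟨y, hy⟩ ⟨z, hz⟩, ← mul_add]
    gcongr
    exact X.dist_triangle _ _ _

theorem exists_distTable_eq : ∃ L : ℕ, 0 < L ∧ ∃ W : ℕ × ℕ → ℕ,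
    distTable X.matrix = table X.n W ∧ IsNatMetric X.n W ∧
      ∀ x y : Fin X.n, (W (x, y) : ℚ≥0) = L * X.dist x y := by
  obtain ⟨L, hL, W, hscale, hval⟩ := exists_scale_eq X.natDist (pairs X.n)
  rw [← entries_map_range, ← X.matrix_eq] at hscale
  have hW : ∀ x y : Fin X.n, (W (x, y) : ℚ≥0) = L * X.dist x y := fun x y => by
    rw [hval (x, y) (mem_pairs.2 ⟨x.2, y.2⟩), natDist_coe]
  exact ⟨L, hL, W, congrArg Prod.fst hscale, X.isNatMetric hL hW, hW⟩

end FinMetric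

/-! ### The reduction on lists -/

/-- Truncation of the values in a table. -/
def truncate (B : ℕ) (T : List ((ℕ × ℕ) × ℕ)) : List ((ℕ × ℕ) × ℕ) :=
  T.map fun e => (e.1, min e.2 B)

theorem truncate_table (B n : ℕ) (W : ℕ × ℕ → ℕ) :
    truncate B (table n W) = table n fun p => min (W p) B := by
  simp [truncate, table]

/-- A list whose length `r` is the binary logarithm of the number of copies of each point of `l`.
Unary counters keep the iterations polynomial; `2 ^ r` is at least `l.length ^ 3 * 2 ^ c` and still
polynomially bounded. -/
def logCopies (c : ℕ) (l : List ℕ) : List Bool :=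
  l.length.bits ++ (l.length.bits ++ (l.length.bits ++ List.replicate c true))

theorem two_pow_length_logCopies (c : ℕ) (l : List ℕ) :
    2 ^ (logCopies c l).length = (2 ^ l.length.size) ^ 3 * 2 ^ c := by
  simp only [logCopies, List.length_append, List.length_replicate, Nat.size_eq_bits_len, pow_add]
  ring

theorem length_pow_mul_le_two_pow_logCopies (c : ℕ) (l : List ℕ) :
    l.length ^ 3 * 2 ^ c ≤ 2 ^ (logCopies c l).length := by
  rw [two_pow_length_logCopies]
  gcongr
  exact (Nat.lt_size_self _).le

theorem two_pow_size_le (n : ℕ) : 2 ^ n.size ≤ 2 * n + 1 := by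
  have hlt : n.size < (Nat.bit true n).size := by
    rw [Nat.size_bit (by simp [Nat.bit_val])]
    exact Nat.lt_succ_self _
  exact Nat.lt_size.1 hlt

/-- The concatenation of `2 ^ r` copies of `l`, obtained by repeated doubling. -/
def copies (r : ℕ) (l : List ℕ) : List ℕ := (fun l => l ++ l)^[r] l

theorem copies_succ (r : ℕ) (l : List ℕ) : copies (r + 1) l = copies r (l ++ l) := rfl

theorem sum_map_copies (f : ℕ → ℕ) (r : ℕ) : ∀ l : List ℕ,
    ((copies r l).map f).sum = 2 ^ r * (l.map f).sum := by
  induction r with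
  | zero => simp [copies]
  | succ r ih =>
    intro l
    rw [copies_succ, ih, List.map_append, List.sum_append]
    ring

theorem mem_of_mem_copies {x : ℕ} (r : ℕ) : ∀ l : List ℕ, x ∈ copies r l → x ∈ l := by
  induction r with
  | zero => exact fun l h => h
  | succ r ih => exact fun l h => (List.mem_append.1 (ih (l ++ l) h)).elim id id

theorem encSize_copies_le (r : ℕ) : ∀ l : List ℕ, encSize (copies r l) ≤ 2 ^ r * encSize l := by
  induction r with
  | zero => simp [copies]
  | succ r ih =>
    intro l
    have happend : encSize (l ++ l) ≤ 2 * encSize l := by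
      have := encSize_append l l
      omega
    rw [copies_succ, pow_succ, mul_assoc]
    exact (ih _).trans (Nat.mul_le_mul_left _ happend)

/-- The points of the fair instance, as pairs of a location and a group: `2 ^ r` copies of all
points in group `0`, and the first `k` points once more in group `1`. -/
def fairPoints (r : ℕ) (l : List ℕ) (k : ℕ) : List (ℕ × ℕ) :=
  (copies r l).map (fun x => (x, 0)) ++ (l.filter fun x => decide (x < k)).map fun x => (x, 1)

/-- The matrix of integral fractions given by a table. -/
def tableMatrix (T : List ((ℕ × ℕ) × ℕ)) (l : List ℕ) : List (List (ℕ × ℕ)) :=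
  l.map fun x => l.map fun y => (lookupD T (x, y), 1)

/-- The edges from the locations of the points of group `0` to their centers. After division by the
number of copies, they form a fractional assignment. -/
def fairEdges (P : List (ℕ × ℕ)) (s : List ℕ × List ℕ) : List (ℕ × ℕ) :=
  (P.zipIdx.filter fun q => decide (q.1.2 = 0)).map fun q => (q.1.1, s.1.getD (s.2.getD q.2 0) 0)

/-- Instances of the capacitated problem, as lists: the distance matrix, `k` and `u`. -/
abbrev SoftData := List (List (ℕ × ℕ)) × ℕ × ℕ

namespace SoftData

/-- The table of distances, multiplied by a common denominator. -/
def distances (d : SoftData) : List ((ℕ × ℕ) × ℕ) := distTable d.1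

/-- The points, numbered by their rows of the matrix. -/
def points (d : SoftData) : List ℕ := List.range d.1.length

/-- The fallback assignment, which is optimal up to a factor `n ^ 2`. -/
def start (d : SoftData) : List (ℕ × ℕ) := fallback d.distances d.points d.2.1 d.2.2

/-- The distances, truncated above the cost of the fallback assignment. -/
def truncatedDistances (d : SoftData) : List ((ℕ × ℕ) × ℕ) :=
  truncate (totalCost d.distances d.start + 1) d.distances

/-- The fair instance to which the algorithm for fair clustering is applied. -/
def fairData (c : ℕ) (d : SoftData) : List (List (ℕ × ℕ)) × List (ℕ × ℕ) × ℕ × ℕ :=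
  (tableMatrix d.truncatedDistances d.points,
    fairPoints (logCopies c d.points).length d.points d.2.1, d.2.1,
    d.2.2 * 2 ^ (logCopies c d.points).length)

/-- The integral assignment obtained from a fair clustering by repeated halving. -/
def rounded (c : ℕ) (d : SoftData) (s : List ℕ × List ℕ) : List (ℕ × ℕ) :=
  d.points.map fun x => (x, lookupD ((halve (lookupD d.truncatedDistances))^[
    (logCopies c d.points).length] (fairEdges (d.fairData c).2.1 s)) x)

/-- The better one of the rounded and the fallback assignment. -/
def best (c : ℕ) (d : SoftData) (s : List ℕ × List ℕ) : List (ℕ × ℕ) :=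
  if totalCost d.distances (d.rounded c s) < totalCost d.distances d.start then d.rounded c s
  else d.start

/-- The facilities and the assignment of the resulting solution. -/
def solution (c : ℕ) (d : SoftData) (s : List ℕ × List ℕ) : List ℕ × List ℕ :=
  ((pack d.2.2 ((d.best c s).map Prod.snd)).1.map Prod.fst,
    (pack d.2.2 ((d.best c s).map Prod.snd)).2)

end SoftData

namespace PolyTime

variable {α β : Type} [Enc α] [Enc β]

theorem range_length {l : α → List β} (hl : PolyTime l) :
    PolyTime fun x => List.range (l x).length :=
  hl.zipIdx.map_snd.congr fun x => by
    rw [List.zipIdx_eq_zip_range', List.map_snd_zip (by simp), List.range_eq_range']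

theorem truncate {B : α → ℕ} {T : α → List ((ℕ × ℕ) × ℕ)} (hB : PolyTime B) (hT : PolyTime T) :
    PolyTime fun x => truncate (B x) (T x) :=
  hT.map (f := fun x (e : (ℕ × ℕ) × ℕ) => (e.1, Min.min e.2 (B x)))
    (id.snd.fst.pair (id.snd.snd.min (hB.comp id.fst)))

theorem mul_two_pow_length {r : α → List β} {u : α → ℕ} (hr : PolyTime r) (hu : PolyTime u) :
    PolyTime fun x => u x * 2 ^ (r x).length :=
  (foldl_of_le_add (f := fun _ t _ => Nat.bit false t) ((const false).bit id.snd.fst) hu hr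
    (.const 4) fun _ _ _ _ => encSize_bit_le _ _).congr fun x => by
      have hdouble : Nat.bit false = (· * 2) := funext fun n => by simp [Nat.bit_val, mul_comm]
      rw [List.foldl_const, hdouble, mul_right_iterate]

theorem tableMatrix {T : α → List ((ℕ × ℕ) × ℕ)} {l : α → List ℕ} (hT : PolyTime T)
    (hl : PolyTime l) : PolyTime fun x => tableMatrix (T x) (l x) :=
  hl.map (f := fun a x => (l a).map fun y => (_root_.lookupD (T a) (x, y), 1))
    ((hl.comp id.fst).map (f := fun (p : α × ℕ) y => (_root_.lookupD (T p.1) (p.2, y), 1))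
      (((hT.comp id.fst.fst).lookupD_pair (id.fst.snd.pair id.snd)).pair (const 1)))

theorem fairEdges {P : α → List (ℕ × ℕ)} {s : α → List ℕ × List ℕ} (hP : PolyTime P)
    (hs : PolyTime s) : PolyTime fun x => fairEdges (P x) (s x) :=
  map (f := fun x (q : (ℕ × ℕ) × ℕ) => (q.1.1, (s x).1.getD ((s x).2.getD q.2 0) 0))
    (hP.zipIdx.filter (p := fun _ (q : (ℕ × ℕ) × ℕ) => decide (q.1.2 = 0))
      (id.snd.fst.snd.decide_eq (const 0)))
    (id.snd.fst.fst.pair ((hs.comp id.fst).fst.getD ((hs.comp id.fst).snd.getD id.snd.snd)))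

section copies

variable (c : ℕ) {l : α → List ℕ} (hl : PolyTime l)
include hl

theorem logCopies : PolyTime fun x => logCopies c (l x) :=
  hl.length.bits.append (hl.length.bits.append (hl.length.bits.append (const _)))

theorem two_pow_length_logCopies_bounded :
    PolyBounded fun x => 2 ^ (_root_.logCopies c (l x)).length := by
  have hbound := ((PolyBounded.const 2).mul hl.encSize_bounded).add (.const 1)
  refine (((hbound.mul hbound).mul hbound).mul (.const (2 ^ c))).mono fun x => ?_
  have hsize : 2 ^ (l x).length.size ≤ 2 * encSize (l x) + 1 :=
    (two_pow_size_le _).trans (by have := length_lt_encSize (l x); omega)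
  rw [two_pow_length_logCopies, pow_succ, pow_two]
  gcongr

theorem copies : PolyTime fun x => copies (_root_.logCopies c (l x)).length (l x) := by
  simp only [_root_.copies, ← List.foldl_const]
  refine foldl (f := fun _ l _ => l ++ l) (id.snd.fst.append id.snd.fst) hl (logCopies c hl)
    ((two_pow_length_logCopies_bounded c hl).mul hl.encSize_bounded) fun x r hr => ?_
  rw [List.foldl_const]
  refine (encSize_copies_le r.length (l x)).trans (Nat.mul_le_mul_right _ ?_)
  exact Nat.pow_le_pow_right two_pos hr.length_le

theorem fairPoints {k : α → ℕ} (hk : PolyTime k) :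
    PolyTime fun x => fairPoints (_root_.logCopies c (l x)).length (l x) (k x) :=
  ((copies c hl).map (f := fun _ x => (x, 0)) (id.snd.pair (const 0))).append
    ((hl.filter (p := fun a x => decide (x < k a)) (id.snd.decide_lt (hk.comp id.fst))).map
      (f := fun _ x => (x, 1)) (id.snd.pair (const 1)))

end copies

section SoftData

variable {d : α → SoftData} (hd : PolyTime d)
include hd

theorem distances : PolyTime fun x => (d x).distances := hd.fst.distTable

theorem points : PolyTime fun x => (d x).points := hd.fst.range_length

theorem start : PolyTime fun x => (d x).start :=
  hd.distances.fallback hd.points hd.snd.fst hd.snd.snd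

theorem truncatedDistances : PolyTime fun x => (d x).truncatedDistances :=
  ((hd.distances.totalCost hd.start).add (const 1)).truncate hd.distances

variable (c : ℕ)

theorem fairData : PolyTime fun x => (d x).fairData c :=
  (hd.truncatedDistances.tableMatrix hd.points).pair ((fairPoints c hd.points hd.snd.fst).pair
    (hd.snd.fst.pair ((logCopies c hd.points).mul_two_pow_length hd.snd.snd)))

variable {s : α → List ℕ × List ℕ} (hs : PolyTime s)
include hs

theorem rounded : PolyTime fun x => (d x).rounded c (s x) :=
  hd.points.map (f := fun x y => (y, _root_.lookupD ((_root_.halve (_root_.lookupD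
      (d x).truncatedDistances))^[(_root_.logCopies c (d x).points).length]
      (_root_.fairEdges ((d x).fairData c).2.1 (s x))) y))
    (id.snd.pair (lookupD_nat ((hd.truncatedDistances.iterate_halve (logCopies c hd.points)
      ((hd.fairData c).snd.fst.fairEdges hs)).comp id.fst) id.snd))

theorem solution : PolyTime fun x => (d x).solution c (s x) := by
  have hrounded := hd.rounded c hs
  have hbest : PolyTime fun x => (d x).best c (s x) :=
    ite ((hd.distances.totalCost hrounded).decide_lt (hd.distances.totalCost hd.start))
      hrounded hd.start
  have hpack := hd.snd.snd.pack hbest.map_snd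
  exact hpack.fst.map_fst.pair hpack.snd

end SoftData

end PolyTime

/-! ### The fair instance -/

theorem enc_ofFn {α : Type} [Enc α] {n : ℕ} (g : Fin n → α) :
    enc (List.ofFn g) = Data.ofFn fun i => enc (g i) :=
  congrArg Data.ofList List.map_ofFn

theorem countP_finRange {n : ℕ} (p : Fin n → Prop) [DecidablePred p] :
    (List.finRange n).countP (fun i => decide (p i)) = (Finset.univ.filter p).card := by
  rw [← sum_map_ite_eq_countP, Finset.card_filter, Fin.sum_univ_def]
  simp only [decide_eq_true_eq]

theorem card_filter_get {α : Type*} (l : List α) (p : α → Prop) [DecidablePred p] :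
    (Finset.univ.filter fun i : Fin l.length => p (l.get i)).card =
      l.countP fun a => decide (p a) := by
  conv_rhs => rw [← List.map_get_finRange l, List.countP_map]
  exact (countP_finRange fun i => p (l.get i)).symm

theorem sum_map_filter {α : Type*} (l : List α) (p : α → Bool) (f : α → ℕ) :
    ((l.filter p).map f).sum = (l.map fun a => if p a then f a else 0).sum := by
  induction l with
  | nil => rfl
  | cons a l ih => by_cases h : p a <;> simp [h, ih]

section fairPoints

variable (r n k : ℕ)

theorem mem_fairPoints {r n k : ℕ} (p : ℕ × ℕ) (hp : p ∈ fairPoints r (List.range n) k) :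
    p.1 < n ∧ p.2 < 2 := by
  rcases List.mem_append.1 hp with hp | hp
  · obtain ⟨x, hx, rfl⟩ := List.mem_map.1 hp
    exact ⟨List.mem_range.1 (mem_of_mem_copies r _ hx), two_pos⟩
  · obtain ⟨x, hx, rfl⟩ := List.mem_map.1 hp
    exact ⟨List.mem_range.1 (List.mem_filter.1 hx).1, one_lt_two⟩

theorem sum_map_fairPoints (f : ℕ × ℕ → ℕ) :
    ((fairPoints r (List.range n) k).map f).sum = 2 ^ r * ∑ x : Fin n, f (x, 0) +
      ∑ x : Fin n, if (x : ℕ) < k then f (x, 1) else 0 := by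
  rw [fairPoints, List.map_append, List.sum_append, List.map_map, List.map_map,
    sum_map_copies, sum_map_range, sum_map_filter, sum_map_range]
  simp only [Function.comp_apply, decide_eq_true_eq]

theorem countP_fairPoints (p : ℕ × ℕ → Prop) [DecidablePred p] :
    ((fairPoints r (List.range n) k).countP fun q => decide (p q)) =
      2 ^ r * (Finset.univ.filter fun x : Fin n => p (x, 0)).card +
        (Finset.univ.filter fun x : Fin n => (x : ℕ) < k ∧ p (x, 1)).card := by
  rw [← sum_map_ite_eq_countP, sum_map_fairPoints, Finset.card_filter, Finset.card_filter]
  simp only [decide_eq_true_eq, ite_and]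

theorem countP_fairPoints_snd_eq_one_le :
    ((fairPoints r (List.range n) k).countP fun q => decide (q.2 = 1)) ≤ k := by
  rw [countP_fairPoints]
  calc 2 ^ r * (Finset.univ.filter fun x : Fin n => 0 = 1).card +
        (Finset.univ.filter fun x : Fin n => (x : ℕ) < k ∧ 1 = 1).card
      = (Finset.univ.filter fun x : Fin n => (x : ℕ) < k).card := by simp
    _ ≤ (Finset.range k).card :=
        Finset.card_le_card_of_injOn Fin.val (fun x hx => by simpa using hx)
          Fin.val_injective.injOn
    _ = k := Finset.card_range k

end fairPoints

namespace IsNatMetric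

variable {n : ℕ} {W : ℕ × ℕ → ℕ} (hW : IsNatMetric n W)
include hW

theorem truncate {B : ℕ} (hB : 0 < B) : IsNatMetric n fun p => min (W p) B where
  eq_zero x hx y hy := by
    rw [← hW.eq_zero x hx y hy]
    omega
  comm x hx y hy := by simp only [hW.comm x hx y hy]
  triangle x hx y hy z hz := by
    have := hW.triangle x hx y hy z hz
    omega

/-- The metric space given by integral distances. -/
def space : FinMetric where
  n := n
  dist x y := W (x, y)
  dist_eq_zero x y := by rw [Nat.cast_eq_zero, hW.eq_zero x x.2 y y.2, Fin.ext_iff]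
  dist_comm x y := by rw [hW.comm x x.2 y y.2]
  dist_triangle x y z := by exact_mod_cast hW.triangle x x.2 y y.2 z z.2

theorem matrix_space : hW.space.matrix = tableMatrix (table n W) (List.range n) := by
  refine ofFn_eq_map_range _ _ fun x => ofFn_eq_map_range _ _ fun y => ?_
  rw [lookupD_table W ⟨x.2, y.2⟩]
  simp [space]

variable (P : List (ℕ × ℕ)) (hP : ∀ p ∈ P, p.1 < n ∧ p.2 < 2) (k t : ℕ) (ht : 1 ≤ t)

/-- The fair instance with given integral distances and a given list of points, as pairs of a
location and a group. -/
def fairInst : PairwiseFairInst 2 where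
  space := hW.space
  N := P.length
  loc p := ⟨(P.get p).1, (hP _ (P.get_mem p)).1⟩
  group p := ⟨(P.get p).2, (hP _ (P.get_mem p)).2⟩
  k := k
  t := t
  one_le_t := ht

theorem encode_fairInst :
    (hW.fairInst P hP k t ht).encode = enc (tableMatrix (table n W) (List.range n), P, k, t) := by
  have hpoints : (Data.ofFn fun p => .node (Data.ofNat ((hW.fairInst P hP k t ht).loc p))
      (Data.ofNat ((hW.fairInst P hP k t ht).group p))) = enc P := by
    conv_rhs => rw [← List.ofFn_get P, enc_ofFn]
    rfl
  rw [enc_prod, enc_prod, ← hW.matrix_space, FinMetric.enc_matrix, ← hpoints]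
  rfl

theorem exists_fairSol {m : ℕ} (hm : m ≤ k) (center : Fin m → Fin n) (φ : ℕ × ℕ → Fin m)
    (hφ : ∀ (j : Fin m) (a b : Fin 2), (P.countP fun q => decide (φ q = j ∧ q.2 = a)) ≤
      t * P.countP fun q => decide (φ q = j ∧ q.2 = b)) :
    ∃ S : PairwiseFairSol (hW.fairInst P hP k t ht), (pairwiseFairKMedian 2).cost _ S =
      ((P.map fun q => W (q.1, center (φ q))).sum : ℕ) := by
  have hcount (j : Fin m) (a : Fin 2) : (Finset.univ.filter fun p : Fin P.length =>
      φ (P.get p) = j ∧ (⟨(P.get p).2, (hP _ (P.get_mem p)).2⟩ : Fin 2) = a).card =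
        P.countP fun q => decide (φ q = j ∧ q.2 = a) := by
    rw [← card_filter_get]
    exact congrArg Finset.card (Finset.filter_congr fun p _ => and_congr_right fun _ => Fin.ext_iff)
  refine ⟨⟨m, hm, center, fun p => φ (P.get p), fun j a b => ?_⟩, ?_⟩
  · exact (hcount j a).trans_le ((hφ j a b).trans_eq (congrArg _ (hcount j b).symm))
  · rw [← Fin.sum_univ_fun_getElem P fun q => W (q.1, center (φ q)), Nat.cast_sum]
    rfl

end IsNatMetric

namespace SoftCkMSol

variable {I : SoftCkMInst}

theorem card_le (S : SoftCkMSol I) : I.space.n ≤ I.k * I.u := by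
  have hcard : (Finset.univ : Finset (Fin I.space.n)).card ≤
      I.u * (Finset.univ : Finset (Fin S.numFacilities)).card :=
    Finset.card_le_mul_card_image_of_maps_to (f := S.assign) (fun _ _ => Finset.mem_univ _) _
      fun j _ => S.capacity j
  rw [Finset.card_fin, Finset.card_fin, mul_comm] at hcard
  exact hcard.trans (Nat.mul_le_mul_right _ S.numFacilities_le)

/-- Every facility in use gets a point of the second group, since there are at most `k` and at most
`n` of them; superfluous points join clusters in use. -/
theorem exists_enumeration (S : SoftCkMSol I) (hn : 0 < I.space.n) :
    ∃ h : ℕ → Fin S.numFacilities, (∀ i, ∃ x, S.assign x = h i) ∧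
      ∀ x, ∃ i : Fin I.space.n, (i : ℕ) < I.k ∧ h i = S.assign x := by
  let used := (Finset.univ.image S.assign).toList
  have hused : ∀ j, j ∈ used ↔ ∃ x, S.assign x = j := by simp [used]
  refine ⟨fun i => used.getD i (S.assign ⟨0, hn⟩), fun i => ?_, fun x => ?_⟩
  · rcases lt_or_ge i used.length with hi | hi
    · dsimp only
      rw [List.getD_eq_getElem _ _ hi]
      exact (hused _).1 (List.getElem_mem hi)
    · exact ⟨_, (List.getD_eq_default _ _ hi).symm⟩
  · obtain ⟨i, hi, hix⟩ := List.mem_iff_getElem.1 ((hused _).2 ⟨x, rfl⟩)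
    have hk : used.length ≤ I.k := by
      rw [Finset.length_toList]
      exact (Finset.card_le_univ _).trans ((Fintype.card_fin _).trans_le S.numFacilities_le)
    have hn : used.length ≤ I.space.n := by
      rw [Finset.length_toList]
      exact Finset.card_image_le.trans (Finset.card_fin _).le
    exact ⟨⟨i, hi.trans_le hn⟩, hi.trans_le hk, (List.getD_eq_getElem _ _ hi).trans hix⟩

/-- The cluster of a point of the fair instance: copies follow the original, and the second group
is distributed by `h`. -/
def cluster (S : SoftCkMSol I) (h : ℕ → Fin S.numFacilities) (q : ℕ × ℕ) : Fin S.numFacilities :=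
  if hq : q.2 = 0 ∧ q.1 < I.space.n then S.assign ⟨q.1, hq.2⟩ else h q.1

variable {S : SoftCkMSol I} {h : ℕ → Fin S.numFacilities}

theorem cluster_zero (x : Fin I.space.n) : S.cluster h (x, 0) = S.assign x := by simp [cluster]

theorem cluster_one (x : ℕ) : S.cluster h (x, 1) = h x := by simp [cluster]

theorem countP_cluster_zero (r : ℕ) (j : Fin S.numFacilities) :
    ((fairPoints r (List.range I.space.n) I.k).countP fun q =>
      decide (S.cluster h q = j ∧ q.2 = (0 : Fin 2))) =
      2 ^ r * (Finset.univ.filter fun x => S.assign x = j).card := by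
  rw [countP_fairPoints]
  simp [cluster_zero]

theorem countP_cluster_one (r : ℕ) (j : Fin S.numFacilities) :
    ((fairPoints r (List.range I.space.n) I.k).countP fun q =>
      decide (S.cluster h q = j ∧ q.2 = (1 : Fin 2))) =
      (Finset.univ.filter fun x : Fin I.space.n => (x : ℕ) < I.k ∧ h x = j).card := by
  rw [countP_fairPoints]
  simp [cluster_one]

theorem countP_cluster_le (hused : ∀ i, ∃ x, S.assign x = h i)
    (hsurj : ∀ x, ∃ i : Fin I.space.n, (i : ℕ) < I.k ∧ h i = S.assign x) {r : ℕ}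
    (hr : I.space.n ≤ 2 ^ r) (ht : 1 ≤ I.u * 2 ^ r) (j : Fin S.numFacilities) (a b : Fin 2) :
    ((fairPoints r (List.range I.space.n) I.k).countP fun q =>
      decide (S.cluster h q = j ∧ q.2 = a)) ≤
      I.u * 2 ^ r * (fairPoints r (List.range I.space.n) I.k).countP fun q =>
        decide (S.cluster h q = j ∧ q.2 = b) := by
  obtain rfl | hab := eq_or_ne a b
  · exact Nat.le_mul_of_pos_left _ ht
  have hcap := S.capacity j
  have hblue : (Finset.univ.filter fun x : Fin I.space.n => (x : ℕ) < I.k ∧ h x = j).card ≤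
      2 ^ r := (Finset.card_filter_le _ _).trans ((Finset.card_fin _).trans_le hr)
  have hpos : 0 < (Finset.univ.filter fun x => S.assign x = j).card ↔
      0 < (Finset.univ.filter fun x : Fin I.space.n => (x : ℕ) < I.k ∧ h x = j).card := by
    simp only [Finset.card_pos, Finset.filter_nonempty_iff, Finset.mem_univ, true_and]
    constructor
    · rintro ⟨x, rfl⟩
      exact hsurj x
    · rintro ⟨i, -, rfl⟩
      exact hused i
  have hcases : a = 0 ∧ b = 1 ∨ a = 1 ∧ b = 0 := by omega
  rcases hcases with ⟨rfl, rfl⟩ | ⟨rfl, rfl⟩ <;> rw [countP_cluster_zero, countP_cluster_one] <;>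
    generalize (Finset.univ.filter fun x => S.assign x = j).card = red at * <;>
    generalize (Finset.univ.filter fun x : Fin I.space.n => (x : ℕ) < I.k ∧ h x = j).card =
      blue at *
  · rcases Nat.eq_zero_or_pos red with rfl | hred
    · exact Nat.zero_le _
    · calc 2 ^ r * red ≤ 2 ^ r * I.u := Nat.mul_le_mul_left _ hcap
        _ = I.u * 2 ^ r * 1 := by ring
        _ ≤ I.u * 2 ^ r * blue := Nat.mul_le_mul_left _ (hpos.1 hred)
  · rcases Nat.eq_zero_or_pos blue with rfl | hblue_pos
    · exact Nat.zero_le _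
    · calc blue ≤ 1 * (2 ^ r * 1) := by omega
        _ ≤ I.u * 2 ^ r * (2 ^ r * red) :=
          Nat.mul_le_mul ht (Nat.mul_le_mul_left _ (hpos.2 hblue_pos))

variable (S)

theorem exists_fairSol_cost_le (hn : 0 < I.space.n) {W : ℕ × ℕ → ℕ}
    (hW : IsNatMetric I.space.n W) {B : ℕ} (hB : ∀ p, W p ≤ B) {r : ℕ}
    (hr : I.space.n ≤ 2 ^ r) (ht : 1 ≤ I.u * 2 ^ r) :
    ∃ S' : PairwiseFairSol (hW.fairInst (fairPoints r (List.range I.space.n) I.k) mem_fairPoints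
        I.k (I.u * 2 ^ r) ht),
      (pairwiseFairKMedian 2).cost _ S' ≤ (2 ^ r * S.natCost W + I.space.n * B : ℕ) := by
  obtain ⟨h, hused, hsurj⟩ := S.exists_enumeration hn
  obtain ⟨S', hS'⟩ := hW.exists_fairSol _ mem_fairPoints I.k _ ht S.numFacilities_le S.facility
    (S.cluster h) (countP_cluster_le hused hsurj hr ht)
  have hsecond : (∑ x : Fin I.space.n, if (x : ℕ) < I.k then
      W (x, S.facility (S.cluster h (x, 1))) else 0) ≤ I.space.n * B := by
    refine (Finset.sum_le_card_nsmul _ _ B fun x _ => ?_).trans_eq (by simp)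
    split_ifs
    exacts [hB _, Nat.zero_le _]
  refine ⟨S', hS'.trans_le (Nat.cast_le.2 ?_)⟩
  rw [sum_map_fairPoints]
  simp only [cluster_zero]
  exact Nat.add_le_add_left hsecond _

end SoftCkMSol

namespace PairwiseFairSol

theorem card_filter_center_le {ℓ : ℕ} {J : PairwiseFairInst ℓ} (S : PairwiseFairSol J)
    (p : Fin J.space.n → Prop) [DecidablePred p] (a b : Fin ℓ) :
    (Finset.univ.filter fun i => J.group i = a ∧ p (S.center (S.assign i))).card ≤
      J.t * (Finset.univ.filter fun i => J.group i = b ∧ p (S.center (S.assign i))).card := by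
  have hclusters (a : Fin ℓ) :
      (Finset.univ.filter fun i => J.group i = a ∧ p (S.center (S.assign i))).card =
        ∑ j with p (S.center j),
          (Finset.univ.filter fun i => S.assign i = j ∧ J.group i = a).card := by
    rw [Finset.card_eq_sum_card_fiberwise (f := S.assign)
      (t := Finset.univ.filter fun j => p (S.center j)) fun i hi =>
        Finset.mem_coe.2 (Finset.mem_filter.2
          ⟨Finset.mem_univ _, (Finset.mem_filter.1 (Finset.mem_coe.1 hi)).2.2⟩)]
    refine Finset.sum_congr rfl fun j hj => congrArg Finset.card ?_
    ext i
    have := (Finset.mem_filter.1 hj).2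
    simp only [Finset.mem_filter, Finset.mem_univ, true_and]
    grind
  rw [hclusters, hclusters, Finset.mul_sum]
  exact Finset.sum_le_sum fun j _ => S.fair j a b

/-- The encoding of a fair clustering, as lists of centers and of clusters of the points. -/
def lists {ℓ : ℕ} {J : PairwiseFairInst ℓ} (S : PairwiseFairSol J) : List ℕ × List ℕ :=
  (List.ofFn fun j => (S.center j : ℕ), List.ofFn fun p => (S.assign p : ℕ))

theorem enc_lists {ℓ : ℕ} {J : PairwiseFairInst ℓ} (S : PairwiseFairSol J) :
    enc S.lists = (pairwiseFairKMedian ℓ).encSol J S := by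
  rw [lists, enc_prod, enc_ofFn, enc_ofFn]
  rfl

variable {n : ℕ} {W : ℕ × ℕ → ℕ} {hW : IsNatMetric n W} {P : List (ℕ × ℕ)}
  {hP : ∀ p ∈ P, p.1 < n ∧ p.2 < 2} {k t : ℕ} {ht : 1 ≤ t}
  (S : PairwiseFairSol (hW.fairInst P hP k t ht))

theorem fairEdges_lists : fairEdges P S.lists =
    ((List.finRange P.length).filter fun i => decide ((P.get i).2 = 0)).map fun i =>
      ((P.get i).1, (S.center (S.assign i) : ℕ)) := by
  have hzipIdx : P.zipIdx = (List.finRange P.length).map fun i => (P.get i, (i : ℕ)) :=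
    List.ext_getElem (by simp) fun i _ _ => by simp
  have hassign (i : Fin P.length) : S.lists.2.getD i 0 = S.assign i :=
    (List.getD_eq_getElem _ _ (by simp [lists, IsNatMetric.fairInst])).trans (List.getElem_ofFn _)
  have hcenter (j : Fin S.numClusters) : S.lists.1.getD j 0 = S.center j :=
    (List.getD_eq_getElem _ _ (by simp [lists])).trans (List.getElem_ofFn _)
  rw [fairEdges, hzipIdx, List.filter_map, List.map_map]
  exact List.map_congr_left fun i _ => by simp only [Function.comp_apply, hassign, hcenter]

theorem mem_fairEdges (q : ℕ × ℕ) (hq : q ∈ fairEdges P S.lists) : q.1 < n ∧ q.2 < n := by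
  rw [S.fairEdges_lists] at hq
  obtain ⟨i, -, rfl⟩ := List.mem_map.1 hq
  exact ⟨(hP _ (P.get_mem i)).1, (S.center (S.assign i)).2⟩

theorem sum_map_fairEdges_le :
    (((fairEdges P S.lists).map W).sum : ℚ≥0) ≤ (pairwiseFairKMedian 2).cost _ S := by
  have hcost : (pairwiseFairKMedian 2).cost _ S =
      (∑ i : Fin P.length, W ((P.get i).1, S.center (S.assign i)) : ℕ) := by
    rw [Nat.cast_sum]
    rfl
  rw [hcost, Nat.cast_le, S.fairEdges_lists, List.map_map, Fin.sum_univ_def]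
  exact (List.filter_sublist.map _).sum_le_sum fun _ _ => Nat.zero_le _

theorem countP_fairEdges (p : ℕ × ℕ → Prop) [DecidablePred p] :
    ((fairEdges P S.lists).countP fun q => decide (p q)) = (Finset.univ.filter
      fun i : Fin P.length => (P.get i).2 = 0 ∧ p ((P.get i).1, S.center (S.assign i))).card := by
  rw [S.fairEdges_lists, List.countP_map, List.countP_filter, ← countP_finRange]
  exact List.countP_congr fun i _ => by simp [and_comm]

theorem exists_countP_snd_fairEdges_le :
    ∃ b : ℕ → ℕ, (∀ c, ((fairEdges P S.lists).countP fun q => decide (q.2 = c)) ≤ t * b c) ∧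
      ∑ c ∈ Finset.range n, b c = P.countP fun q => decide (q.2 = 1) := by
  refine ⟨fun c => (Finset.univ.filter fun i => (hW.fairInst P hP k t ht).group i = 1 ∧
    (S.center (S.assign i) : ℕ) = c).card, fun c => ?_, ?_⟩
  · have hfair := S.card_filter_center_le (fun x => (x : ℕ) = c) 0 1
    simp only [Fin.ext_iff] at hfair ⊢
    rw [countP_fairEdges]
    exact hfair
  · have hfibers := Finset.card_eq_sum_card_fiberwise (s := Finset.univ.filter fun i =>
      (hW.fairInst P hP k t ht).group i = 1) (f := fun i => (S.center (S.assign i) : ℕ))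
      (t := Finset.range n) fun i _ =>
        Finset.mem_coe.2 (Finset.mem_range.2 (S.center (S.assign i)).2)
    simp only [Finset.filter_filter] at hfibers
    rw [← hfibers, ← card_filter_get]
    exact congrArg Finset.card (Finset.filter_congr fun i _ => Fin.ext_iff)

end PairwiseFairSol

/-! ### Rounding a fair clustering -/

theorem sum_map_lookupD_le {E : List (ℕ × ℕ)} {n : ℕ} (hE : ∀ x < n, ∃ p ∈ E, p.1 = x)
    (f : ℕ × ℕ → ℕ) : ((List.range n).map fun x => f (x, lookupD E x)).sum ≤ (E.map f).sum := by
  have hsubperm : List.Subperm ((List.range n).map fun x => (x, lookupD E x)) E := by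
    refine List.subperm_of_subset
      (List.Nodup.map (fun _ _ h => (Prod.ext_iff.1 h).1) List.nodup_range) fun p hp => ?_
    obtain ⟨x, hx, rfl⟩ := List.mem_map.1 hp
    exact lookupD_mem (hE x (List.mem_range.1 hx))
  obtain ⟨l, hperm, hsublist⟩ := hsubperm
  have hsum := (hperm.map f).sum_eq
  rw [List.map_map] at hsum
  exact hsum.symm.trans_le ((hsublist.map f).sum_le_sum fun _ _ => Nat.zero_le _)

namespace PairwiseFairSol

variable {n r k u : ℕ} {W : ℕ × ℕ → ℕ} {hW : IsNatMetric n W} {ht : 1 ≤ u * 2 ^ r}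
  (S : PairwiseFairSol
    (hW.fairInst (fairPoints r (List.range n) k) mem_fairPoints k (u * 2 ^ r) ht))

/-- The edges of an integral assignment, obtained from the centers of the `2 ^ r` copies of each
point by halving the multigraph of points and centers `r` times. -/
def roundedEdges : List (ℕ × ℕ) :=
  (halve (lookupD (table n W)))^[r] (fairEdges (fairPoints r (List.range n) k) S.lists)

theorem mem_roundedEdges {q : ℕ × ℕ} (hq : q ∈ S.roundedEdges) : q.1 < n ∧ q.2 < n :=
  S.mem_fairEdges q (mem_of_mem_iterate_halve _ hq)

theorem countP_fst_fairEdges {x : ℕ} (hx : x < n) :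
    ((fairEdges (fairPoints r (List.range n) k) S.lists).countP fun q => decide (q.1 = x)) =
      2 ^ r := by
  refine (S.countP_fairEdges fun q => q.1 = x).trans
    ((card_filter_get _ fun q : ℕ × ℕ => q.2 = 0 ∧ q.1 = x).trans ?_)
  rw [countP_fairPoints]
  have hcopies : (Finset.univ.filter fun y : Fin n => (y : ℕ) = x) = {⟨x, hx⟩} := by
    ext y
    simp [Fin.ext_iff]
  simp [hcopies]

theorem exists_mem_roundedEdges {x : ℕ} (hx : x < n) : ∃ q ∈ S.roundedEdges, q.1 = x := by
  have hcount : (S.roundedEdges.countP fun q => q.1 = x) = 1 :=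
    countP_fst_iterate_halve _ r _ ((S.countP_fst_fairEdges hx).trans (mul_one _).symm)
  obtain ⟨q, hq, hqx⟩ := List.countP_pos_iff.1 (hcount ▸ one_pos)
  exact ⟨q, hq, of_decide_eq_true hqx⟩

/-- The integral assignment obtained from a fair clustering. -/
def rounding (x : ℕ) : ℕ := lookupD S.roundedEdges x

theorem rounding_lt {x : ℕ} (hx : x < n) : S.rounding x < n :=
  (S.mem_roundedEdges (lookupD_mem (S.exists_mem_roundedEdges hx))).2

theorem count_map_rounding_le (c : ℕ) :
    ((List.range n).map S.rounding).count c ≤ S.roundedEdges.countP fun q => q.2 = c := by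
  have hle := sum_map_lookupD_le (fun _ => S.exists_mem_roundedEdges)
    fun q => if decide (q.2 = c) then 1 else 0
  rw [sum_map_ite_eq_countP, sum_map_ite_eq_countP] at hle
  rw [List.count, List.countP_map]
  exact hle

theorem length_pack_rounding_le (hu : 1 ≤ u) :
    (pack u ((List.range n).map S.rounding)).1.length ≤ k := by
  obtain ⟨b, hb, hsum⟩ := S.exists_countP_snd_fairEdges_le
  refine (length_pack_fst_le_sum hu (fun c hc => ?_) fun c _ =>
    (S.count_map_rounding_le c).trans (countP_snd_iterate_halve_le _ r _ ?_)).trans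
      (hsum.trans_le (countP_fairPoints_snd_eq_one_le r n k))
  · obtain ⟨x, hx, rfl⟩ := List.mem_map.1 hc
    exact Finset.mem_range.2 (S.rounding_lt (List.mem_range.1 hx))
  · exact (hb c).trans_eq (by ring)

theorem two_pow_mul_sum_rounding_le :
    ((2 ^ r * ∑ x : Fin n, W (x, S.rounding x) : ℕ) : ℚ≥0) ≤ (pairwiseFairKMedian 2).cost _ S := by
  refine le_trans (Nat.cast_le.2 ?_) S.sum_map_fairEdges_le
  have hhalve := two_pow_mul_sum_map_iterate_halve_le (lookupD (table n W)) r
    (fairEdges (fairPoints r (List.range n) k) S.lists)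
  have hrounded := totalCost_table W fun q => S.mem_roundedEdges (q := q)
  have hedges := totalCost_table W S.mem_fairEdges
  calc 2 ^ r * ∑ x : Fin n, W (x, S.rounding x)
      = 2 ^ r * ((List.range n).map fun x => W (x, S.rounding x)).sum := by rw [sum_map_range]
    _ ≤ 2 ^ r * (S.roundedEdges.map W).sum :=
        Nat.mul_le_mul_left _ (sum_map_lookupD_le (fun _ => S.exists_mem_roundedEdges) W)
    _ ≤ ((fairEdges (fairPoints r (List.range n) k) S.lists).map W).sum := by
        rw [← hrounded, ← hedges]
        exact hhalve

end PairwiseFairSol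

/-! ### Correctness of the reduction -/

namespace SoftCkMSol

variable {I : SoftCkMInst}

theorem exists_of_lists {F a : List ℕ} {f : ℕ → ℕ} (hk : F.length ≤ I.k)
    (hF : ∀ c ∈ F, c < I.space.n)
    (ha : List.Forall₂ (fun j c => F[j]? = some c) a ((List.range I.space.n).map f))
    (hu : ∀ j, a.count j ≤ I.u) :
    ∃ S : SoftCkMSol I, softCapacitatedKMedian.encSol I S = enc (F, a) ∧
      ∀ x, (S.facility (S.assign x) : ℕ) = f x := by
  have hlength : a.length = I.space.n := by simpa using ha.length_eq
  obtain ⟨⟨n, dist, hzero, hcomm, htri⟩, k, u⟩ := I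
  obtain rfl : a.length = n := hlength
  have hget (x : Fin a.length) : F[a.get x]? = some (f x) := by
    simpa using ha.get x.2 (by simp)
  have hassign (x : Fin a.length) : a.get x < F.length :=
    (List.getElem?_eq_some_iff.1 (hget x)).1
  refine ⟨⟨F.length, hk, fun j => ⟨F.get j, hF _ (F.get_mem j)⟩,
    fun x => ⟨a.get x, hassign x⟩, fun j => ?_⟩, ?_, fun x => ?_⟩
  · simp only [Fin.ext_iff]
    refine (card_filter_get a fun i => i = j).trans_le ((hu j).trans_eq' ?_)
    exact List.countP_congr fun i _ => by simp
  · conv_rhs => rw [← List.ofFn_get F, ← List.ofFn_get a, enc_prod, enc_ofFn, enc_ofFn]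
    rfl
  · exact (List.getElem?_eq_some_iff.1 (hget x)).2

theorem exists_of_pack (hu : 1 ≤ I.u) {f : ℕ → ℕ} (hf : ∀ x < I.space.n, f x < I.space.n)
    (hk : (pack I.u ((List.range I.space.n).map f)).1.length ≤ I.k) :
    ∃ S : SoftCkMSol I, softCapacitatedKMedian.encSol I S =
        enc ((pack I.u ((List.range I.space.n).map f)).1.map Prod.fst,
          (pack I.u ((List.range I.space.n).map f)).2) ∧
      ∀ x, (S.facility (S.assign x) : ℕ) = f x := by
  refine exists_of_lists (by rwa [List.length_map]) (fun c hc => ?_) (forall₂_pack _ _)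
    (count_pack_le hu _)
  obtain ⟨q, hq, rfl⟩ := List.mem_map.1 hc
  obtain ⟨x, hx, hxq⟩ := List.mem_map.1 (mem_pack hq).1
  rw [← hxq]
  exact hf x (List.mem_range.1 hx)

theorem natCost_eq_mul_cost (S : SoftCkMSol I) {L : ℕ} {W : ℕ × ℕ → ℕ}
    (hW : ∀ x y : Fin I.space.n, (W (x, y) : ℚ≥0) = L * I.space.dist x y) :
    (S.natCost W : ℚ≥0) = L * softCapacitatedKMedian.cost I S := by
  rw [natCost, Nat.cast_sum, Finset.sum_congr rfl fun x _ => hW x _, ← Finset.mul_sum]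
  rfl

end SoftCkMSol

theorem min_sum_le_sum_min {ι : Type*} (s : Finset ι) (f : ι → ℕ) (B : ℕ) :
    min (∑ i ∈ s, f i) B ≤ ∑ i ∈ s, min (f i) (B + 1) := by
  by_cases h : ∃ i ∈ s, B < f i
  · obtain ⟨i, hi, hB⟩ := h
    have hsingle := Finset.single_le_sum (f := fun i => min (f i) (B + 1))
      (fun _ _ => Nat.zero_le _) hi
    omega
  · refine (min_le_left _ _).trans (Finset.sum_le_sum fun i hi => ?_)
    have : f i ≤ B := not_lt.1 fun hB => h ⟨i, hi, hB⟩
    omega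

namespace SoftCkMInst

variable (I : SoftCkMInst)

/-- An instance as lists. -/
def data : SoftData := (I.space.matrix, I.k, I.u)

theorem enc_data : enc I.data = I.encode := by
  rw [data, enc_prod, FinMetric.enc_matrix]
  rfl

theorem length_matrix : I.data.1.length = I.space.n := List.length_ofFn

theorem points_data : I.data.points = List.range I.space.n :=
  congrArg List.range I.length_matrix

variable (W : ℕ × ℕ → ℕ) (c : ℕ)

/-- The cost of the fallback assignment. -/
def fallbackCost : ℕ :=
  totalCost (table I.space.n W) (fallback (table I.space.n W) (List.range I.space.n) I.k I.u)

/-- The distances of the fair instance. The truncation bounds the cost of the points of the second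
group by a polynomial multiple of the optimum, and a truncated distance still exceeds the cost of
the fallback assignment. -/
def truncatedDist (p : ℕ × ℕ) : ℕ := min (W p) (I.fallbackCost W + 1)

/-- The number of halvings, the binary logarithm of the number of copies of each point. -/
def numHalvings : ℕ := (logCopies c (List.range I.space.n)).length

theorem pow_mul_le_two_pow_numHalvings : I.space.n ^ 3 * 2 ^ c ≤ 2 ^ I.numHalvings c := by
  have hle := length_pow_mul_le_two_pow_logCopies c (List.range I.space.n)
  rwa [List.length_range] at hle

theorem n_le_two_pow_numHalvings : I.space.n ≤ 2 ^ I.numHalvings c :=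
  calc I.space.n ≤ I.space.n ^ 3 := Nat.le_self_pow three_ne_zero _
    _ ≤ I.space.n ^ 3 * 2 ^ c := Nat.le_mul_of_pos_right _ (Nat.two_pow_pos c)
    _ ≤ 2 ^ I.numHalvings c := I.pow_mul_le_two_pow_numHalvings c

variable {I W} (hW : IsNatMetric I.space.n W) (hu : 1 ≤ I.u)

/-- The fair instance to which a soft capacitated instance is reduced. -/
def fairInst : PairwiseFairInst 2 :=
  IsNatMetric.fairInst (hW.truncate (Nat.succ_pos (I.fallbackCost W)))
    (fairPoints (I.numHalvings c) (List.range I.space.n) I.k) mem_fairPoints I.k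
    (I.u * 2 ^ I.numHalvings c) (Nat.mul_pos hu (Nat.two_pow_pos _))

section data

variable (hT : distTable I.space.matrix = table I.space.n W)
include hT

theorem start_data : I.data.start =
    fallback (table I.space.n W) (List.range I.space.n) I.k I.u := by
  rw [← hT, ← points_data]
  rfl

theorem totalCost_start_data : totalCost I.data.distances I.data.start = I.fallbackCost W := by
  rw [start_data hT, fallbackCost, ← hT]
  rfl

theorem truncatedDistances_data :
    I.data.truncatedDistances = table I.space.n (I.truncatedDist W) := by
  rw [SoftData.truncatedDistances, totalCost_start_data hT]
  exact (congrArg _ hT).trans (truncate_table _ _ _)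

theorem encode_fairInst : (fairInst c hW hu).encode = enc (I.data.fairData c) := by
  rw [fairInst, IsNatMetric.encode_fairInst, SoftData.fairData, truncatedDistances_data hT,
    points_data]
  rfl

theorem rounded_data (S : PairwiseFairSol (fairInst c hW hu)) : I.data.rounded c S.lists =
    (List.range I.space.n).map fun x => (x, PairwiseFairSol.rounding S x) := by
  rw [SoftData.rounded, SoftData.fairData, truncatedDistances_data hT, points_data]
  rfl

variable (hn : 0 < I.space.n) (hk : I.space.n ≤ I.k * I.u)
include hn hk

theorem exists_best_eq_map (S : PairwiseFairSol (fairInst c hW hu)) :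
    ∃ g : ℕ → ℕ, I.data.best c S.lists = (List.range I.space.n).map (fun x => (x, g x)) ∧
      (∀ x < I.space.n, g x < I.space.n) ∧
      (pack I.u ((List.range I.space.n).map g)).1.length ≤ I.k ∧
      ∑ x : Fin I.space.n, W (x, g x) ≤
        min (∑ x : Fin I.space.n, W (x, PairwiseFairSol.rounding S x)) (I.fallbackCost W) := by
  obtain ⟨f, hf, hlt, hpack⟩ := exists_fallback_table_eq_map hW hn hu hk
  have hfcost : I.fallbackCost W = ∑ x : Fin I.space.n, W (x, f x) := by
    rw [fallbackCost, hf, totalCost_table_map_range W hlt]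
  have hrounding : ∀ x < I.space.n, PairwiseFairSol.rounding S x < I.space.n :=
    fun _ => PairwiseFairSol.rounding_lt S
  have hrcost : totalCost I.data.distances (I.data.rounded c S.lists) =
      ∑ x : Fin I.space.n, W (x, PairwiseFairSol.rounding S x) := by
    rw [rounded_data c hW hu hT, ← totalCost_table_map_range W hrounding, ← hT]
    rfl
  rw [SoftData.best, totalCost_start_data hT, hrcost]
  split_ifs with hlt'
  · exact ⟨_, rounded_data c hW hu hT S, hrounding,
      PairwiseFairSol.length_pack_rounding_le S hu, le_min le_rfl hlt'.le⟩
  · exact ⟨f, (start_data hT).trans hf, hlt, hpack, hfcost ▸ le_min (not_lt.1 hlt') le_rfl⟩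

theorem exists_sol_of_fairSol (S : PairwiseFairSol (fairInst c hW hu)) :
    ∃ R : SoftCkMSol I, softCapacitatedKMedian.encSol I R = enc (I.data.solution c S.lists) ∧
      R.natCost W ≤ I.fallbackCost W ∧
      ((2 ^ I.numHalvings c * R.natCost W : ℕ) : ℚ≥0) ≤ (pairwiseFairKMedian 2).cost _ S := by
  obtain ⟨g, hg, hlt, hpack, hle⟩ := exists_best_eq_map c hW hu hT hn hk S
  obtain ⟨R, henc, hR⟩ := SoftCkMSol.exists_of_pack hu hlt hpack
  have hcost : R.natCost W = ∑ x : Fin I.space.n, W (x, g x) := by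
    simp only [SoftCkMSol.natCost, hR]
  rw [← hcost] at hle
  refine ⟨R, ?_, hle.trans (min_le_right _ _), ?_⟩
  · rw [henc, SoftData.solution, hg, List.map_map]
    rfl
  · refine le_trans (Nat.cast_le.2 (Nat.mul_le_mul_left _ (hle.trans ?_)))
      (PairwiseFairSol.two_pow_mul_sum_rounding_le S)
    exact min_sum_le_sum_min _ _ _

end data

end SoftCkMInst

/-- A solution whose cost is at most `a` times that of every feasible solution. -/
def MinProblem.IsApprox (Q : MinProblem) (a : ℝ) {I : Q.Inst} (S : Q.Sol I) : Prop :=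
  ∀ S' : Q.Sol I, (Q.cost I S : ℝ) ≤ a * Q.cost I S'

theorem le_one_add_mul_of_scaled_le {n c M A B F : ℕ} {ε a : ℝ} (ha : 0 ≤ a)
    (hc : 2 ≤ ε * 2 ^ c) (hM : n ^ 3 * 2 ^ c ≤ M) (hM₀ : 0 < M) (hAF : A ≤ F)
    (hFB : F ≤ n * n * B) (hle : (M * A : ℝ) ≤ a * (M * B + n * (F + 1))) :
    (A : ℝ) ≤ (1 + ε) * a * B := by
  have hε : 0 ≤ ε := (pos_of_mul_pos_left (two_pos.trans_le hc) (by positivity)).le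
  rcases Nat.eq_zero_or_pos (n * n * B) with hzero | hpos
  · obtain rfl : A = 0 := by omega
    rw [Nat.cast_zero]
    positivity
  have herror : (n * (F + 1) : ℝ) ≤ ε * M * B :=
    calc (n * (F + 1) : ℝ) ≤ n * (2 * (n * n * B)) := by
          gcongr
          exact_mod_cast (by omega : F + 1 ≤ 2 * (n * n * B))
      _ = 2 * n ^ 3 * B := by ring
      _ ≤ ε * 2 ^ c * n ^ 3 * B := by gcongr
      _ = ε * (n ^ 3 * 2 ^ c) * B := by ring
      _ ≤ ε * M * B := by
          gcongr
          exact_mod_cast hM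
  refine le_of_mul_le_mul_left ?_ (Nat.cast_pos.2 hM₀ : (0 : ℝ) < M)
  calc (M * A : ℝ) ≤ a * (M * B + n * (F + 1)) := hle
    _ ≤ a * (M * B + ε * M * B) := by gcongr
    _ = M * ((1 + ε) * a * B) := by ring

namespace SoftCkMInst

variable {I : SoftCkMInst}

section fairInst

variable {W : ℕ × ℕ → ℕ} (hW : IsNatMetric I.space.n W) (hu : 1 ≤ I.u) (hn : 0 < I.space.n) (c : ℕ)
include hW hu hn

theorem fallbackCost_le (R : SoftCkMSol I) :
    I.fallbackCost W ≤ I.space.n * I.space.n * R.natCost W :=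
  totalCost_fallback_table_le hW hn hu R

theorem exists_fairSol_of_sol (R : SoftCkMSol I) :
    ∃ S : PairwiseFairSol (fairInst c hW hu), (pairwiseFairKMedian 2).cost _ S ≤
      (2 ^ I.numHalvings c * R.natCost W + I.space.n * (I.fallbackCost W + 1) : ℕ) := by
  obtain ⟨S, hS⟩ := R.exists_fairSol_cost_le hn (hW.truncate (Nat.succ_pos _))
    (fun _ => min_le_right _ _) (I.n_le_two_pow_numHalvings c)
    (Nat.mul_pos hu (Nat.two_pow_pos (I.numHalvings c)))
  refine ⟨S, hS.trans (Nat.cast_le.2 ?_)⟩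
  gcongr
  exact Finset.sum_le_sum fun _ _ => min_le_left _ _

theorem nonempty_fairSol (hk : I.space.n ≤ I.k * I.u) :
    Nonempty (PairwiseFairSol (fairInst c hW hu)) := by
  obtain ⟨f, -, hf, hpack⟩ := exists_fallback_table_eq_map hW hn hu hk
  obtain ⟨R, -⟩ := SoftCkMSol.exists_of_pack hu hf hpack
  obtain ⟨S, -⟩ := exists_fairSol_of_sol hW hu hn c R
  exact ⟨S⟩

theorem natCost_le_of_isApprox {ε a : ℝ} (hc : 2 ≤ ε * 2 ^ c) (ha : 0 ≤ a)
    {S : PairwiseFairSol (fairInst c hW hu)} (hS : (pairwiseFairKMedian 2).IsApprox a S)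
    {R : SoftCkMSol I} (hR : R.natCost W ≤ I.fallbackCost W)
    (hRS : ((2 ^ I.numHalvings c * R.natCost W : ℕ) : ℚ≥0) ≤ (pairwiseFairKMedian 2).cost _ S)
    (R' : SoftCkMSol I) : (R.natCost W : ℝ) ≤ (1 + ε) * a * R'.natCost W := by
  obtain ⟨S', hS'⟩ := exists_fairSol_of_sol hW hu hn c R'
  refine le_one_add_mul_of_scaled_le ha hc (I.pow_mul_le_two_pow_numHalvings c)
    (Nat.two_pow_pos _) hR (fallbackCost_le hW hu hn R') ?_
  calc ((2 ^ I.numHalvings c : ℕ) * R.natCost W : ℝ)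
      ≤ (pairwiseFairKMedian 2).cost _ S := by exact_mod_cast hRS
    _ ≤ a * (pairwiseFairKMedian 2).cost _ S' := hS S'
    _ ≤ a * ((2 ^ I.numHalvings c : ℕ) * R'.natCost W + I.space.n * (I.fallbackCost W + 1)) := by
        gcongr
        exact_mod_cast hS'

end fairInst

theorem exists_fairInst (hn : 0 < I.space.n) (hk : I.space.n ≤ I.k * I.u) {ε : ℝ} {c : ℕ}
    (hc : 2 ≤ ε * 2 ^ c) :
    ∃ J : PairwiseFairInst 2, J.encode = enc (I.data.fairData c) ∧ J.k = I.k ∧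
      Nonempty (PairwiseFairSol J) ∧ ∀ (a : ℝ) (S : PairwiseFairSol J), 0 ≤ a →
        (pairwiseFairKMedian 2).IsApprox a S → ∃ R : SoftCkMSol I,
          softCapacitatedKMedian.encSol I R = enc (I.data.solution c S.lists) ∧
          softCapacitatedKMedian.IsApprox ((1 + ε) * a) R := by
  have hu : 1 ≤ I.u := Nat.pos_of_mul_pos_left (hn.trans_le hk)
  obtain ⟨L, hL, W, hT, hW, hWL⟩ := I.space.exists_distTable_eq
  refine ⟨fairInst c hW hu, encode_fairInst c hW hu hT, rfl,
    nonempty_fairSol hW hu hn c hk, fun a S ha hS => ?_⟩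
  obtain ⟨R, henc, hR, hRS⟩ := exists_sol_of_fairSol c hW hu hT hn hk S
  refine ⟨R, henc, fun R' => le_of_mul_le_mul_left ?_ (Nat.cast_pos.2 hL : (0 : ℝ) < L)⟩
  have hscale (Q : SoftCkMSol I) :
      (L * softCapacitatedKMedian.cost I Q : ℝ) = Q.natCost W := by
    exact_mod_cast (Q.natCost_eq_mul_cost hWL).symm
  calc (L * softCapacitatedKMedian.cost I R : ℝ) = R.natCost W := hscale R
    _ ≤ (1 + ε) * a * SoftCkMSol.natCost R' W :=
        natCost_le_of_isApprox hW hu hn c hc ha hS hR hRS R'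
    _ = L * ((1 + ε) * a * softCapacitatedKMedian.cost I R') := by
        rw [← hscale R', mul_left_comm]

theorem exists_sol_of_n_eq_zero (hn : I.space.n = 0) (a : ℝ) :
    ∃ S : SoftCkMSol I, softCapacitatedKMedian.encSol I S = enc (([], []) : List ℕ × List ℕ) ∧
      softCapacitatedKMedian.IsApprox a S := by
  obtain ⟨S, henc, -⟩ := SoftCkMSol.exists_of_lists (I := I) (F := []) (a := []) (f := id)
    (Nat.zero_le _) (by simp) (by simp [hn]) (by simp)
  have : IsEmpty (Fin I.space.n) := by rw [hn]; infer_instance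
  have hcost (S : SoftCkMSol I) : softCapacitatedKMedian.cost I S = 0 := by
    change ∑ x : Fin I.space.n, I.space.dist x _ = 0
    exact Fintype.sum_empty _
  exact ⟨S, henc, fun S' => by rw [hcost S, hcost S', NNRat.cast_zero, mul_zero]⟩

end SoftCkMInst

/-! ### Approximation algorithms as polynomial-time functions -/

namespace MinProblem

variable {Q : MinProblem} {β : Type} [Enc β]

instance (Q : MinProblem) : Enc Q.Inst := ⟨Q.encInst⟩

theorem HasPolyTimeApprox.exists_polyTime {α : Q.Inst → ℝ} (h : Q.HasPolyTimeApprox α)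
    {g : ∀ {I}, Q.Sol I → β} (hg : ∀ {I} (S : Q.Sol I), enc (g S) = Q.encSol I S) :
    ∃ A : {I : Q.Inst // Nonempty (Q.Sol I)} → β, PolyTime A ∧
      ∀ I, ∃ S : Q.Sol I.1, A I = g S ∧ Q.IsApprox (α I.1) S := by
  obtain ⟨c, p, hc⟩ := h
  choose y m hy hm hS using hc
  choose S hyS happrox using hS
  refine ⟨fun I => g (S I.1 I.2), ?_, fun I => ⟨S I.1 I.2, rfl, happrox I.1 I.2⟩⟩
  refine ⟨.seq c (.clear c.bound), _, (PolyBounded.encSize.eval p).add (.const (2 + 2 * c.bound)),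
    fun I => ⟨m I.1 + (2 + 2 * c.bound), Nat.add_le_add_right (hm I.1) _, ?_⟩⟩
  rw [hg, ← hyS]
  exact (hy I.1).exec_init

theorem hasPolyTimeApprox_of_polyTime {α : Q.Inst → ℝ} {F : Q.Inst → β} (hF : PolyTime F)
    (h : ∀ I, Nonempty (Q.Sol I) → ∃ S : Q.Sol I, Q.encSol I S = enc (F I) ∧
      Q.IsApprox (α I) S) : Q.HasPolyTimeApprox α := by
  obtain ⟨c, t, ⟨p, hp⟩, hc⟩ := hF
  refine ⟨c, p, fun I => ?_⟩
  obtain ⟨m, hm, hexec⟩ := hc I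
  refine ⟨enc (F I), m, ⟨_, hexec, rfl⟩, hm.trans (hp I), fun hI => ?_⟩
  obtain ⟨S, hS, happrox⟩ := h I hI
  exact ⟨S, hS.symm, happrox⟩

end MinProblem

namespace SoftCkMInst

/-- The test whether a soft capacitated instance is nonempty and has a feasible solution. -/
def feasible (I : SoftCkMInst) : Bool :=
  decide (0 < I.data.1.length) && decide (I.data.1.length ≤ I.data.2.1 * I.data.2.2)

theorem feasible_iff {I : SoftCkMInst} :
    I.feasible = true ↔ 0 < I.space.n ∧ I.space.n ≤ I.k * I.u := by
  rw [feasible, length_matrix, Bool.and_eq_true, decide_eq_true_eq, decide_eq_true_eq]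
  rfl

theorem polyTime_data : PolyTime fun I : softCapacitatedKMedian.Inst => data I :=
  .of_enc_eq enc_data

theorem polyTime_feasible : PolyTime fun I : softCapacitatedKMedian.Inst => feasible I :=
  ((PolyTime.const 0).decide_lt polyTime_data.fst.length).and
    (polyTime_data.fst.length.decide_le (polyTime_data.snd.fst.mul polyTime_data.snd.snd))

end SoftCkMInst

theorem exists_le_mul_two_pow {ε : ℝ} (hε : 0 < ε) (b : ℝ) : ∃ c : ℕ, b ≤ ε * 2 ^ c := by
  obtain ⟨c, hc⟩ := pow_unbounded_of_one_lt (b / ε) one_lt_two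
  exact ⟨c, ((div_lt_iff₀' hε).1 hc).le⟩

theorem exists_polyTime_reduction {ε : ℝ} {c : ℕ} (hc : 2 ≤ ε * 2 ^ c) :
    ∃ J : {I : softCapacitatedKMedian.Inst // SoftCkMInst.feasible I = true} →
        {J : (pairwiseFairKMedian 2).Inst // Nonempty ((pairwiseFairKMedian 2).Sol J)},
      PolyTime J ∧ ∀ I, (J I).1.k = I.1.k ∧
        ∀ (a : ℝ) (S : PairwiseFairSol (J I).1), 0 ≤ a → (pairwiseFairKMedian 2).IsApprox a S →
          ∃ R : SoftCkMSol I.1,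
            softCapacitatedKMedian.encSol I.1 R = enc (I.1.data.solution c S.lists) ∧
            softCapacitatedKMedian.IsApprox ((1 + ε) * a) R := by
  have hex (I : {I : softCapacitatedKMedian.Inst // SoftCkMInst.feasible I = true}) :=
    have hI := SoftCkMInst.feasible_iff.1 I.2
    SoftCkMInst.exists_fairInst hI.1 hI.2 hc
  choose J henc hk hne happrox using hex
  exact ⟨fun I => ⟨J I, hne I⟩,
    ((SoftCkMInst.polyTime_data.comp .subtype_val).fairData c).congr_enc henc,
    fun I => ⟨hk I, happrox I⟩⟩

theorem theorem2 (α : ℕ → ℝ) (hα : ∀ k, 1 ≤ α k)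
    (h : (pairwiseFairKMedian 2).HasPolyTimeApprox
      fun I : PairwiseFairInst 2 => α I.k) :
    ∀ ε : ℝ, 0 < ε →
      softCapacitatedKMedian.HasPolyTimeApprox
        fun I : SoftCkMInst => (1 + ε) * α I.k := by
  intro ε hε
  obtain ⟨c, hc⟩ := exists_le_mul_two_pow hε 2
  obtain ⟨A, hA, hAS⟩ := h.exists_polyTime PairwiseFairSol.enc_lists
  obtain ⟨J, hJ, hJR⟩ := exists_polyTime_reduction hc
  have hsolution :=
    (SoftCkMInst.polyTime_data.comp PolyTime.subtype_val).solution c (hA.comp hJ)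
  refine MinProblem.hasPolyTimeApprox_of_polyTime
    (SoftCkMInst.polyTime_feasible.dite hsolution (.const ([], []))) ?_
  rintro I ⟨S₀⟩
  by_cases hI : SoftCkMInst.feasible I = true
  · obtain ⟨hk, happrox⟩ := hJR ⟨I, hI⟩
    obtain ⟨S, hS, hSα⟩ := hAS (J ⟨I, hI⟩)
    rw [dif_pos hI, hS]
    exact happrox _ S (zero_le_one.trans (hα _)) (hk ▸ hSα)
  · have hn : ¬ 0 < I.space.n := fun hn => hI (SoftCkMInst.feasible_iff.2 ⟨hn, S₀.card_le⟩)
    rw [dif_neg hI]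
    exact SoftCkMInst.exists_sol_of_n_eq_zero (Nat.eq_zero_of_not_pos hn) _
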